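/- **Setting.** Let $(\Omega,\mathcal F,P)$ be a probability space and $\Omega_X,\Omega_M,\Omega_Y$ separable metric spaces. There are potential mediators $M(x)$ and potential outcomes $Y(x,m)$ for $x\in\Omega_X$, $m\in\Omega_M$, and observed random elements $X$, $M=M(X)$, $Y=Y(X,M)$. As random functions of their indices (jointly measurable with respect to σ-algebras having these independence properties), the potential outcomes satisfy $Y(\cdot,\cdot)\perp X$, $Y(\cdot,\cdot)\perp M\mid X$, $M(\cdot)\perp X$, and $Y(\cdot,\cdot)\perp M(x')$ for all $x'$. Let $\rho:\Omega_Y\to\mathcal H$ be an isometry into a separable real Hilbert space, $V=\rho(Y)$, $V(x,m)=\rho(Y(x,m))$. All $V(x,m)$ and $V(x,M(x'))$ are Bochner integrable and $\mathbb E[V(x,m)]\in\rho(\Omega_Y)$. Put $$\mathrm{NDE}=\mathbb E[V(x,M(x))]-\mathbb E[V(x^*,M(x))],\qquad \mathrm{NIE}=\mathbb E[V(x^*,M(x))]-\mathbb E[V(x^*,M(x^*))].$$ Let $\mathcal X,\mathcal M$ be separable reproducing kernel Hilbert spaces on $\Omega_X,\Omega_M$ with continuous kernels $\kappa_X,\kappa_M$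 and feature maps $\tau_X(x)=\kappa_X(\cdot,x)$, $\tau_M(m)=\kappa_M(\cdot,m)$; let $\mathcal Z=\mathcal X\oplus\mathcal M$ (orthogonal sum), $\tau_Z(x,m)=(\tau_X(x),\tau_M(m))$, so that the kernel is $\kappa_Z=\kappa_X+\kappa_M$, and $Z=(X,M)$. With $(a\otimes b)f=\langle b,f\rangle a$, means $\mu_X,\mu_M$ of $\tau_X(X),\tau_M(M)$ and $\mu_Z=(\mu_X,\mu_M)$, let $\Sigma_{XX},\Sigma_{XM},\Sigma_{MX},\Sigma_{MM},\Sigma_{ZZ}$ be the (cross-)covariance operators of the features, $\Sigma_{MV}=\mathrm{Cov}(\tau_M(M),V_I)$, $\Sigma_{XV}=\mathrm{Cov}(\tau_X(X),V_D)$, $\Sigma_{ZV}=\mathrm{Cov}(\tau_Z(Z),V)$, and $\dagger$ the Moore–Penrose inverse. **Assumptions.** 1. $V=V_I+V_D$ with $V_I\perp X\mid M$ and $V_D\perp M\mid X$, and $V_I,V_D$ integrable. 2. $\kappa_M(M,M)$, $\sqrt{\kappa_M(M,M)}\|V_I\|$, $\kappa_X(X,X)$, $\sqrt{\kappa_X(X,X)}\|V_D\|$,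 $\sqrt{\kappa_X(X,X)}\|\tau_M(M)\|$ and $\sqrt{\kappa_Z(Z,Z)}\|V\|$ have finite mean; moreover $\mathbb E[\kappa_X(X,X)^2]$, $\mathbb E[\kappa_M(M,M)^2]$ and $\mathbb E\|V\|^4$ are finite. 3. $\mathrm{ran}\,\Sigma_{XM},\mathrm{ran}\,\Sigma_{XV}\subset\mathrm{ran}\,\Sigma_{XX}$; $\mathrm{ran}\,\Sigma_{MX},\mathrm{ran}\,\Sigma_{MV}\subset\mathrm{ran}\,\Sigma_{MM}$; $\mathrm{ran}\,\Sigma_{ZV}\subset\mathrm{ran}\,\Sigma_{ZZ}$; and $R_{XM}=\Sigma_{XX}^\dagger\Sigma_{XM}$, $R_{XV}=\Sigma_{XX}^\dagger\Sigma_{XV}$, $R_{MV}=\Sigma_{MM}^\dagger\Sigma_{MV}$, $R_{ZV}=\Sigma_{ZZ}^\dagger\Sigma_{ZV}$ are bounded. Write $$\Phi(x)=\mu_M+R_{XM}^*(\tau_X(x)-\mu_X),\quad \Psi(m)=\mathbb E V_I+R_{MV}^*(\tau_M(m)-\mu_M),\quad \gamma(x)=\mathbb E V_D+R_{XV}^*(\tau_X(x)-\mu_X).$$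 4. Almost surely $\mathbb E[\tau_M(M)\mid X]=\Phi(X)$, $\mathbb E[V_I\mid M]=\Psi(M)$, $\mathbb E[V_D\mid X]=\gamma(X)$. 5. $V_I-\Psi(M)\perp X$ and $V_D-\gamma(X)\perp M$. 6. For some $\eta,\tilde\eta\in(0,1]$ and bounded operators $S_{ZV}:\mathcal H\to\mathcal Z$, $S_{XM}:\mathcal M\to\mathcal X$: $\Sigma_{ZV}=\Sigma_{ZZ}^{1+\tilde\eta}S_{ZV}$ and $\Sigma_{XM}=\Sigma_{XX}^{1+\eta}S_{XM}$. **Estimators.** Let $(X_i,M_i,Y_i)$, $i=1,2,\dots$, be i.i.d. copies of $(X,M,Y)$, $V_i=\rho(Y_i)$. From the first $n$ observations form sample means $\hat\mu_X,\hat\mu_M,\hat\mu_Z,\mathbb E_n[V]$ and the empirical covariance operators, and let $\hat\Sigma_{XX}^\dagger=(\hat\Sigma_{XX}+\epsilon I)^{-1}$, $\hat\Sigma_{ZZ}^\dagger=(\hat\Sigma_{ZZ}+\tilde\epsilon I)^{-1}$, where $\epsilon=\epsilon_n>0$, $\tilde\epsilon=\tilde\epsilon_n>0$. Put $\hat\Phi(x)=\hat\mu_M+\hat\Sigma_{MX}\hat\Sigma_{XX}^\dagger(\tau_X(x)-\hat\mu_X)$,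 $\hat\Psi(m)+\hat\gamma(x)=\mathbb E_n[V]+\hat\Sigma_{VZ}\hat\Sigma_{ZZ}^\dagger(\tau_Z(x,m)-\hat\mu_Z)$, $$\widehat{\mathrm{NDE}}=\hat\Sigma_{VZ}\hat\Sigma_{ZZ}^\dagger(\tau_X(x)-\tau_X(x^*)),\qquad \widehat{\mathrm{NIE}}=\hat\Sigma_{VZ}\hat\Sigma_{ZZ}^\dagger\hat\Sigma_{MX}\hat\Sigma_{XX}^\dagger(\tau_X(x)-\tau_X(x^*)).$$ **Theorem.** Let $\epsilon\to0$ and $\tilde\epsilon\to0$ as $n\to\infty$. For all $x,x^*\in\Omega_X$ and $m\in\Omega_M$: (a) $\|\hat\Phi(x)-\Phi(x)\|=O_P(\epsilon^{-1}n^{-1/2}+\epsilon^{\eta})$. (b) If the additive decomposition is identifiable, i.e. for $f\in\mathcal X$, $g\in\mathcal M$ the sum $f(X)+g(M)$ is a.s. constant only if $f(X)$ and $g(M)$ are, then $\|\hat\Psi(m)+\hat\gamma(x)-\Psi(m)-\gamma(x)\|=O_P(\tilde\epsilon^{-1}n^{-1/2}+\tilde\epsilon^{\tilde\eta})$. (c),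 (d) If positivity holds, i.e. the law of $(X,M)$ charges every nonempty open subset of $\Omega_X\times\Omega_M$, and the means $x\mapsto\mathbb E[\tau_M(M(x))]$ and $(x,m)\mapsto\mathbb E[V(x,m)]$ exist and are continuous, then $$\|\widehat{\mathrm{NDE}}-\mathrm{NDE}\|=O_P(\tilde\epsilon^{-1}n^{-1/2}+\tilde\epsilon^{\tilde\eta}),\qquad \|\widehat{\mathrm{NIE}}-\mathrm{NIE}\|=O_P(\tilde\epsilon^{-1}n^{-1/2}+\tilde\epsilon^{\tilde\eta}+\epsilon^{-1}n^{-1/2}+\epsilon^{\eta}).$$ -/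

import Mathlib

open MeasureTheory ProbabilityTheory Filter Topology

noncomputable section

/-! ### Operators on Hilbert spaces -/

section Operators

variable {E F : Type*} [NormedAddCommGroup E] [InnerProductSpace ℝ E] [CompleteSpace E]
  [NormedAddCommGroup F] [InnerProductSpace ℝ F] [CompleteSpace F]

/-- The tensor product `a ⊗ b`, that is, the operator `f ↦ ⟪b, f⟫ a`. -/
def tensorOp (a : E) (b : F) : F →L[ℝ] E := InnerProductSpace.rankOne ℝ a b

/-- The cross-covariance operator `𝔼[(A - 𝔼 A) ⊗ (B - 𝔼 B)] : F → E`, a Bochner integral. -/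
def crossCov {Ω : Type*} [MeasurableSpace Ω] (P : Measure Ω) (A : Ω → E) (B : Ω → F) :
    F →L[ℝ] E :=
  ∫ ω, tensorOp (A ω - ∫ ω', A ω' ∂P) (B ω - ∫ ω', B ω' ∂P) ∂P

open Classical in
/-- The Moore-Penrose inverse of a self-adjoint operator `S`, the inverse of the restriction of
`S` to the closure of its range. It is a function on the range of `S`, extended by zero. -/
def moorePenrose (S : E →L[ℝ] E) (y : E) : E :=
  if h : ∃ x ∈ (LinearMap.range (S : E →ₗ[ℝ] E)).topologicalClosure, S x = y
  then h.choose else 0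

/-- `ran C ⊆ ran S`, and the regression operator `S† C` is a bounded operator. -/
def HasRegressionOp (S : E →L[ℝ] E) (C : F →L[ℝ] E) : Prop :=
  LinearMap.range (C : F →ₗ[ℝ] E) ≤ LinearMap.range (S : E →ₗ[ℝ] E) ∧
    ∃ R : F →L[ℝ] E, ∀ v, R v = moorePenrose S (C v)

open Classical in
/-- The regression operator `R = S† C` as a bounded operator (zero if it is not bounded). -/
def regressionOp (S : E →L[ℝ] E) (C : F →L[ℝ] E) : F →L[ℝ] E :=
  if h : ∃ R : F →L[ℝ] E, ∀ v, R v = moorePenrose S (C v) then h.choose else 0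

/-- The power `T ^ s f = ∑ λ ^ s • (projection of f to the eigenspace of λ)`, the sum being over
all eigenvalues `λ` of `T`, for a compact nonnegative self-adjoint operator `T` and `s > 0`.
The sum may be taken over all reals, since the eigenspace of a non-eigenvalue is zero. -/
def opPow (T : E →L[ℝ] E) (s : ℝ) (f : E) : E :=
  ∑' t : ℝ, t ^ s •
    (T - t • ContinuousLinearMap.id ℝ E).ker.starProjection f

/-! ### Empirical versions, from the first `n` terms of a sequence of observations -/

/-- The sample mean. -/
def empMean (n : ℕ) (A : ℕ → E) : E := (n : ℝ)⁻¹ • ∑ i ∈ Finset.range n, A i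

/-- The empirical cross-covariance operator. -/
def empCov (n : ℕ) (A : ℕ → E) (B : ℕ → F) : F →L[ℝ] E :=
  (n : ℝ)⁻¹ • ∑ i ∈ Finset.range n, tensorOp (A i - empMean n A) (B i - empMean n B)

/-- The Tikhonov regularized inverse `(T + ε I)⁻¹`. -/
def tikhonov (T : E →L[ℝ] E) (ε : ℝ) : E →L[ℝ] E :=
  Ring.inverse (T + ε • ContinuousLinearMap.id ℝ E)

/-- The empirical regression operator of `B` on `A`, that is, the empirical cross-covariance
`F ← E` composed with the Tikhonov regularized inverse of the empirical covariance on `E`. -/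
def empRegression (n : ℕ) (ε : ℝ) (A : ℕ → E) (B : ℕ → F) : E →L[ℝ] F :=
  (empCov n B A).comp (tikhonov (empCov n A A) ε)

end Operators

/-! ### Probability -/

/-- `T n = O_P(r n)`. -/
def IsBigOInProbability {Ω : Type*} [MeasurableSpace Ω] (Q : Measure Ω)
    (T : ℕ → Ω → ℝ) (r : ℕ → ℝ) : Prop :=
  ∀ δ : ℝ, 0 < δ → ∃ C : ℝ, ∀ᶠ n in atTop, Q {ω | C * r n < |T n ω|} ≤ ENNReal.ofReal δ

/-- Conditional independence of the σ-algebras `m₁` and `m₂` given the σ-algebra `m`. -/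
def CondIndepGiven {Ω : Type*} {mΩ : MeasurableSpace Ω} (P : Measure Ω)
    (m₁ m₂ m : MeasurableSpace Ω) : Prop :=
  ∀ A B : Set Ω, MeasurableSet[m₁] A → MeasurableSet[m₂] B →
    P[(A ∩ B).indicator (fun _ => (1 : ℝ)) | m] =ᵐ[P]
      fun ω => (P[A.indicator (fun _ => (1 : ℝ)) | m]) ω *
        (P[B.indicator (fun _ => (1 : ℝ)) | m]) ω

/-- The σ-algebra generated by a random element. -/
abbrev sigmaOf {Ω S : Type*} [mS : MeasurableSpace S] (f : Ω → S) : MeasurableSpace Ω :=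
  MeasurableSpace.comap f mS

/-- The independence conditions `Y(x, m) ⫫ X`, `Y(x, m) ⫫ M | X`, `M(x) ⫫ X` and
`Y(x, m) ⫫ M(x')`, for the potential outcomes as random functions of their indices: `𝒢Y` and
`𝒢M` are σ-algebras with respect to which the random functions `Y(·, ·)` and `M(·)` are
(jointly) measurable. -/
def IsIgnorable {Ω ΩX ΩM ΩY : Type*} {mΩ : MeasurableSpace Ω} [mX : MeasurableSpace ΩX]
    [mM : MeasurableSpace ΩM] [mY : MeasurableSpace ΩY] (P : Measure Ω)
    (X : Ω → ΩX) (M : Ω → ΩM) (Mpot : ΩX → Ω → ΩM) (Ypot : ΩX → ΩM → Ω → ΩY) : Prop :=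
  ∃ 𝒢Y 𝒢M : MeasurableSpace Ω, 𝒢Y ≤ mΩ ∧ 𝒢M ≤ mΩ ∧
    Measurable[(mX.prod mM).prod 𝒢Y, mY] (fun p : (ΩX × ΩM) × Ω => Ypot p.1.1 p.1.2 p.2) ∧
    Measurable[mX.prod 𝒢M, mM] (fun p : ΩX × Ω => Mpot p.1 p.2) ∧
    Indep 𝒢Y (sigmaOf X) P ∧
    CondIndepGiven P 𝒢Y (sigmaOf M) (sigmaOf X) ∧
    Indep 𝒢M (sigmaOf X) P ∧
    ∀ x' : ΩX, Indep 𝒢Y (sigmaOf (Mpot x')) P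

/-! ### The reproducing kernel Hilbert spaces -/

section Kernels

variable {S : Type*} (𝒦 : Type*) [NormedAddCommGroup 𝒦] [InnerProductSpace ℝ 𝒦]
  [CompleteSpace 𝒦] [RKHS ℝ 𝒦 S ℝ]

/-- The feature map `x ↦ κ(·, x)` of a reproducing kernel Hilbert space. -/
def featureMap (x : S) : 𝒦 := RKHS.kerFun 𝒦 x 1

/-- The real-valued reproducing kernel. -/
def realKernel (x y : S) : ℝ := RKHS.kernel 𝒦 x y 1

end Kernels

/-! ### The mediation model -/

/-- The data of the mediation model: a probability space, the observed exposure, mediator and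
outcome, the potential mediators `M(x)` and potential outcomes `Y(x, m)`, the embedding `ρ` of
the outcome space, and the two parts of the embedded outcome. -/
structure MediationModel (Ω ΩX ΩM ΩY H : Type*) [MeasurableSpace Ω] where
  P : Measure Ω
  X : Ω → ΩX
  M : Ω → ΩM
  Y : Ω → ΩY
  Mpot : ΩX → Ω → ΩM
  Ypot : ΩX → ΩM → Ω → ΩY
  ρ : ΩY → H
  VI : Ω → H
  VD : Ω → H

namespace MediationModel

variable {Ω ΩX ΩM ΩY H : Type*} [MeasurableSpace Ω]

section Outcome

variable (𝔐 : MediationModel Ω ΩX ΩM ΩY H)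

/-- The embedded outcome `V = ρ(Y)`. -/
def V (ω : Ω) : H := 𝔐.ρ (𝔐.Y ω)

/-- The embedded potential outcome `V(x, m) = ρ(Y(x, m))`. -/
def Vpot (x : ΩX) (m : ΩM) (ω : Ω) : H := 𝔐.ρ (𝔐.Ypot x m ω)

variable [NormedAddCommGroup H] [InnerProductSpace ℝ H]

/-- The mean `𝔼[V(x, M(x'))]` of a nested embedded potential outcome. -/
def nestedMean (x x' : ΩX) : H := ∫ ω, 𝔐.Vpot x (𝔐.Mpot x' ω) ω ∂𝔐.P

/-- The natural direct effect `𝔼[V(x, M(x))] - 𝔼[V(x*, M(x))]`. -/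
def NDE (x xs : ΩX) : H := 𝔐.nestedMean x x - 𝔐.nestedMean xs x

/-- The natural indirect effect `𝔼[V(x*, M(x))] - 𝔼[V(x*, M(x*))]`. -/
def NIE (x xs : ΩX) : H := 𝔐.nestedMean xs x - 𝔐.nestedMean xs xs

end Outcome

section Population

variable [NormedAddCommGroup H] [InnerProductSpace ℝ H] [CompleteSpace H]

variable (𝔐 : MediationModel Ω ΩX ΩM ΩY H)
  (𝒳 : Type*) [NormedAddCommGroup 𝒳] [InnerProductSpace ℝ 𝒳] [CompleteSpace 𝒳]
  [RKHS ℝ 𝒳 ΩX ℝ]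
  (ℳ : Type*) [NormedAddCommGroup ℳ] [InnerProductSpace ℝ ℳ] [CompleteSpace ℳ]
  [RKHS ℝ ℳ ΩM ℝ]

/-- The random feature `τ_X(X)`. -/
def featX (ω : Ω) : 𝒳 := featureMap 𝒳 (𝔐.X ω)

/-- The random feature `τ_M(M)`. -/
def featM (ω : Ω) : ℳ := featureMap ℳ (𝔐.M ω)

/-- The joint space, in which `𝒳` and `ℳ` are combined orthogonally. The pair `(f, g)` stands
for the additive function `(x, m) ↦ f x + g m`. -/
abbrev JointSpace (𝒳 ℳ : Type*) : Type _ := WithLp 2 (𝒳 × ℳ)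

/-- The joint feature map `(x, m) ↦ (τ_X(x), τ_M(m))`. The kernel that it defines on `ΩX × ΩM`
is the additive kernel `κ_Z = κ_X + κ_M`. -/
def jointFeature (x : ΩX) (m : ΩM) : JointSpace 𝒳 ℳ :=
  WithLp.toLp 2 (featureMap 𝒳 x, featureMap ℳ m)

/-- The random feature `κ_Z(·, Z)`, for `Z = (X, M)`. -/
def featZ (ω : Ω) : JointSpace 𝒳 ℳ := jointFeature 𝒳 ℳ (𝔐.X ω) (𝔐.M ω)

/-- The mean elements `μ_X` and `μ_M`. -/
def muX : 𝒳 := ∫ ω, 𝔐.featX 𝒳 ω ∂𝔐.P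

def muM : ℳ := ∫ ω, 𝔐.featM ℳ ω ∂𝔐.P

/-- The operators `Σ_XX`, `Σ_MM`, `Σ_XM`, `Σ_MX`, `Σ_MV`, `Σ_XV`, `Σ_ZZ` and `Σ_ZV`; note that
`Σ_MV` is formed with `V_I`, `Σ_XV` with `V_D`, and `Σ_ZV` with `V`. -/
def covXX : 𝒳 →L[ℝ] 𝒳 := crossCov 𝔐.P (𝔐.featX 𝒳) (𝔐.featX 𝒳)

def covMM : ℳ →L[ℝ] ℳ := crossCov 𝔐.P (𝔐.featM ℳ) (𝔐.featM ℳ)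

def covXM : ℳ →L[ℝ] 𝒳 := crossCov 𝔐.P (𝔐.featX 𝒳) (𝔐.featM ℳ)

def covMX : 𝒳 →L[ℝ] ℳ := crossCov 𝔐.P (𝔐.featM ℳ) (𝔐.featX 𝒳)

def covMV : H →L[ℝ] ℳ := crossCov 𝔐.P (𝔐.featM ℳ) 𝔐.VI

def covXV : H →L[ℝ] 𝒳 := crossCov 𝔐.P (𝔐.featX 𝒳) 𝔐.VD

def covZZ : JointSpace 𝒳 ℳ →L[ℝ] JointSpace 𝒳 ℳ :=
  crossCov 𝔐.P (𝔐.featZ 𝒳 ℳ) (𝔐.featZ 𝒳 ℳ)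

def covZV : H →L[ℝ] JointSpace 𝒳 ℳ := crossCov 𝔐.P (𝔐.featZ 𝒳 ℳ) 𝔐.V

/-- The regression operators `R_XM = Σ_XX† Σ_XM`, `R_XV = Σ_XX† Σ_XV` and
`R_MV = Σ_MM† Σ_MV`. -/
def RXM : ℳ →L[ℝ] 𝒳 := regressionOp (𝔐.covXX 𝒳) (𝔐.covXM 𝒳 ℳ)

def RXV : H →L[ℝ] 𝒳 := regressionOp (𝔐.covXX 𝒳) (𝔐.covXV 𝒳)

def RMV : H →L[ℝ] ℳ := regressionOp (𝔐.covMM ℳ) (𝔐.covMV ℳ)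

/-- `Φ(x)`, the weak conditional expectation of `τ_M(M)` given `X = x`, namely
`μ_M + R_XM* (τ_X(x) - μ_X)`. -/
def Phi (x : ΩX) : ℳ :=
  𝔐.muM ℳ + (𝔐.RXM 𝒳 ℳ).adjoint (featureMap 𝒳 x - 𝔐.muX 𝒳)

/-- `Ψ(m)`, the weak conditional expectation of `V_I` given `M = m`. -/
def Psi (m : ΩM) : H :=
  (∫ ω, 𝔐.VI ω ∂𝔐.P) + (𝔐.RMV ℳ).adjoint (featureMap ℳ m - 𝔐.muM ℳ)

/-- `γ(x)`, the weak conditional expectation of `V_D` given `X = x`. -/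
def gam (x : ΩX) : H :=
  (∫ ω, 𝔐.VD ω ∂𝔐.P) + (𝔐.RXV 𝒳).adjoint (featureMap 𝒳 x - 𝔐.muX 𝒳)

end Population

/-! ### The assumptions of the model -/

section Assumptions

variable [MeasurableSpace ΩX] [MeasurableSpace ΩM] [MeasurableSpace ΩY]

/-- Measurability, and consistency (SUTVA). -/
structure Basic (𝔐 : MediationModel Ω ΩX ΩM ΩY H) [MeasurableSpace H] : Prop where
  isProb : IsProbabilityMeasure 𝔐.P
  measX : Measurable 𝔐.X
  measM : Measurable 𝔐.M
  measY : Measurable 𝔐.Y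
  measVI : Measurable 𝔐.VI
  measVD : Measurable 𝔐.VD
  sutvaM : ∀ᵐ ω ∂𝔐.P, 𝔐.M ω = 𝔐.Mpot (𝔐.X ω) ω
  sutvaY : ∀ᵐ ω ∂𝔐.P, 𝔐.Y ω = 𝔐.Ypot (𝔐.X ω) (𝔐.M ω) ω

/-- The independence conditions on the potential outcomes of the model. -/
def Ignorability (𝔐 : MediationModel Ω ΩX ΩM ΩY H) : Prop :=
  IsIgnorable 𝔐.P 𝔐.X 𝔐.M 𝔐.Mpot 𝔐.Ypot

variable [NormedAddCommGroup H] [InnerProductSpace ℝ H] [CompleteSpace H] [MeasurableSpace H]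

/-- Integrability of the embedded potential outcomes, and the Fréchet embedding condition. -/
structure FrechetEmbedding (𝔐 : MediationModel Ω ΩX ΩM ΩY H) : Prop where
  integrable : ∀ x m, Integrable (𝔐.Vpot x m) 𝔐.P
  integrable_nested : ∀ x x', Integrable (fun ω => 𝔐.Vpot x (𝔐.Mpot x' ω) ω) 𝔐.P
  mem_range : ∀ x m, (∫ ω, 𝔐.Vpot x m ω ∂𝔐.P) ∈ Set.range 𝔐.ρ

/-- The decomposition `V = V_I + V_D`, with `V_I ⫫ X | M` and `V_D ⫫ M | X`. -/
structure Decomposition (𝔐 : MediationModel Ω ΩX ΩM ΩY H) : Prop where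
  add : ∀ᵐ ω ∂𝔐.P, 𝔐.V ω = 𝔐.VI ω + 𝔐.VD ω
  condVI : CondIndepGiven 𝔐.P (sigmaOf 𝔐.VI) (sigmaOf 𝔐.X) (sigmaOf 𝔐.M)
  condVD : CondIndepGiven 𝔐.P (sigmaOf 𝔐.VD) (sigmaOf 𝔐.M) (sigmaOf 𝔐.X)

variable (𝔐 : MediationModel Ω ΩX ΩM ΩY H)
  (𝒳 : Type*) [NormedAddCommGroup 𝒳] [InnerProductSpace ℝ 𝒳] [CompleteSpace 𝒳]
  [RKHS ℝ 𝒳 ΩX ℝ]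
  (ℳ : Type*) [NormedAddCommGroup ℳ] [InnerProductSpace ℝ ℳ] [CompleteSpace ℳ]
  [RKHS ℝ ℳ ΩM ℝ]

/-- The moment conditions. Since `κ_Z(Z, Z) = κ_X(X, X) + κ_M(M, M)`, the first moment of
`κ_Z(Z, Z)` is covered by `kX` and `kM`. -/
structure Moments : Prop where
  kX : Integrable (fun ω => realKernel 𝒳 (𝔐.X ω) (𝔐.X ω)) 𝔐.P
  kM : Integrable (fun ω => realKernel ℳ (𝔐.M ω) (𝔐.M ω)) 𝔐.P
  kM_VI : Integrable (fun ω => √(realKernel ℳ (𝔐.M ω) (𝔐.M ω)) * ‖𝔐.VI ω‖) 𝔐.P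
  kX_VD : Integrable (fun ω => √(realKernel 𝒳 (𝔐.X ω) (𝔐.X ω)) * ‖𝔐.VD ω‖) 𝔐.P
  kX_kM : Integrable (fun ω => √(realKernel 𝒳 (𝔐.X ω) (𝔐.X ω)) * ‖𝔐.featM ℳ ω‖) 𝔐.P
  kZ_V : Integrable (fun ω => √(realKernel 𝒳 (𝔐.X ω) (𝔐.X ω) +
    realKernel ℳ (𝔐.M ω) (𝔐.M ω)) * ‖𝔐.V ω‖) 𝔐.P
  VI : Integrable 𝔐.VI 𝔐.P
  VD : Integrable 𝔐.VD 𝔐.P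

/-- Finite fourth moments of the features and of the embedded outcome. -/
structure FourthMoments : Prop where
  kX : Integrable (fun ω => realKernel 𝒳 (𝔐.X ω) (𝔐.X ω) ^ 2) 𝔐.P
  kM : Integrable (fun ω => realKernel ℳ (𝔐.M ω) (𝔐.M ω) ^ 2) 𝔐.P
  V : Integrable (fun ω => ‖𝔐.V ω‖ ^ 4) 𝔐.P

/-- The range conditions and the boundedness of the regression operators. -/
structure Ranges : Prop where
  XM : HasRegressionOp (𝔐.covXX 𝒳) (𝔐.covXM 𝒳 ℳ)
  XV : HasRegressionOp (𝔐.covXX 𝒳) (𝔐.covXV 𝒳)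
  MX : LinearMap.range (𝔐.covMX 𝒳 ℳ : 𝒳 →ₗ[ℝ] ℳ) ≤ LinearMap.range (𝔐.covMM ℳ : ℳ →ₗ[ℝ] ℳ)
  MV : HasRegressionOp (𝔐.covMM ℳ) (𝔐.covMV ℳ)
  ZV : HasRegressionOp (𝔐.covZZ 𝒳 ℳ) (𝔐.covZV 𝒳 ℳ)

/-- The conditional expectations equal their weak counterparts. -/
structure CondExpEqWeak : Prop where
  M_X : 𝔐.P[𝔐.featM ℳ | sigmaOf 𝔐.X] =ᵐ[𝔐.P] fun ω => 𝔐.Phi 𝒳 ℳ (𝔐.X ω)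
  VI_M : 𝔐.P[𝔐.VI | sigmaOf 𝔐.M] =ᵐ[𝔐.P] fun ω => 𝔐.Psi ℳ (𝔐.M ω)
  VD_X : 𝔐.P[𝔐.VD | sigmaOf 𝔐.X] =ᵐ[𝔐.P] fun ω => 𝔐.gam 𝒳 (𝔐.X ω)

/-- `V_I - Ψ(M)` is independent of `X`, and `V_D - γ(X)` is independent of `M`. -/
structure ResidualIndep : Prop where
  VI : IndepFun (fun ω => 𝔐.VI ω - 𝔐.Psi ℳ (𝔐.M ω)) 𝔐.X 𝔐.P
  VD : IndepFun (fun ω => 𝔐.VD ω - 𝔐.gam 𝒳 (𝔐.X ω)) 𝔐.M 𝔐.P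

/-- Identifiability of the additive decomposition: if `f(X) + g(M)` is almost surely constant,
for `f ∈ 𝒳` and `g ∈ ℳ`, then so is `f(X)` (and hence `g(M)`). -/
def AdditivelyIdentifiable : Prop :=
  ∀ (f : 𝒳) (g : ℳ), (∃ c : ℝ, ∀ᵐ ω ∂𝔐.P, f (𝔐.X ω) + g (𝔐.M ω) = c) →
    ∃ c : ℝ, ∀ᵐ ω ∂𝔐.P, f (𝔐.X ω) = c

/-- Positivity: the law of `(X, M)` charges every nonempty open subset of `ΩX × ΩM`. Moreover
the means of the potential features and of the potential embedded outcomes exist and depend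
continuously on the indices. -/
structure Positivity [TopologicalSpace ΩX] [TopologicalSpace ΩM] : Prop where
  support : (𝔐.P.map (fun ω => (𝔐.X ω, 𝔐.M ω))).IsOpenPosMeasure
  integrableM : ∀ x, Integrable (fun ω => featureMap ℳ (𝔐.Mpot x ω)) 𝔐.P
  continuousM : Continuous fun x => ∫ ω, featureMap ℳ (𝔐.Mpot x ω) ∂𝔐.P
  continuousV : Continuous fun p : ΩX × ΩM => ∫ ω, 𝔐.Vpot p.1 p.2 ω ∂𝔐.P

/-- The smoothness conditions `Σ_ZV = Σ_ZZ^(1+η') S_ZV` and `Σ_XM = Σ_XX^(1+η) S_XM`, for some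
bounded operators `S_ZV` and `S_XM`. -/
structure Smoothness (η η' : ℝ) : Prop where
  ZV : ∃ S : H →L[ℝ] JointSpace 𝒳 ℳ,
    ∀ v, 𝔐.covZV 𝒳 ℳ v = opPow (𝔐.covZZ 𝒳 ℳ) (1 + η') (S v)
  XM : ∃ S : ℳ →L[ℝ] 𝒳,
    ∀ g, 𝔐.covXM 𝒳 ℳ g = opPow (𝔐.covXX 𝒳) (1 + η) (S g)

end Assumptions

end MediationModel

/-! ### The estimators -/

section Estimators

variable {ΩX ΩM H : Type*} [NormedAddCommGroup H] [InnerProductSpace ℝ H] [CompleteSpace H]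
  (𝒳 : Type*) [NormedAddCommGroup 𝒳] [InnerProductSpace ℝ 𝒳] [CompleteSpace 𝒳]
  [RKHS ℝ 𝒳 ΩX ℝ]
  (ℳ : Type*) [NormedAddCommGroup ℳ] [InnerProductSpace ℝ ℳ] [CompleteSpace ℳ]
  [RKHS ℝ ℳ ΩM ℝ]
  (n : ℕ) (ε ε' : ℝ) (X : ℕ → ΩX) (M : ℕ → ΩM) (V : ℕ → H)

/-- The empirical operator `Σ̂_MX Σ̂_XX†` with regularization parameter `ε`. -/
def hatRMX : 𝒳 →L[ℝ] ℳ :=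
  empRegression n ε (fun i => featureMap 𝒳 (X i)) (fun i => featureMap ℳ (M i))

/-- The empirical operator `Σ̂_VZ Σ̂_ZZ†` with regularization parameter `ε'`. -/
def hatRVZ : MediationModel.JointSpace 𝒳 ℳ →L[ℝ] H :=
  empRegression n ε' (fun i => MediationModel.jointFeature 𝒳 ℳ (X i) (M i)) V

/-- The estimator `Φ̂(x) = μ̂_M + Σ̂_MX Σ̂_XX† (τ_X(x) - μ̂_X)`. -/
def hatPhi (x : ΩX) : ℳ :=
  empMean n (fun i => featureMap ℳ (M i)) +
    hatRMX 𝒳 ℳ n ε X M (featureMap 𝒳 x - empMean n (fun i => featureMap 𝒳 (X i)))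

/-- The estimator `Ψ̂(m) + γ̂(x) = 𝔼ₙ[V] + Σ̂_VZ Σ̂_ZZ† (κ_Z(·, (x, m)) - μ̂_Z)`. -/
def hatPsiGam (x : ΩX) (m : ΩM) : H :=
  empMean n V + hatRVZ 𝒳 ℳ n ε' X M V
    (MediationModel.jointFeature 𝒳 ℳ x m -
      empMean n (fun i => MediationModel.jointFeature 𝒳 ℳ (X i) (M i)))

/-- The estimator `Σ̂_VZ Σ̂_ZZ† (τ_X(x) - τ_X(x*))` of the natural direct effect. -/
def hatNDE (x xs : ΩX) : H :=
  hatRVZ 𝒳 ℳ n ε' X M V (WithLp.toLp 2 (featureMap 𝒳 x - featureMap 𝒳 xs, 0))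

/-- The estimator `Σ̂_VZ Σ̂_ZZ† Σ̂_MX Σ̂_XX† (τ_X(x) - τ_X(x*))` of the natural indirect
effect. -/
def hatNIE (x xs : ΩX) : H :=
  hatRVZ 𝒳 ℳ n ε' X M V
    (WithLp.toLp 2 (0, hatRMX 𝒳 ℳ n ε X M (featureMap 𝒳 x - featureMap 𝒳 xs)))

end Estimators

end

/-! Every estimator is built from regularized regressions `C' (T' + ε)⁻¹`, where `T'` and `C'` are
empirical versions of a covariance `T` and a cross-covariance `C = R T`. Since `T' (T' + ε)⁻¹ = 1 -
ε (T' + ε)⁻¹`, the error is exactly `(C' - R T') (T' + ε)⁻¹ - ε R (T' + ε)⁻¹`. The first term is at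
most `ε⁻¹ (‖C' - C‖ + ‖R‖ ‖T' - T‖)`. In the second, the resolvent identity replaces `T'` by `T` at
a cost of the same order and leaves the deterministic bias `ε ‖R (T + ε)⁻¹‖`
(`norm_regularized_regression_sub_le`). The source condition says that the adjoint of `R` is `T ^ η
S`, and `ε t ^ η / (t + ε) ≤ ε ^ η` bounds the bias (`HasRegressionOp.regBias_le`). Empirical
covariances err by `O_P(n ^ (-1/2))`: the operator norm is at most the Hilbert-Schmidt norm, whose
mean square is a sum of variances of sample means, finite by the fourth moments
(`IsIIDSample.isBigO_empCov`).

The indirect effect composes two regressions. Multiplying their errors would produce a product of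
rates, which the sum need not dominate, as nothing forces `ε⁻¹ n ^ (-1/2)` to stay bounded. The two
steps share a sample, however. With `h = (Σ̂_XX + ε)⁻¹ t`, the vector `(0, Σ̂_MX h)` that enters the
second regression equals `Σ̂_ZZ (h, 0) - (t, 0) + ε (h, 0)`, so the second regularized inverse maps
it to a vector of norm `O(ε⁻¹ + ε̃⁻¹)` rather than `O(ε⁻¹ ε̃⁻¹)`
(`norm_regularized_regression_comp_sub_le`).

It remains to identify the limits. The residuals `V_I - Ψ(M)` and `V_D - γ(X)` are uncorrelated with
the features of both `X` and `M`, so the pair `(R_XV, R_MV)` solves the normal equation of the joint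
regression; under identifiability it is orthogonal to the kernel of `Σ_ZZ` and hence equals `R_ZV`
(`regressionOp_covZV_eq`). Ignorability and the decomposition give two expressions for `𝔼[V | X,
M]`, and positivity with continuity upgrades their almost sure equality to `𝔼[V(x, m)] = γ(x) +
Ψ(m)` everywhere; similarly `𝔼[τ_M(M(x))] = Φ(x)`. As `Ψ` is affine in the feature, `nestedMean_eq`
follows, so the direct effect is `R_XV* (τ_X(x) - τ_X(x*))` and the indirect effect is `R_MV* R_XM*
(τ_X(x) - τ_X(x*))`. -/

noncomputable section

set_option linter.unusedSectionVars false

/-! ### Tikhonov inverses and the deterministic error of regularized regression. -/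

section RegularizedInverse

variable {E F : Type*} [NormedAddCommGroup E] [InnerProductSpace ℝ E] [CompleteSpace E]
  [NormedAddCommGroup F] [InnerProductSpace ℝ F] [CompleteSpace F]

open scoped InnerProductSpace

/-- Lax-Milgram: the form of `T + ε` is coercive with constant `ε`. Symmetry plays no role. -/
lemma isUnit_add_smul_id {T : E →L[ℝ] E} (hT : ∀ x, 0 ≤ ⟪T x, x⟫_ℝ) {ε : ℝ} (hε : 0 < ε) :
    IsUnit (T + ε • ContinuousLinearMap.id ℝ E) := by
  refine ContinuousLinearMap.isUnit_of_forall_le_norm_inner_map _ (c := ⟨ε, hε.le⟩) hε fun x ↦ ?_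
  have h : ⟪(T + ε • ContinuousLinearMap.id ℝ E) x, x⟫_ℝ = ⟪T x, x⟫_ℝ + ε * ‖x‖ ^ 2 := by
    simp [inner_add_left, inner_smul_left]
  rw [h, Real.norm_eq_abs]
  refine le_trans ?_ (le_abs_self _)
  have := hT x
  change ‖x‖ ^ 2 * ε ≤ _
  linarith

lemma apply_tikhonov {T : E →L[ℝ] E} (hT : ∀ x, 0 ≤ ⟪T x, x⟫_ℝ) {ε : ℝ} (hε : 0 < ε) (y : E) :
    T (tikhonov T ε y) = y - ε • tikhonov T ε y := by
  have h := Ring.mul_inverse_cancel _ (isUnit_add_smul_id hT hε)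
  have h' := congrArg (fun f : E →L[ℝ] E ↦ f y) h
  simp only [mul_apply_eq_comp, add_apply,
    smul_apply, ContinuousLinearMap.id_apply,
    one_apply_eq_self] at h'
  exact eq_sub_of_add_eq h'

lemma tikhonov_apply {T : E →L[ℝ] E} (hT : ∀ x, 0 ≤ ⟪T x, x⟫_ℝ) {ε : ℝ} (hε : 0 < ε) (y : E) :
    tikhonov T ε (T y) = y - ε • tikhonov T ε y := by
  have h := Ring.inverse_mul_cancel _ (isUnit_add_smul_id hT hε)
  have h' := congrArg (fun f : E →L[ℝ] E ↦ f y) h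
  simp only [mul_apply_eq_comp, add_apply,
    smul_apply, ContinuousLinearMap.id_apply,
    one_apply_eq_self, map_add, map_smul] at h'
  exact eq_sub_of_add_eq h'

lemma eq_tikhonov {T : E →L[ℝ] E} (hT : ∀ x, 0 ≤ ⟪T x, x⟫_ℝ) {ε : ℝ} (hε : 0 < ε) {x y : E}
    (h : T x + ε • x = y) : x = tikhonov T ε y := by
  rw [← h, map_add, tikhonov_apply hT hε, map_smul, sub_add_cancel]

/-- For positive `T` and `ε`, all three terms on the right are nonnegative, so `‖T y‖` and `ε ‖y‖`
are each at most `‖(T + ε) y‖`. Both resolvent bounds below come from this expansion. -/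
lemma norm_add_smul_sq {T : E →L[ℝ] E} (ε : ℝ) (y : E) :
    ‖T y + ε • y‖ ^ 2 = ‖T y‖ ^ 2 + 2 * (ε * ⟪T y, y⟫_ℝ) + (ε * ‖y‖) ^ 2 := by
  rw [norm_add_sq_real, inner_smul_right, norm_smul, mul_pow, mul_pow, Real.norm_eq_abs, sq_abs]

lemma norm_tikhonov_le {T : E →L[ℝ] E} (hT : ∀ x, 0 ≤ ⟪T x, x⟫_ℝ) {ε : ℝ} (hε : 0 < ε) (y : E) :
    ‖tikhonov T ε y‖ ≤ ε⁻¹ * ‖y‖ := by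
  have h := norm_add_smul_sq (T := T) ε (tikhonov T ε y)
  rw [apply_tikhonov hT hε, sub_add_cancel] at h
  have h1 := mul_nonneg hε.le (hT (tikhonov T ε y))
  rw [apply_tikhonov hT hε] at h1
  have h2 : (ε * ‖tikhonov T ε y‖) ^ 2 ≤ ‖y‖ ^ 2 := by
    rw [h]; nlinarith [sq_nonneg ‖y - ε • tikhonov T ε y‖]
  have h3 := (pow_le_pow_iff_left₀ (by positivity) (norm_nonneg y) two_ne_zero).1 h2
  rw [inv_mul_eq_div, le_div_iff₀ hε]
  linarith

lemma norm_apply_tikhonov_le {T : E →L[ℝ] E} (hT : ∀ x, 0 ≤ ⟪T x, x⟫_ℝ) {ε : ℝ} (hε : 0 < ε)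
    (y : E) : ‖T (tikhonov T ε y)‖ ≤ ‖y‖ := by
  have h := norm_add_smul_sq (T := T) ε (tikhonov T ε y)
  have h1 := mul_nonneg hε.le (hT (tikhonov T ε y))
  have h0 : T (tikhonov T ε y) + ε • tikhonov T ε y = y := by
    rw [apply_tikhonov hT hε, sub_add_cancel]
  rw [h0] at h
  refine (pow_le_pow_iff_left₀ (norm_nonneg _) (norm_nonneg y) two_ne_zero).1 ?_
  nlinarith [sq_nonneg (ε * ‖tikhonov T ε y‖)]

lemma tikhonov_apply_comm {T : E →L[ℝ] E} (hT : ∀ x, 0 ≤ ⟪T x, x⟫_ℝ) {ε : ℝ} (hε : 0 < ε) (y : E) :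
    tikhonov T ε (T y) = T (tikhonov T ε y) := by
  rw [tikhonov_apply hT hε, apply_tikhonov hT hε]

lemma tikhonov_sub_tikhonov {T T' : E →L[ℝ] E} (hT : ∀ x, 0 ≤ ⟪T x, x⟫_ℝ)
    (hT' : ∀ x, 0 ≤ ⟪T' x, x⟫_ℝ) {ε : ℝ} (hε : 0 < ε) (y : E) :
    tikhonov T' ε y = tikhonov T ε y - tikhonov T ε ((T' - T) (tikhonov T' ε y)) := by
  rw [sub_apply, map_sub, tikhonov_apply hT hε, apply_tikhonov hT' hε, map_sub,
    map_smul]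
  abel

lemma adjoint_tikhonov {T : E →L[ℝ] E} (hT : ∀ x, 0 ≤ ⟪T x, x⟫_ℝ)
    (hsymm : ∀ x y, ⟪T x, y⟫_ℝ = ⟪x, T y⟫_ℝ) {ε : ℝ} (hε : 0 < ε) (x y : E) :
    ⟪tikhonov T ε x, y⟫_ℝ = ⟪x, tikhonov T ε y⟫_ℝ := by
  have h1 : T (tikhonov T ε x) + ε • tikhonov T ε x = x := by
    rw [apply_tikhonov hT hε, sub_add_cancel]
  have h2 : T (tikhonov T ε y) + ε • tikhonov T ε y = y := by
    rw [apply_tikhonov hT hε, sub_add_cancel]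
  conv_lhs => rw [← h2]
  conv_rhs => rw [← h1]
  rw [inner_add_left, inner_add_right, hsymm, inner_smul_left, inner_smul_right]
  simp

/-- The regularization bias. -/
def regBias (T : E →L[ℝ] E) (R : E →L[ℝ] F) (ε : ℝ) : ℝ := ε * ‖R ∘L tikhonov T ε‖

/-- The resolvent identity trades the empirical inverse for the population one. The correction
carries two inverses, and the prefactor `ε` absorbs one of them. -/
lemma norm_smul_comp_tikhonov_le {T T' : E →L[ℝ] E} (R : E →L[ℝ] F)
    (hT : ∀ x, 0 ≤ ⟪T x, x⟫_ℝ) (hT' : ∀ x, 0 ≤ ⟪T' x, x⟫_ℝ) {ε : ℝ} (hε : 0 < ε) (y : E) :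
    ‖ε • R (tikhonov T' ε y)‖ ≤ (regBias T R ε + ‖R‖ * ‖T' - T‖ * ε⁻¹) * ‖y‖ := by
  rw [tikhonov_sub_tikhonov hT hT' hε, map_sub, smul_sub, add_mul]
  refine (norm_sub_le _ _).trans (add_le_add ?_ ?_)
  · rw [norm_smul, Real.norm_eq_abs, abs_of_pos hε, regBias, mul_assoc]
    exact mul_le_mul_of_nonneg_left ((R ∘L tikhonov T ε).le_opNorm y) hε.le
  · rw [norm_smul, Real.norm_eq_abs, abs_of_pos hε]
    calc ε * ‖R (tikhonov T ε ((T' - T) (tikhonov T' ε y)))‖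
        ≤ ε * (‖R‖ * (ε⁻¹ * (‖T' - T‖ * (ε⁻¹ * ‖y‖)))) := by
          refine mul_le_mul_of_nonneg_left ((R.le_opNorm _).trans ?_) hε.le
          refine mul_le_mul_of_nonneg_left ((norm_tikhonov_le hT hε _).trans ?_) (norm_nonneg _)
          refine mul_le_mul_of_nonneg_left (((T' - T).le_opNorm _).trans ?_) (by positivity)
          exact mul_le_mul_of_nonneg_left (norm_tikhonov_le hT' hε _) (norm_nonneg _)
      _ = ‖R‖ * ‖T' - T‖ * ε⁻¹ * ‖y‖ := by field_simp

/-- The exact error decomposition: write `C' = R T' + (C' - R T')` and use `T' (T' + ε)⁻¹ = 1 - ε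
(T' + ε)⁻¹`. -/
lemma comp_tikhonov_eq {T' : E →L[ℝ] E} (R C' : E →L[ℝ] F) (hT' : ∀ x, 0 ≤ ⟪T' x, x⟫_ℝ)
    {ε : ℝ} (hε : 0 < ε) (y : E) :
    C' (tikhonov T' ε y) =
      R y - ε • R (tikhonov T' ε y) + (C' - R ∘L T') (tikhonov T' ε y) := by
  simp [apply_tikhonov hT' hε]

/-- The population residual `C - R T` vanishes, so the empirical one is pure sampling error. -/
lemma norm_residual_le {T T' : E →L[ℝ] E} {R C C' : E →L[ℝ] F} (hC : C = R ∘L T) :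
    ‖C' - R ∘L T'‖ ≤ ‖C' - C‖ + ‖R‖ * ‖T' - T‖ := by
  have h : C' - R ∘L T' = (C' - C) - R ∘L (T' - T) := by
    rw [hC, ContinuousLinearMap.comp_sub]; abel
  rw [h]
  exact (norm_sub_le _ _).trans (add_le_add_right (R.opNorm_comp_le _) _)

/-- Error of the Tikhonov-regularized regression operator. -/
lemma norm_regularized_regression_sub_le {T T' : E →L[ℝ] E} {R C C' : E →L[ℝ] F}
    (hC : C = R ∘L T) (hT : ∀ x, 0 ≤ ⟪T x, x⟫_ℝ) (hT' : ∀ x, 0 ≤ ⟪T' x, x⟫_ℝ)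
    {ε : ℝ} (hε : 0 < ε) :
    ‖C' ∘L tikhonov T' ε - R‖ ≤
      regBias T R ε + (‖C' - C‖ + 2 * ‖R‖ * ‖T' - T‖) * ε⁻¹ := by
  have hb : 0 ≤ regBias T R ε := mul_nonneg hε.le (norm_nonneg _)
  refine ContinuousLinearMap.opNorm_le_bound _ (by positivity) fun y ↦ ?_
  have h1 := norm_smul_comp_tikhonov_le R hT hT' hε y
  have h2 : ‖(C' - R ∘L T') (tikhonov T' ε y)‖ ≤
      (‖C' - C‖ + ‖R‖ * ‖T' - T‖) * (ε⁻¹ * ‖y‖) :=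
    ((C' - R ∘L T').le_opNorm _).trans (mul_le_mul (norm_residual_le hC)
      (norm_tikhonov_le hT' hε y) (norm_nonneg _) (by positivity))
  have h3 : (C' ∘L tikhonov T' ε - R) y =
      (C' - R ∘L T') (tikhonov T' ε y) - ε • R (tikhonov T' ε y) := by
    rw [sub_apply, ContinuousLinearMap.comp_apply,
      comp_tikhonov_eq R C' hT' hε y]
    abel
  rw [h3]
  refine (norm_sub_le _ _).trans ((add_le_add h2 h1).trans (le_of_eq ?_))
  ring

/-- Error of a composition of two regularized regressions. The product of the two errors does not
enter, since `q` is itself the image under `T'` of a vector of norm `O(δ⁻¹)`, up to bounded terms. -/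
lemma norm_regularized_regression_comp_sub_le {T T' : E →L[ℝ] E} {R C C' : E →L[ℝ] F}
    (hC : C = R ∘L T) (hT : ∀ x, 0 ≤ ⟪T x, x⟫_ℝ) (hT' : ∀ x, 0 ≤ ⟪T' x, x⟫_ℝ)
    {ε δ : ℝ} (hε : 0 < ε) (hδ : 0 < δ) {p q d : E} (q₀ : E) (hpq : T' p = d - δ • p + q)
    (hp : ‖p‖ ≤ δ⁻¹ * ‖d‖) :
    ‖C' (tikhonov T' ε q) - R q₀‖ ≤
      ‖R‖ * ‖q - q₀‖ + (regBias T R ε + ‖R‖ * ‖T' - T‖ * ε⁻¹) * ‖q₀‖ +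
        (‖C' - C‖ + ‖R‖ * ‖T' - T‖) * ((δ⁻¹ + 2 * ε⁻¹) * ‖d‖) := by
  set U := C' - R ∘L T' with hU
  have hUn : ‖U‖ ≤ ‖C' - C‖ + ‖R‖ * ‖T' - T‖ := norm_residual_le hC
  have hq : q = T' p - d + δ • p := by rw [hpq]; abel
  have h1 := norm_smul_comp_tikhonov_le R hT hT' hε q₀
  -- Bias is charged only to the fixed vector `q₀`. The difference `q - q₀` meets the contraction
  -- `T' (T' + ε)⁻¹`, so its norm is not multiplied by `ε⁻¹`.
  have e1 : C' (tikhonov T' ε q) - R q₀ =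
      R (T' (tikhonov T' ε (q - q₀))) - ε • R (tikhonov T' ε q₀) + U (tikhonov T' ε q) := by
    rw [comp_tikhonov_eq R C' hT' hε q, apply_tikhonov hT' hε, ← hU]
    simp only [map_sub, smul_sub, map_smul]
    abel
  have h2 : ‖R (T' (tikhonov T' ε (q - q₀)))‖ ≤ ‖R‖ * ‖q - q₀‖ :=
    (R.le_opNorm _).trans (mul_le_mul_of_nonneg_left (norm_apply_tikhonov_le hT' hε _)
      (norm_nonneg _))
  -- The direct bound `ε⁻¹ ‖q‖` would multiply the two regularization factors when `‖q‖` is of order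
  -- `δ⁻¹`. Since `q = T' p - d + δ p`, the dangerous part `T' p` is again met by a contraction, and
  -- `δ ‖p‖ ≤ ‖d‖`.
  have h3 : ‖tikhonov T' ε q‖ ≤ (δ⁻¹ + 2 * ε⁻¹) * ‖d‖ := by
    rw [hq, map_add, map_sub, map_smul, tikhonov_apply_comm hT' hε]
    calc ‖T' (tikhonov T' ε p) - tikhonov T' ε d + δ • tikhonov T' ε p‖
        ≤ ‖p‖ + ε⁻¹ * ‖d‖ + δ * (ε⁻¹ * ‖p‖) := by
          refine (norm_add_le _ _).trans (add_le_add ((norm_sub_le _ _).trans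
            (add_le_add (norm_apply_tikhonov_le hT' hε _) (norm_tikhonov_le hT' hε _))) ?_)
          rw [norm_smul, Real.norm_eq_abs, abs_of_pos hδ]
          exact mul_le_mul_of_nonneg_left (norm_tikhonov_le hT' hε _) hδ.le
      _ ≤ δ⁻¹ * ‖d‖ + ε⁻¹ * ‖d‖ + δ * (ε⁻¹ * (δ⁻¹ * ‖d‖)) := by gcongr
      _ = (δ⁻¹ + 2 * ε⁻¹) * ‖d‖ := by field_simp; ring
  have h4 : ‖U (tikhonov T' ε q)‖ ≤
      (‖C' - C‖ + ‖R‖ * ‖T' - T‖) * ((δ⁻¹ + 2 * ε⁻¹) * ‖d‖) :=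
    (U.le_opNorm _).trans (mul_le_mul hUn h3 (norm_nonneg _) (by positivity))
  rw [e1]
  exact (norm_add_le _ _).trans (add_le_add ((norm_sub_le _ _).trans (add_le_add h2 h1)) h4)

end RegularizedInverse

/-! ### Eigenspace expansions and the bias under a source condition. -/

section Spectral

variable {E F : Type*} [NormedAddCommGroup E] [InnerProductSpace ℝ E] [CompleteSpace E]
  [NormedAddCommGroup F] [InnerProductSpace ℝ F] [CompleteSpace F]

open scoped InnerProductSpace

/-- Uniqueness in the source condition: a vector orthogonal to the kernel is determined by its
image. -/
lemma eq_of_apply_eq_of_orthogonal_ker {T : E →L[ℝ] E} {u w : E} (h : T u = T w)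
    (hu : ∀ z, T z = 0 → ⟪u, z⟫_ℝ = 0) (hw : ∀ z, T z = 0 → ⟪w, z⟫_ℝ = 0) : u = w := by
  have hz : T (u - w) = 0 := by rw [map_sub, h, sub_self]
  have h0 : ⟪u - w, u - w⟫_ℝ = 0 := by rw [inner_sub_left, hu _ hz, hw _ hz, sub_zero]
  exact sub_eq_zero.1 (inner_self_eq_zero.1 h0)

/-- The projection to the eigenspace. -/
abbrev eigenProj (T : E →L[ℝ] E) (t : ℝ) : E →L[ℝ] E :=
  (T - t • ContinuousLinearMap.id ℝ E).ker.starProjection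

lemma apply_eigenProj (T : E →L[ℝ] E) (t : ℝ) (f : E) :
    T (eigenProj T t f) = t • eigenProj T t f := by
  have h : eigenProj T t f ∈ (T - t • ContinuousLinearMap.id ℝ E).ker :=
    Submodule.starProjection_apply_mem _ _
  rw [LinearMap.mem_ker] at h
  simpa [sub_eq_zero] using h

lemma inner_eq_zero_of_eigen {T : E →L[ℝ] E} (hsymm : ∀ x y, ⟪T x, y⟫_ℝ = ⟪x, T y⟫_ℝ) {s t : ℝ}
    (hst : s ≠ t) {x y : E} (hx : T x = s • x) (hy : T y = t • y) : ⟪x, y⟫_ℝ = 0 := by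
  have h := hsymm x y
  rw [hx, hy, inner_smul_left, inner_smul_right] at h
  simp only [conj_trivial] at h
  have : (s - t) * ⟪x, y⟫_ℝ = 0 := by linarith
  exact (mul_eq_zero.1 this).resolve_left (sub_ne_zero.2 hst)

lemma inner_eigenProj_self (T : E →L[ℝ] E) (t : ℝ) (f : E) :
    ⟪f, eigenProj T t f⟫_ℝ = ‖eigenProj T t f‖ ^ 2 := by
  have h : ⟪f - eigenProj T t f, eigenProj T t f⟫_ℝ = 0 :=
    Submodule.starProjection_inner_eq_zero _ _ (Submodule.starProjection_apply_mem _ _)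
  rw [inner_sub_left, sub_eq_zero, real_inner_self_eq_norm_sq] at h
  exact h

lemma eigenProj_eq_zero_of_neg {T : E →L[ℝ] E} (hT : ∀ x, 0 ≤ ⟪T x, x⟫_ℝ) {t : ℝ} (ht : t < 0)
    (f : E) : eigenProj T t f = 0 := by
  have h := hT (eigenProj T t f)
  rw [apply_eigenProj, inner_smul_left, real_inner_self_eq_norm_sq] at h
  simp only [conj_trivial] at h
  by_contra hne
  have : 0 < ‖eigenProj T t f‖ ^ 2 := by positivity
  nlinarith

lemma eigenProj_eq_zero_of_norm_lt {T : E →L[ℝ] E} {t : ℝ} (ht : ‖T‖ < t)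
    (f : E) : eigenProj T t f = 0 := by
  have h := T.le_opNorm (eigenProj T t f)
  rw [apply_eigenProj, norm_smul, Real.norm_eq_abs] at h
  by_contra hne
  have : 0 < ‖eigenProj T t f‖ := by positivity
  have := le_abs_self t
  nlinarith

variable {T : E →L[ℝ] E}

/-- Pythagoras: distinct eigenspaces of a symmetric operator are orthogonal. -/
lemma norm_sum_smul_eigenProj_sq (hsymm : ∀ x y, ⟪T x, y⟫_ℝ = ⟪x, T y⟫_ℝ) (c : ℝ → ℝ) (f : E)
    (s : Finset ℝ) :
    ‖∑ t ∈ s, c t • eigenProj T t f‖ ^ 2 = ∑ t ∈ s, c t ^ 2 * ‖eigenProj T t f‖ ^ 2 := by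
  rw [← real_inner_self_eq_norm_sq, sum_inner]
  refine Finset.sum_congr rfl fun t ht ↦ ?_
  rw [inner_sum, Finset.sum_eq_single t]
  · rw [inner_smul_left, inner_smul_right, real_inner_self_eq_norm_sq]; simp; ring
  · intro t' _ hne
    rw [inner_smul_left, inner_smul_right,
      inner_eq_zero_of_eigen hsymm hne.symm (apply_eigenProj T t f) (apply_eigenProj T t' f)]
    simp
  · exact fun h ↦ absurd ht h

/-- Bessel's inequality. Completeness of the eigenvectors is never used, so compactness of `T` is
not required. -/
lemma sum_norm_eigenProj_sq_le (hsymm : ∀ x y, ⟪T x, y⟫_ℝ = ⟪x, T y⟫_ℝ) (f : E) (s : Finset ℝ) :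
    ∑ t ∈ s, ‖eigenProj T t f‖ ^ 2 ≤ ‖f‖ ^ 2 := by
  have h1 := norm_sum_smul_eigenProj_sq hsymm (fun _ ↦ 1) f s
  simp only [one_smul, one_pow, one_mul] at h1
  have h2 : ⟪f, ∑ t ∈ s, eigenProj T t f⟫_ℝ = ∑ t ∈ s, ‖eigenProj T t f‖ ^ 2 := by
    rw [inner_sum]; exact Finset.sum_congr rfl fun t _ ↦ inner_eigenProj_self T t f
  have h3 := norm_sub_sq_real f (∑ t ∈ s, eigenProj T t f)
  rw [h2, h1] at h3
  nlinarith [sq_nonneg ‖f - ∑ t ∈ s, eigenProj T t f‖]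

lemma norm_sum_smul_eigenProj_le (hsymm : ∀ x y, ⟪T x, y⟫_ℝ = ⟪x, T y⟫_ℝ) {c : ℝ → ℝ} {f : E}
    {K : ℝ} (s : Finset ℝ) (hc : ∀ t ∈ s, eigenProj T t f ≠ 0 → |c t| ≤ K) :
    ‖∑ t ∈ s, c t • eigenProj T t f‖ ^ 2 ≤ K ^ 2 * ∑ t ∈ s, ‖eigenProj T t f‖ ^ 2 := by
  rw [norm_sum_smul_eigenProj_sq hsymm, Finset.mul_sum]
  refine Finset.sum_le_sum fun t ht ↦ ?_
  by_cases h0 : eigenProj T t f = 0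
  · simp [h0]
  · refine mul_le_mul_of_nonneg_right ?_ (by positivity)
    rw [← sq_abs]
    exact pow_le_pow_left₀ (abs_nonneg _) (hc t ht h0) 2

lemma summable_smul_eigenProj (hsymm : ∀ x y, ⟪T x, y⟫_ℝ = ⟪x, T y⟫_ℝ) {c : ℝ → ℝ} {f : E}
    {K : ℝ} (hK : 0 ≤ K) (hc : ∀ t, eigenProj T t f ≠ 0 → |c t| ≤ K) :
    Summable fun t ↦ c t • eigenProj T t f := by
  have hs : Summable fun t : ℝ ↦ ‖eigenProj T t f‖ ^ 2 :=
    summable_of_sum_le (fun _ ↦ by positivity) (sum_norm_eigenProj_sq_le hsymm f)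
  rw [summable_iff_vanishing_norm] at hs ⊢
  intro δ hδ
  -- `K + 1` instead of `K` avoids dividing by zero when `K = 0`.
  obtain ⟨s, hs⟩ := hs ((δ / (K + 1)) ^ 2) (by positivity)
  refine ⟨s, fun t ht ↦ ?_⟩
  have h1 := hs t ht
  rw [Real.norm_eq_abs, abs_of_nonneg (Finset.sum_nonneg fun _ _ ↦ by positivity)] at h1
  have h2 := norm_sum_smul_eigenProj_le hsymm t (fun t _ h ↦ hc t h)
  refine lt_of_pow_lt_pow_left₀ 2 hδ.le ?_
  have h3 : K ^ 2 * ∑ i ∈ t, ‖eigenProj T i f‖ ^ 2 ≤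
      (K + 1) ^ 2 * ∑ i ∈ t, ‖eigenProj T i f‖ ^ 2 := by
    refine mul_le_mul_of_nonneg_right ?_ (Finset.sum_nonneg fun _ _ ↦ by positivity)
    nlinarith
  have h4 : (K + 1) ^ 2 * ∑ i ∈ t, ‖eigenProj T i f‖ ^ 2 < (K + 1) ^ 2 * (δ / (K + 1)) ^ 2 :=
    mul_lt_mul_of_pos_left h1 (by positivity)
  have h5 : (K + 1) ^ 2 * (δ / (K + 1)) ^ 2 = δ ^ 2 := by field_simp
  linarith

lemma norm_tsum_smul_eigenProj_le (hsymm : ∀ x y, ⟪T x, y⟫_ℝ = ⟪x, T y⟫_ℝ) {c : ℝ → ℝ} {f : E}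
    {K : ℝ} (hK : 0 ≤ K) (hc : ∀ t, eigenProj T t f ≠ 0 → |c t| ≤ K) :
    ‖∑' t, c t • eigenProj T t f‖ ≤ K * ‖f‖ := by
  have h := (summable_smul_eigenProj hsymm hK hc).hasSum
  refine le_of_tendsto h.norm (Eventually.of_forall fun s ↦ ?_)
  refine le_of_sq_le_sq ?_ (by positivity)
  refine (norm_sum_smul_eigenProj_le hsymm s (fun t _ h ↦ hc t h)).trans ?_
  rw [mul_pow]
  exact mul_le_mul_of_nonneg_left (sum_norm_eigenProj_sq_le hsymm f s) (by positivity)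

/-- Weighted AM-GM gives `t ^ η * ε ^ (1 - η) ≤ η t + (1 - η) ε ≤ t + ε`. The restriction `η ≤ 1` is
the saturation of Tikhonov regularization. -/
lemma mul_rpow_div_add_le {ε t η : ℝ} (hε : 0 < ε) (ht : 0 ≤ t) (hη : η ∈ Set.Ioc (0 : ℝ) 1) :
    ε * (t ^ η / (t + ε)) ≤ ε ^ η := by
  have h := Real.geom_mean_le_arith_mean2_weighted hη.1.le (sub_nonneg.2 hη.2) ht hε.le
    (add_sub_cancel η 1)
  have h1 : t ^ η * ε ^ (1 - η) ≤ t + ε := by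
    refine h.trans (add_le_add ?_ ?_)
    · exact mul_le_of_le_one_left ht hη.2
    · exact mul_le_of_le_one_left hε.le (by linarith [hη.1])
  have h2 : ε ^ η * ε ^ (1 - η) = ε := by
    rw [← Real.rpow_add hε]; simp
  have hp : 0 < t + ε := by positivity
  rw [← mul_div_assoc, div_le_iff₀ hp]
  calc ε * t ^ η = ε ^ η * (t ^ η * ε ^ (1 - η)) := by
        conv_lhs => rw [← h2]
        ring
    _ ≤ ε ^ η * (t + ε) := mul_le_mul_of_nonneg_left h1 (by positivity)

/-- The regularization bias under a source condition. -/
lemma norm_smul_tikhonov_le_of_source (hT : ∀ x, 0 ≤ ⟪T x, x⟫_ℝ)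
    (hsymm : ∀ x y, ⟪T x, y⟫_ℝ = ⟪x, T y⟫_ℝ) {η : ℝ} (hη : η ∈ Set.Ioc (0 : ℝ) 1) {u f : E}
    (hu : ∀ z, T z = 0 → ⟪u, z⟫_ℝ = 0) (huf : T u = opPow T (1 + η) f) {ε : ℝ} (hε : 0 < ε) :
    ‖ε • tikhonov T ε u‖ ≤ ε ^ η * ‖f‖ := by
  have hpos : ∀ t, eigenProj T t f ≠ 0 → 0 ≤ t := fun t h ↦
    le_of_not_gt fun ht ↦ h (eigenProj_eq_zero_of_neg hT ht f)
  have hle : ∀ t, eigenProj T t f ≠ 0 → t ≤ ‖T‖ := fun t h ↦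
    le_of_not_gt fun ht ↦ h (eigenProj_eq_zero_of_norm_lt ht f)
  have hb1 : ∀ t, eigenProj T t f ≠ 0 → |t ^ η| ≤ ‖T‖ ^ η := fun t h ↦ by
    rw [abs_of_nonneg (Real.rpow_nonneg (hpos t h) _)]
    exact Real.rpow_le_rpow (hpos t h) (hle t h) hη.1.le
  have hs1 := summable_smul_eigenProj hsymm (by positivity) hb1
  -- This is `u = T ^ η f`: both sides have the image `T ^ (1 + η) f` under `T` and both are
  -- orthogonal to its kernel, the right side because its term at `t = 0` vanishes for `η > 0`. The
  -- power laws need `t ≥ 0`; projections for negative `t` are zero.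
  have hu' : u = ∑' t : ℝ, t ^ η • eigenProj T t f := by
    refine eq_of_apply_eq_of_orthogonal_ker ?_ hu fun z hz ↦ ?_
    · rw [huf, T.map_tsum hs1, opPow]
      refine tsum_congr fun t ↦ ?_
      rw [map_smul, apply_eigenProj, smul_smul]
      by_cases h0 : eigenProj T t f = 0
      · have h0' : (T - t • ContinuousLinearMap.id ℝ E).ker.starProjection f = 0 := h0
        rw [h0']
        simp
      · congr 1
        rw [add_comm, Real.rpow_add_one' (hpos t h0) (by linarith [hη.1])]
    · rw [real_inner_comm, ← innerSL_apply_apply ℝ, (innerSL ℝ z).map_tsum hs1]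
      convert tsum_zero with t
      rw [innerSL_apply_apply, inner_smul_right]
      by_cases ht : t = 0
      · rw [ht, Real.zero_rpow hη.1.ne', zero_mul]
      · rw [inner_eq_zero_of_eigen hsymm (Ne.symm ht) (by simpa using hz) (apply_eigenProj T t f),
          mul_zero]
  have hb2 : ∀ t, eigenProj T t f ≠ 0 → |t ^ η / (t + ε)| ≤ ε⁻¹ * ε ^ η := fun t h ↦ by
    have h0 := hpos t h
    rw [abs_of_nonneg (by positivity), inv_mul_eq_div, le_div_iff₀ hε, mul_comm]
    exact mul_rpow_div_add_le hε h0 hη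
  have hs2 := summable_smul_eigenProj hsymm (by positivity) hb2
  -- The inverse acts diagonally on the expansion, as is checked by applying `T + ε` term by term.
  have htik : tikhonov T ε u = ∑' t : ℝ, (t ^ η / (t + ε)) • eigenProj T t f := by
    symm
    refine eq_tikhonov hT hε ?_
    rw [T.map_tsum hs2, ← tsum_const_smul'', ← Summable.tsum_add (T.summable hs2) (hs2.const_smul ε),
      hu']
    refine tsum_congr fun t ↦ ?_
    rw [map_smul, apply_eigenProj, smul_smul, smul_smul, ← add_smul]
    by_cases h0 : eigenProj T t f = 0
    · rw [h0, smul_zero, smul_zero]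
    · have : 0 < t + ε := by linarith [hpos t h0]
      congr 1
      field_simp
  rw [norm_smul, Real.norm_eq_abs, abs_of_pos hε, htik]
  calc ε * ‖∑' t : ℝ, (t ^ η / (t + ε)) • eigenProj T t f‖
      ≤ ε * (ε⁻¹ * ε ^ η * ‖f‖) :=
        mul_le_mul_of_nonneg_left (norm_tsum_smul_eigenProj_le hsymm (by positivity) hb2) hε.le
    _ = ε ^ η * ‖f‖ := by field_simp

end Spectral

/-! ### Moore-Penrose inverses and regression operators. -/

section MoorePenrose

variable {E F : Type*} [NormedAddCommGroup E] [InnerProductSpace ℝ E] [CompleteSpace E]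
  [NormedAddCommGroup F] [InnerProductSpace ℝ F] [CompleteSpace F]

open scoped InnerProductSpace

lemma inner_eq_zero_of_mem_closure_range {S : E →L[ℝ] E}
    (hsymm : ∀ x y, ⟪S x, y⟫_ℝ = ⟪x, S y⟫_ℝ) {u z : E}
    (hu : u ∈ (LinearMap.range (S : E →ₗ[ℝ] E)).topologicalClosure) (hz : S z = 0) :
    ⟪u, z⟫_ℝ = 0 := by
  have hc : IsClosed {u : E | ⟪u, z⟫_ℝ = 0} :=
    isClosed_eq (by fun_prop) continuous_const
  have hsub : (LinearMap.range (S : E →ₗ[ℝ] E) : Set E) ⊆ {u : E | ⟪u, z⟫_ℝ = 0} := by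
    rintro _ ⟨w, rfl⟩
    change ⟪S w, z⟫_ℝ = 0
    rw [hsymm, hz, inner_zero_right]
  exact closure_minimal hsub hc hu

/-- By symmetry the orthogonal complement of the range is the kernel, so projecting a preimage to
the closed range does not change its image. Thus `moorePenrose` takes its nontrivial branch on the
whole range. -/
lemma exists_mem_closure_range {S : E →L[ℝ] E} (hsymm : ∀ x y, ⟪S x, y⟫_ℝ = ⟪x, S y⟫_ℝ)
    {y : E} (hy : y ∈ LinearMap.range (S : E →ₗ[ℝ] E)) :
    ∃ x ∈ (LinearMap.range (S : E →ₗ[ℝ] E)).topologicalClosure, S x = y := by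
  obtain ⟨w, rfl⟩ := hy
  set K := (LinearMap.range (S : E →ₗ[ℝ] E)).topologicalClosure
  have : CompleteSpace K := (Submodule.isClosed_topologicalClosure _).completeSpace_coe
  refine ⟨K.starProjection w, Submodule.starProjection_apply_mem _ _, ?_⟩
  have h : S (w - K.starProjection w) = 0 := by
    refine ext_inner_right ℝ fun v ↦ ?_
    rw [hsymm, inner_zero_left]
    exact Submodule.starProjection_inner_eq_zero _ _
      (Submodule.le_topologicalClosure _ ⟨v, rfl⟩)
  rw [map_sub, sub_eq_zero] at h
  exact h.symm

lemma moorePenrose_inner_ker {S : E →L[ℝ] E} (hsymm : ∀ x y, ⟪S x, y⟫_ℝ = ⟪x, S y⟫_ℝ) (y : E)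
    {z : E} (hz : S z = 0) : ⟪moorePenrose S y, z⟫_ℝ = 0 := by
  unfold moorePenrose
  split_ifs with h
  · exact inner_eq_zero_of_mem_closure_range hsymm h.choose_spec.1 hz
  · exact inner_zero_left _

lemma apply_moorePenrose {S : E →L[ℝ] E} (hsymm : ∀ x y, ⟪S x, y⟫_ℝ = ⟪x, S y⟫_ℝ) {y : E}
    (hy : y ∈ LinearMap.range (S : E →ₗ[ℝ] E)) : S (moorePenrose S y) = y := by
  have h := exists_mem_closure_range hsymm hy
  rw [moorePenrose, dif_pos h]
  exact h.choose_spec.2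

lemma HasRegressionOp.regressionOp_apply {S : E →L[ℝ] E} {C : F →L[ℝ] E}
    (h : HasRegressionOp S C) (v : F) : regressionOp S C v = moorePenrose S (C v) := by
  rw [regressionOp, dif_pos h.2]
  exact h.2.choose_spec v

lemma HasRegressionOp.apply_regressionOp {S : E →L[ℝ] E} {C : F →L[ℝ] E}
    (h : HasRegressionOp S C) (hsymm : ∀ x y, ⟪S x, y⟫_ℝ = ⟪x, S y⟫_ℝ) (v : F) :
    S (regressionOp S C v) = C v := by
  rw [h.regressionOp_apply]
  exact apply_moorePenrose hsymm (h.1 ⟨v, rfl⟩)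

lemma HasRegressionOp.inner_ker {S : E →L[ℝ] E} {C : F →L[ℝ] E}
    (h : HasRegressionOp S C) (hsymm : ∀ x y, ⟪S x, y⟫_ℝ = ⟪x, S y⟫_ℝ) (v : F) {z : E}
    (hz : S z = 0) : ⟪regressionOp S C v, z⟫_ℝ = 0 := by
  rw [h.regressionOp_apply]
  exact moorePenrose_inner_ker hsymm _ hz

/-- The bias of Tikhonov regularization of a regression operator, under a source condition. -/
lemma HasRegressionOp.regBias_le {T : E →L[ℝ] E} {C : F →L[ℝ] E} (h : HasRegressionOp T C)
    (hT : ∀ x, 0 ≤ ⟪T x, x⟫_ℝ) (hsymm : ∀ x y, ⟪T x, y⟫_ℝ = ⟪x, T y⟫_ℝ) {η : ℝ}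
    (hη : η ∈ Set.Ioc (0 : ℝ) 1) {S : F →L[ℝ] E} (hS : ∀ v, C v = opPow T (1 + η) (S v))
    {ε : ℝ} (hε : 0 < ε) :
    regBias T (regressionOp T C).adjoint ε ≤ ε ^ η * ‖S‖ := by
  -- Passing to the adjoint preserves the norm and puts the inverse to the left of the regression
  -- operator, whose values satisfy the source condition vector by vector.
  have hadj : (regressionOp T C).adjoint ∘L tikhonov T ε =
      (tikhonov T ε ∘L regressionOp T C).adjoint := by
    rw [ContinuousLinearMap.adjoint_comp]
    congr 1
    rw [ContinuousLinearMap.eq_adjoint_iff]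
    exact adjoint_tikhonov hT hsymm hε
  rw [regBias, hadj, LinearIsometryEquiv.norm_map]
  have h1 : ‖ε • (tikhonov T ε ∘L regressionOp T C)‖ ≤ ε ^ η * ‖S‖ := by
    refine ContinuousLinearMap.opNorm_le_bound _ (by positivity) fun v ↦ ?_
    have h2 := norm_smul_tikhonov_le_of_source hT hsymm hη (fun z hz ↦ h.inner_ker hsymm v hz)
      ((h.apply_regressionOp hsymm v).trans (hS v)) hε
    refine h2.trans ?_
    rw [mul_assoc]
    exact mul_le_mul_of_nonneg_left (S.le_opNorm v) (by positivity)
  rwa [norm_smul, Real.norm_eq_abs, abs_of_pos hε] at h1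

/-- The cross-covariance factors through the adjoint of the regression operator. -/
lemma HasRegressionOp.adjoint_eq {T : E →L[ℝ] E} {C : F →L[ℝ] E} {C' : E →L[ℝ] F}
    (h : HasRegressionOp T C) (hsymm : ∀ x y, ⟪T x, y⟫_ℝ = ⟪x, T y⟫_ℝ)
    (hC : ∀ x v, ⟪C' x, v⟫_ℝ = ⟪x, C v⟫_ℝ) :
    C' = (regressionOp T C).adjoint ∘L T := by
  ext x
  refine ext_inner_right ℝ fun v ↦ ?_
  rw [hC, ContinuousLinearMap.comp_apply, ContinuousLinearMap.adjoint_inner_left, hsymm,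
    h.apply_regressionOp hsymm]

end MoorePenrose

/-! ### Calculus of stochastic rates. -/

section BigOInProbability

variable {Ω : Type*} [MeasurableSpace Ω] {Q : Measure Ω}

lemma IsBigOInProbability.add {S T : ℕ → Ω → ℝ} {r : ℕ → ℝ} (hS : IsBigOInProbability Q S r)
    (hT : IsBigOInProbability Q T r) : IsBigOInProbability Q (fun n ω ↦ S n ω + T n ω) r := by
  intro δ hδ
  obtain ⟨C, hC⟩ := hS (δ / 2) (half_pos hδ)
  obtain ⟨D, hD⟩ := hT (δ / 2) (half_pos hδ)
  refine ⟨C + D, ?_⟩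
  filter_upwards [hC, hD] with n h1 h2
  have hsub : {ω | (C + D) * r n < |S n ω + T n ω|} ⊆
      {ω | C * r n < |S n ω|} ∪ {ω | D * r n < |T n ω|} := by
    intro ω hω
    by_contra hcon
    simp only [Set.mem_union, Set.mem_ofPred_eq, not_or, not_lt] at hcon hω
    have := abs_add_le (S n ω) (T n ω)
    rw [add_mul] at hω
    linarith [hcon.1, hcon.2]
  refine (measure_mono hsub).trans ((measure_union_le _ _).trans ((add_le_add h1 h2).trans ?_))
  rw [← ENNReal.ofReal_add (by positivity) (by positivity), add_halves]

/-- Deterministic transfer of a stochastic rate. -/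
lemma IsBigOInProbability.of_imp {D T : ℕ → Ω → ℝ} {r r' : ℕ → ℝ}
    (hD : IsBigOInProbability Q D r) (hr : ∀ n, 0 ≤ r n)
    (h : ∀ C : ℝ, 0 ≤ C → ∃ C' : ℝ, ∀ᶠ n in atTop, ∀ ω, |D n ω| ≤ C * r n → |T n ω| ≤ C' * r' n) :
    IsBigOInProbability Q T r' := by
  intro δ hδ
  obtain ⟨C, hC⟩ := hD δ hδ
  obtain ⟨C', hC'⟩ := h (max C 0) (le_max_right _ _)
  refine ⟨C', ?_⟩
  filter_upwards [hC, hC'] with n h1 h2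
  refine (measure_mono fun ω hω ↦ ?_).trans h1
  by_contra hcon
  simp only [Set.mem_ofPred_eq, not_lt] at hcon hω
  exact absurd (h2 ω (hcon.trans (mul_le_mul_of_nonneg_right (le_max_left _ _) (hr n))))
    (not_le.2 hω)

/-- Markov's inequality for the majorant `G` of `T ^ 2`. Only `G` has to be measurable, which spares
a proof that operator norms of random operators are. -/
lemma isBigOInProbability_of_lintegral {T : ℕ → Ω → ℝ} {G : ℕ → Ω → ENNReal} {K : ENNReal}
    (hK : K ≠ ⊤) (hG : ∀ n, AEMeasurable (G n) Q)
    (hGK : ∀ n, n ≠ 0 → ∫⁻ ω, G n ω ∂Q ≤ (n : ENNReal)⁻¹ * K)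
    (hT : ∀ n, n ≠ 0 → ∀ ω, ENNReal.ofReal (T n ω ^ 2) ≤ G n ω) :
    IsBigOInProbability Q T (fun n ↦ (n : ℝ) ^ (-(1 / 2) : ℝ)) := by
  intro δ hδ
  -- Chosen so that `K / C ^ 2 ≤ δ`; the summand `1` keeps `C` positive when `K = 0`.
  set C := √(K.toReal / δ) + 1 with hCdef
  have hC0 : 0 < C := by positivity
  have hC : K.toReal ≤ δ * C ^ 2 := by
    have h1 : √(K.toReal / δ) ^ 2 = K.toReal / δ := Real.sq_sqrt (by positivity)
    have h2 : K.toReal / δ ≤ C ^ 2 := by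
      rw [← h1]; exact pow_le_pow_left₀ (Real.sqrt_nonneg _) (by linarith) 2
    rwa [div_le_iff₀' hδ] at h2
  refine ⟨C, ?_⟩
  filter_upwards [eventually_ne_atTop 0] with n hn
  have hn0 : (0 : ℝ) < n := by positivity
  have hsq : ((n : ℝ) ^ (-(1 / 2) : ℝ)) ^ 2 = (n : ℝ)⁻¹ := by
    rw [← Real.rpow_natCast, ← Real.rpow_mul hn0.le, ← Real.rpow_neg_one]; norm_num
  have hsub : {ω | C * (n : ℝ) ^ (-(1 / 2) : ℝ) < |T n ω|} ⊆
      {ω | ENNReal.ofReal (C ^ 2 * (n : ℝ)⁻¹) ≤ G n ω} := by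
    intro ω hω
    refine le_trans (ENNReal.ofReal_le_ofReal ?_) (hT n hn ω)
    rw [← sq_abs (T n ω), ← hsq, ← mul_pow]
    exact pow_le_pow_left₀ (by positivity) (le_of_lt hω) 2
  refine (measure_mono hsub).trans ?_
  have h1 := (mul_meas_ge_le_lintegral₀ (hG n) (ENNReal.ofReal (C ^ 2 * (n : ℝ)⁻¹))).trans
    (hGK n hn)
  have h2 : (n : ENNReal)⁻¹ * K ≤
      ENNReal.ofReal (C ^ 2 * (n : ℝ)⁻¹) * ENNReal.ofReal δ := by
    rw [← ENNReal.ofReal_toReal hK, ← ENNReal.ofReal_natCast, ← ENNReal.ofReal_inv_of_pos hn0,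
      ← ENNReal.ofReal_mul (by positivity), ← ENNReal.ofReal_mul (by positivity)]
    refine ENNReal.ofReal_le_ofReal ?_
    calc (n : ℝ)⁻¹ * K.toReal ≤ (n : ℝ)⁻¹ * (δ * C ^ 2) := by gcongr
      _ = C ^ 2 * (n : ℝ)⁻¹ * δ := by ring
  exact (ENNReal.mul_le_mul_iff_right (by simp; positivity) ENNReal.ofReal_ne_top).1 (h1.trans h2)

end BigOInProbability

/-! ### Root-`n` rates for sample means and empirical covariance operators. -/

section Sample

/-- `W` is an i.i.d. sample from the law `ν`. -/
structure IsIIDSample {Ω S : Type*} [MeasurableSpace Ω] [MeasurableSpace S] (Q : Measure Ω)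
    (W : ℕ → Ω → S) (ν : Measure S) : Prop where
  aemeasurable : ∀ i, AEMeasurable (W i) Q
  map_eq : ∀ i, Q.map (W i) = ν
  indep : iIndepFun W Q

variable {Ω S : Type*} [MeasurableSpace Ω] [MeasurableSpace S] {Q : Measure Ω}
  [IsProbabilityMeasure Q] {W : ℕ → Ω → S} {ν : Measure S} [IsProbabilityMeasure ν]
  {E F : Type*} [NormedAddCommGroup E] [InnerProductSpace ℝ E] [CompleteSpace E]
  [NormedAddCommGroup F] [InnerProductSpace ℝ F] [CompleteSpace F]

open scoped InnerProductSpace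

lemma enorm_sq_eq_ofReal {G : Type*} [NormedAddCommGroup G] (x : G) :
    ‖x‖ₑ ^ 2 = ENNReal.ofReal (‖x‖ ^ 2) := by
  rw [← ofReal_norm, ENNReal.ofReal_pow (norm_nonneg _)]

lemma MeasureTheory.MemLp.lintegral_enorm_sq {α : Type*} [MeasurableSpace α] {μ : Measure α}
    {f : α → E} (hf : MemLp f 2 μ) :
    ∫⁻ a, ‖f a‖ₑ ^ 2 ∂μ = ENNReal.ofReal (∫ a, ‖f a‖ ^ 2 ∂μ) := by
  rw [ofReal_integral_eq_lintegral_ofReal ((memLp_two_iff_integrable_sq_norm hf.1).1 hf)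
    (ae_of_all _ fun _ ↦ by positivity)]
  simp_rw [enorm_sq_eq_ofReal]

lemma IsIIDSample.memLp (hW : IsIIDSample Q W ν) {f : S → E} (hf : MemLp f 2 ν) (i : ℕ) :
    MemLp (fun ω ↦ f (W i ω)) 2 Q := by
  have h : MemLp f 2 (Q.map (W i)) := by rwa [hW.map_eq i]
  exact h.comp_of_map (hW.aemeasurable i)

lemma IsIIDSample.integral_comp (hW : IsIIDSample Q W ν) {f : S → E}
    (hf : AEStronglyMeasurable f ν) (i : ℕ) : ∫ ω, f (W i ω) ∂Q = ∫ s, f s ∂ν := by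
  rw [← hW.map_eq i] at hf ⊢
  exact (integral_map (hW.aemeasurable i) hf).symm

lemma IsIIDSample.integral_inner_eq_zero (hW : IsIIDSample Q W ν) {g : S → E}
    (hg : MemLp g 2 ν) (hg0 : ∫ s, g s ∂ν = 0) {i j : ℕ} (hij : i ≠ j) :
    ∫ ω, ⟪g (W i ω), g (W j ω)⟫_ℝ ∂Q = 0 := by
  have hi : Integrable g ν := hg.integrable (by norm_num)
  have h : ∫ ω, ⟪g (W i ω), g (W j ω)⟫_ℝ ∂Q =
      ⟪∫ ω, g (W i ω) ∂Q, ∫ ω, g (W j ω) ∂Q⟫_ℝ :=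
    (hW.indep.indepFun hij).integral_bilin_comp_comp (hW.aemeasurable i)
      (hW.aemeasurable j) (f := g) (g := g) (by rwa [hW.map_eq]) (by rwa [hW.map_eq]) (innerSL ℝ)
  rw [h, hW.integral_comp hg.1, hg0, inner_zero_left]

lemma MeasureTheory.MemLp.integrable_inner_real {α : Type*} [MeasurableSpace α] {μ : Measure α}
    {f g : α → E} (hf : MemLp f 2 μ) (hg : MemLp g 2 μ) : Integrable (fun a ↦ ⟪f a, g a⟫_ℝ) μ :=
  (MemLp.integrable_mul hf.norm hg.norm).mono' (hf.1.inner hg.1)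
    (ae_of_all _ fun _ ↦ norm_inner_le_norm _ _)

/-- Expanding the square, the off-diagonal inner products have mean zero by independence and
centring. -/
lemma IsIIDSample.integral_norm_sum_sq (hW : IsIIDSample Q W ν) {g : S → E}
    (hg : MemLp g 2 ν) (hg0 : ∫ s, g s ∂ν = 0) (n : ℕ) :
    ∫ ω, ‖∑ i ∈ Finset.range n, g (W i ω)‖ ^ 2 ∂Q = n * ∫ s, ‖g s‖ ^ 2 ∂ν := by
  have h1 : ∀ ω, ‖∑ i ∈ Finset.range n, g (W i ω)‖ ^ 2 =
      ∑ i ∈ Finset.range n, ∑ j ∈ Finset.range n, ⟪g (W i ω), g (W j ω)⟫_ℝ := fun ω ↦ by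
    rw [← real_inner_self_eq_norm_sq, sum_inner]
    simp_rw [inner_sum]
  have hint : ∀ i j, Integrable (fun ω ↦ ⟪g (W i ω), g (W j ω)⟫_ℝ) Q := fun i j ↦
    (hW.memLp hg i).integrable_inner_real (hW.memLp hg j)
  simp_rw [h1]
  rw [integral_finsetSum _ fun i _ ↦ integrable_finsetSum _ fun j _ ↦ hint i j]
  have h2 : ∀ i ∈ Finset.range n,
      ∫ ω, ∑ j ∈ Finset.range n, ⟪g (W i ω), g (W j ω)⟫_ℝ ∂Q = ∫ s, ‖g s‖ ^ 2 ∂ν := by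
    intro i hi
    rw [integral_finsetSum _ fun j _ ↦ hint i j, Finset.sum_eq_single i]
    · simp_rw [real_inner_self_eq_norm_sq]
      exact hW.integral_comp (f := fun s ↦ ‖g s‖ ^ 2) (hg.1.norm.pow 2) i
    · exact fun j _ hj ↦ hW.integral_inner_eq_zero hg hg0 hj.symm
    · exact fun h ↦ absurd hi h
  rw [Finset.sum_congr rfl h2]
  simp

lemma integral_norm_sub_mean_sq_le {f : S → E} (hf : MemLp f 2 ν) :
    ∫ s, ‖f s - ∫ s', f s' ∂ν‖ ^ 2 ∂ν ≤ ∫ s, ‖f s‖ ^ 2 ∂ν := by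
  set c := ∫ s', f s' ∂ν
  have hi : Integrable f ν := hf.integrable (by norm_num)
  have h1 : ∀ s, ‖f s - c‖ ^ 2 = ‖f s‖ ^ 2 - 2 * ⟪c, f s⟫_ℝ + ‖c‖ ^ 2 := fun s ↦ by
    rw [norm_sub_sq_real, real_inner_comm]
  have h2 : Integrable (fun s ↦ ‖f s‖ ^ 2) ν := (memLp_two_iff_integrable_sq_norm hf.1).1 hf
  have h3 : Integrable (fun s ↦ 2 * ⟪c, f s⟫_ℝ) ν := (hi.const_inner c).const_mul 2
  simp_rw [h1]
  have h4 : Integrable (fun s ↦ ‖f s‖ ^ 2 - 2 * ⟪c, f s⟫_ℝ) ν := h2.sub h3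
  rw [integral_add h4 (integrable_const _), integral_sub h2 h3, integral_const_mul,
    integral_inner hi, real_inner_self_eq_norm_sq]
  simp only [integral_const, probReal_univ, one_smul]
  nlinarith [sq_nonneg ‖c‖]

/-- The mean squared error of the sample mean. -/
lemma IsIIDSample.lintegral_empMean_sub_sq_le (hW : IsIIDSample Q W ν) {f : S → E}
    (hf : MemLp f 2 ν) {n : ℕ} (hn : n ≠ 0) :
    ∫⁻ ω, ‖empMean n (fun i ↦ f (W i ω)) - ∫ s, f s ∂ν‖ₑ ^ 2 ∂Q ≤
      (n : ENNReal)⁻¹ * ∫⁻ s, ‖f s‖ₑ ^ 2 ∂ν := by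
  set c := ∫ s, f s ∂ν with hc
  have hn0 : (0 : ℝ) < n := by positivity
  have hg : MemLp (fun s ↦ f s - c) 2 ν := hf.sub (memLp_const c)
  have hg0 : ∫ s, (f s - c) ∂ν = 0 := by
    rw [integral_sub (hf.integrable (by norm_num)) (integrable_const _)]
    simp [hc]
  have h1 : ∀ ω, empMean n (fun i ↦ f (W i ω)) - c =
      (n : ℝ)⁻¹ • ∑ i ∈ Finset.range n, (f (W i ω) - c) := fun ω ↦ by
    rw [empMean, Finset.sum_sub_distrib, smul_sub, Finset.sum_const, Finset.card_range,
      ← Nat.cast_smul_eq_nsmul ℝ, smul_smul, inv_mul_cancel₀ hn0.ne', one_smul]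
  have hm : MemLp (fun ω ↦ (n : ℝ)⁻¹ • ∑ i ∈ Finset.range n, (f (W i ω) - c)) 2 Q :=
    (memLp_finsetSum _ fun i _ ↦ hW.memLp hg i).const_smul _
  simp_rw [h1]
  rw [hm.lintegral_enorm_sq, hf.lintegral_enorm_sq, ← ENNReal.ofReal_natCast,
    ← ENNReal.ofReal_inv_of_pos hn0, ← ENNReal.ofReal_mul (by positivity)]
  refine ENNReal.ofReal_le_ofReal ?_
  simp_rw [norm_smul, mul_pow]
  rw [integral_const_mul, hW.integral_norm_sum_sq hg hg0]
  calc ‖(n : ℝ)⁻¹‖ ^ 2 * (n * ∫ s, ‖f s - c‖ ^ 2 ∂ν)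
      = (n : ℝ)⁻¹ * ∫ s, ‖f s - c‖ ^ 2 ∂ν := by
        rw [Real.norm_eq_abs, sq_abs]; field_simp
    _ ≤ _ := mul_le_mul_of_nonneg_left (integral_norm_sub_mean_sq_le hf) (by positivity)

lemma IsIIDSample.aestronglyMeasurable_empMean (hW : IsIIDSample Q W ν) {f : S → E}
    (hf : MemLp f 2 ν) (n : ℕ) :
    AEStronglyMeasurable (fun ω ↦ empMean n (fun i ↦ f (W i ω)) - ∫ s, f s ∂ν) Q :=
  ((Finset.aestronglyMeasurable_fun_sum _ fun i _ ↦ (hW.memLp hf i).1).const_smul _).sub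
    aestronglyMeasurable_const

lemma IsIIDSample.isBigO_empMean (hW : IsIIDSample Q W ν) {f : S → E} (hf : MemLp f 2 ν) :
    IsBigOInProbability Q (fun n ω ↦ ‖empMean n (fun i ↦ f (W i ω)) - ∫ s, f s ∂ν‖)
      (fun n ↦ (n : ℝ) ^ (-(1 / 2) : ℝ)) := by
  refine isBigOInProbability_of_lintegral (K := ∫⁻ s, ‖f s‖ₑ ^ 2 ∂ν)
    (G := fun n ω ↦ ‖empMean n (fun i ↦ f (W i ω)) - ∫ s, f s ∂ν‖ₑ ^ 2) ?_
    (fun n ↦ (hW.aestronglyMeasurable_empMean hf n).enorm.pow_const 2)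
    (fun n hn ↦ hW.lintegral_empMean_sub_sq_le hf hn)
    (fun n _ ω ↦ (enorm_sq_eq_ofReal _).ge)
  rw [hf.lintegral_enorm_sq]
  exact ENNReal.ofReal_ne_top

/-- Basis vectors lie at mutual distance `√2`, so balls of radius `1/2` around them are disjoint.
Countability is what allows summation over the basis to be exchanged with integration. -/
lemma countable_of_hilbertBasis [TopologicalSpace.SeparableSpace F] {w : Set F}
    (b : HilbertBasis w ℝ F) : Countable w := by
  have hdist : ∀ i j : w, i ≠ j → 1 < ‖b i - b j‖ := by
    intro i j hij
    have h := norm_sub_sq_real (b i) (b j)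
    rw [b.orthonormal.2 hij, b.orthonormal.1 i, b.orthonormal.1 j] at h
    nlinarith [norm_nonneg (b i - b j)]
  have hd : (Set.univ : Set w).PairwiseDisjoint fun i ↦ Metric.ball (b i) (1 / 2) := by
    intro i _ j _ hij
    refine Metric.ball_disjoint_ball ?_
    rw [dist_eq_norm]
    linarith [hdist i j hij]
  have := hd.countable_of_isOpen (fun i _ ↦ Metric.isOpen_ball)
    (fun i _ ↦ Metric.nonempty_ball.2 (by norm_num))
  exact Set.countable_univ_iff.1 this

/-- The operator norm is at most the Hilbert-Schmidt norm. -/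
lemma enorm_sq_le_tsum {ι : Type*} (b : HilbertBasis ι ℝ F) (T : F →L[ℝ] E) :
    ‖T‖ₑ ^ 2 ≤ ∑' k, ‖T (b k)‖ₑ ^ 2 := by
  by_cases htop : ∑' k, ‖T (b k)‖ₑ ^ 2 = ⊤
  · rw [htop]; exact le_top
  simp_rw [enorm_sq_eq_ofReal] at htop ⊢
  have hs : Summable fun k ↦ ‖T (b k)‖ ^ 2 := by
    have := ENNReal.summable_toReal htop
    simpa [ENNReal.toReal_ofReal] using this
  rw [← ENNReal.ofReal_tsum_of_nonneg (fun _ ↦ by positivity) hs]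
  refine ENNReal.ofReal_le_ofReal ?_
  have h0 : 0 ≤ ∑' k, ‖T (b k)‖ ^ 2 := tsum_nonneg fun _ ↦ by positivity
  -- The coordinates of `T* v` are `⟪T (b k), v⟫`, so Parseval and Cauchy-Schwarz bound the adjoint.
  have h1 : ‖T.adjoint‖ ≤ √(∑' k, ‖T (b k)‖ ^ 2) := by
    refine ContinuousLinearMap.opNorm_le_bound _ (Real.sqrt_nonneg _) fun v ↦ ?_
    refine le_of_sq_le_sq ?_ (by positivity)
    rw [mul_pow, Real.sq_sqrt h0, ← real_inner_self_eq_norm_sq]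
    have h2 := b.hasSum_inner_mul_inner (T.adjoint v) (T.adjoint v)
    refine hasSum_le (fun k ↦ ?_) h2 (hs.hasSum.mul_right (‖v‖ ^ 2))
    rw [ContinuousLinearMap.adjoint_inner_left, ContinuousLinearMap.adjoint_inner_right,
      real_inner_comm, ← sq, ← mul_pow, ← sq_abs]
    exact pow_le_pow_left₀ (abs_nonneg _) (abs_real_inner_le_norm _ _) 2
  rw [LinearIsometryEquiv.norm_map] at h1
  calc ‖T‖ ^ 2 ≤ √(∑' k, ‖T (b k)‖ ^ 2) ^ 2 := pow_le_pow_left₀ (norm_nonneg _) h1 2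
    _ = _ := Real.sq_sqrt h0

lemma tensorOp_apply (a : E) (b v : F) : tensorOp a b v = ⟪b, v⟫_ℝ • a := rfl

lemma norm_tensorOp (a : E) (b : F) : ‖tensorOp a b‖ = ‖a‖ * ‖b‖ :=
  InnerProductSpace.norm_rankOne a b

lemma aestronglyMeasurable_tensorOp {α : Type*} [MeasurableSpace α] {μ : Measure α} {a : α → E}
    {b : α → F} (ha : AEStronglyMeasurable a μ) (hb : AEStronglyMeasurable b μ) :
    AEStronglyMeasurable (fun s ↦ tensorOp (a s) (b s)) μ := by
  have h : (fun s ↦ tensorOp (a s) (b s)) = fun s ↦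
      ContinuousLinearMap.smulRightL ℝ F E (innerSL ℝ (b s)) (a s) := by
    ext s v
    rfl
  rw [h]
  exact (ContinuousLinearMap.smulRightL ℝ F E).aestronglyMeasurable_comp₂
    ((innerSL ℝ).continuous.comp_aestronglyMeasurable hb) ha

lemma memLp_tensorOp {a : S → E} {b : S → F} (ha : MemLp a 4 ν) (hb : MemLp b 4 ν) :
    MemLp (fun s ↦ tensorOp (a s) (b s)) 2 ν := by
  rw [memLp_two_iff_integrable_sq_norm (aestronglyMeasurable_tensorOp ha.1 hb.1)]
  have ha' := MemLp.integrable_norm_pow (p := 4) ha (by norm_num)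
  have hb' := MemLp.integrable_norm_pow (p := 4) hb (by norm_num)
  refine (ha'.add hb').mono' ((aestronglyMeasurable_tensorOp ha.1 hb.1).norm.pow 2)
    (ae_of_all _ fun s ↦ ?_)
  rw [norm_tensorOp, Real.norm_of_nonneg (by positivity), Pi.add_apply]
  nlinarith [sq_nonneg (‖a s‖ ^ 2 - ‖b s‖ ^ 2), sq_nonneg (‖a s‖ ^ 2), sq_nonneg (‖b s‖ ^ 2)]

lemma enorm_tensorOp_apply (a : E) (b v : F) : ‖tensorOp a b v‖ₑ = ‖⟪v, b⟫_ℝ‖ₑ * ‖a‖ₑ := by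
  rw [tensorOp_apply, enorm_smul, real_inner_comm]

/-- Parseval: a rank-one operator has equal Hilbert-Schmidt and operator norms. Summing
coordinatewise second moments over the basis therefore returns the second moment of the tensor norm.
-/
lemma tsum_enorm_tensorOp_sq {ι : Type*} (e : HilbertBasis ι ℝ F) (a : E) (b : F) :
    ∑' k, ‖tensorOp a b (e k)‖ₑ ^ 2 = ‖tensorOp a b‖ₑ ^ 2 := by
  have h := e.hasSum_inner_mul_inner b b
  have h2 : ∑' k, ‖⟪e k, b⟫_ℝ‖ₑ ^ 2 = ‖b‖ₑ ^ 2 := by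
    simp_rw [enorm_sq_eq_ofReal]
    rw [← real_inner_self_eq_norm_sq b, ← h.tsum_eq, ENNReal.ofReal_tsum_of_nonneg _ h.summable]
    · refine tsum_congr fun k ↦ ?_
      rw [Real.norm_eq_abs, sq_abs, real_inner_comm b, ← sq]
    · intro k
      rw [real_inner_comm b]
      exact mul_self_nonneg _
  simp_rw [enorm_tensorOp_apply, mul_pow]
  rw [ENNReal.tsum_mul_right, h2, ← mul_pow, enorm_sq_eq_ofReal, norm_tensorOp, mul_comm ‖a‖,
    mul_pow ‖b‖, ENNReal.ofReal_mul (by positivity), ← enorm_sq_eq_ofReal, ← enorm_sq_eq_ofReal,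
    mul_pow]

/-- The sample mean of tensors converges at the root-`n` rate in operator norm. -/
lemma IsIIDSample.isBigO_tensorOp [TopologicalSpace.SeparableSpace F] (hW : IsIIDSample Q W ν)
    {a : S → E} {b : S → F} (ha : MemLp a 4 ν) (hb : MemLp b 4 ν) :
    IsBigOInProbability Q (fun n ω ↦ ‖(n : ℝ)⁻¹ • ∑ i ∈ Finset.range n,
        tensorOp (a (W i ω)) (b (W i ω)) - ∫ s, tensorOp (a s) (b s) ∂ν‖)
      (fun n ↦ (n : ℝ) ^ (-(1 / 2) : ℝ)) := by
  obtain ⟨w, e, -⟩ := exists_hilbertBasis ℝ F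
  have := countable_of_hilbertBasis e
  have hab := memLp_tensorOp ha hb
  have hint : Integrable (fun s ↦ tensorOp (a s) (b s)) ν := hab.integrable (by norm_num)
  have hk : ∀ v, MemLp (fun s ↦ tensorOp (a s) (b s) v) 2 ν := fun v ↦
    hab.continuousLinearMap_comp (ContinuousLinearMap.apply ℝ E v)
  have happ : ∀ (n : ℕ) ω v, ((n : ℝ)⁻¹ • ∑ i ∈ Finset.range n,
        tensorOp (a (W i ω)) (b (W i ω)) - ∫ s, tensorOp (a s) (b s) ∂ν) v =
      empMean n (fun i ↦ tensorOp (a (W i ω)) (b (W i ω)) v) -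
        ∫ s, tensorOp (a s) (b s) v ∂ν := fun n ω v ↦ by
    rw [sub_apply, ContinuousLinearMap.integral_apply hint, smul_apply, sum_apply, empMean]
  -- The majorant is the squared Hilbert-Schmidt error, a countable sum of squared errors of
  -- `E`-valued sample means.
  refine isBigOInProbability_of_lintegral (K := ∫⁻ s, ‖tensorOp (a s) (b s)‖ₑ ^ 2 ∂ν)
    (G := fun n ω ↦ ∑' k : w, ‖empMean n (fun i ↦ tensorOp (a (W i ω)) (b (W i ω)) (e k)) -
        ∫ s, tensorOp (a s) (b s) (e k) ∂ν‖ₑ ^ 2) ?_ (fun n ↦ ?_) (fun n hn ↦ ?_) (fun n _ ω ↦ ?_)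
  · have h1 : ∫⁻ s, ‖tensorOp (a s) (b s)‖ₑ ^ 2 ∂ν =
        ENNReal.ofReal (∫ s, ‖tensorOp (a s) (b s)‖ ^ 2 ∂ν) := by
      rw [ofReal_integral_eq_lintegral_ofReal ((memLp_two_iff_integrable_sq_norm hab.1).1 hab)
        (ae_of_all _ fun _ ↦ by positivity)]
      simp_rw [enorm_sq_eq_ofReal]
    rw [h1]
    exact ENNReal.ofReal_ne_top
  · exact AEMeasurable.tsum fun k ↦
      (hW.aestronglyMeasurable_empMean (hk (e k)) n).enorm.pow_const 2
  · rw [lintegral_tsum fun k ↦ (hW.aestronglyMeasurable_empMean (hk (e k)) n).enorm.pow_const 2]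
    refine (ENNReal.tsum_le_tsum fun k ↦ hW.lintegral_empMean_sub_sq_le (hk (e k)) hn).trans ?_
    rw [ENNReal.tsum_mul_left, ← lintegral_tsum fun k ↦ (hk (e k)).1.enorm.pow_const 2]
    simp_rw [tsum_enorm_tensorOp_sq]
    exact le_rfl
  · rw [← enorm_sq_eq_ofReal]
    refine (enorm_sq_le_tsum e _).trans (le_of_eq (tsum_congr fun k ↦ ?_))
    rw [happ]

/-- Recentring at fixed vectors, by bilinearity. With the population means for `c` and `d`, the
first term is an average of i.i.d. tensors and the correction is a product of two sample mean
errors. -/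
lemma empCov_eq {n : ℕ} (hn : n ≠ 0) (A : ℕ → E) (B : ℕ → F) (c : E) (d : F) :
    empCov n A B = (n : ℝ)⁻¹ • ∑ i ∈ Finset.range n, tensorOp (A i - c) (B i - d) -
      tensorOp (empMean n A - c) (empMean n B - d) := by
  have hn0 : (n : ℝ) ≠ 0 := by positivity
  have hA : ∑ i ∈ Finset.range n, A i = (n : ℝ) • empMean n A := by
    rw [empMean, smul_smul, mul_inv_cancel₀ hn0, one_smul]
  have hB : ∑ i ∈ Finset.range n, B i = (n : ℝ) • empMean n B := by
    rw [empMean, smul_smul, mul_inv_cancel₀ hn0, one_smul]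
  have key : ∀ c d, ∑ i ∈ Finset.range n, tensorOp (A i - c) (B i - d) =
      ∑ i ∈ Finset.range n, tensorOp (A i) (B i) + (n : ℝ) • (tensorOp (empMean n A - c)
        (empMean n B - d) - tensorOp (empMean n A) (empMean n B)) := by
    intro c d
    have h1 : ∀ i, tensorOp (A i - c) (B i - d) =
        tensorOp (A i) (B i) - tensorOp (A i) d - tensorOp c (B i) + tensorOp c d := fun i ↦ by
      ext v
      simp only [tensorOp_apply, sub_apply, add_apply, inner_sub_left, sub_smul, smul_sub]
      abel
    have h2 : ∑ i ∈ Finset.range n, tensorOp (A i) d = (n : ℝ) • tensorOp (empMean n A) d := by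
      ext v
      simp only [tensorOp_apply, sum_apply, smul_apply]
      rw [← Finset.smul_sum, hA, smul_comm]
    have h3 : ∑ i ∈ Finset.range n, tensorOp c (B i) = (n : ℝ) • tensorOp c (empMean n B) := by
      ext v
      simp only [tensorOp_apply, sum_apply, smul_apply]
      rw [← Finset.sum_smul, ← sum_inner, hB, inner_smul_left, smul_smul]
      rfl
    simp_rw [h1]
    rw [Finset.sum_add_distrib, Finset.sum_sub_distrib, Finset.sum_sub_distrib, h2, h3,
      Finset.sum_const, Finset.card_range, ← Nat.cast_smul_eq_nsmul ℝ]
    ext v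
    simp only [tensorOp_apply, sub_apply, add_apply, smul_apply, inner_sub_left, sub_smul, smul_sub]
    abel
  rw [empCov, key, key c d]
  ext v
  simp only [tensorOp_apply, sub_apply, add_apply, smul_apply, inner_sub_left, sub_smul, smul_sub,
    smul_add, smul_smul, inv_mul_cancel₀ hn0]
  simp
  abel

/-- The empirical cross-covariance operator converges at the root-`n` rate in operator norm. -/
lemma IsIIDSample.isBigO_empCov [TopologicalSpace.SeparableSpace F] (hW : IsIIDSample Q W ν)
    {a : S → E} {b : S → F} (ha : MemLp a 4 ν) (hb : MemLp b 4 ν) :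
    IsBigOInProbability Q
      (fun n ω ↦ ‖empCov n (fun i ↦ a (W i ω)) (fun i ↦ b (W i ω)) - crossCov ν a b‖)
      (fun n ↦ (n : ℝ) ^ (-(1 / 2) : ℝ)) := by
  have ha2 : MemLp a 2 ν := ha.mono_exponent (by norm_num)
  have hb2 : MemLp b 2 ν := hb.mono_exponent (by norm_num)
  have h1 := hW.isBigO_tensorOp (a := fun s ↦ a s - ∫ s', a s' ∂ν)
    (b := fun s ↦ b s - ∫ s', b s' ∂ν) (ha.sub (memLp_const _)) (hb.sub (memLp_const _))
  refine ((h1.add (hW.isBigO_empMean ha2)).add (hW.isBigO_empMean hb2)).of_imp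
    -- `C` accounts for the average of tensors, and `C ^ 2` for the recentring product, one of whose
    -- factors `n ^ (-1/2)` is bounded by `1`.
    (fun n ↦ by positivity) fun C hC ↦ ⟨C + C ^ 2, ?_⟩
  filter_upwards [eventually_ne_atTop 0] with n hn ω hω
  have hn1 : (n : ℝ) ^ (-(1 / 2) : ℝ) ≤ 1 :=
    Real.rpow_le_one_of_one_le_of_nonpos (by exact_mod_cast Nat.one_le_iff_ne_zero.2 hn)
      (by norm_num)
  have hn0 : 0 ≤ (n : ℝ) ^ (-(1 / 2) : ℝ) := by positivity
  rw [abs_of_nonneg (by positivity)] at hω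
  rw [abs_of_nonneg (by positivity), empCov_eq hn _ _ (∫ s, a s ∂ν) (∫ s, b s ∂ν), crossCov,
    sub_right_comm]
  refine (norm_sub_le _ _).trans ?_
  rw [norm_tensorOp, add_mul]
  set x := ‖empMean n (fun i ↦ a (W i ω)) - ∫ s, a s ∂ν‖
  set y := ‖empMean n (fun i ↦ b (W i ω)) - ∫ s, b s ∂ν‖
  set z := ‖(n : ℝ)⁻¹ • ∑ i ∈ Finset.range n, tensorOp (a (W i ω) - ∫ s, a s ∂ν)
    (b (W i ω) - ∫ s, b s ∂ν) - ∫ s, tensorOp (a s - ∫ s', a s' ∂ν) (b s - ∫ s', b s' ∂ν) ∂ν‖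
  have hx : 0 ≤ x := norm_nonneg _
  have hy : 0 ≤ y := norm_nonneg _
  have hz : 0 ≤ z := norm_nonneg _
  refine add_le_add (by linarith) ?_
  calc x * y ≤ (C * (n : ℝ) ^ (-(1 / 2) : ℝ)) * (C * 1) := by
        refine mul_le_mul (by linarith) ?_ hy (by positivity)
        exact le_trans (by linarith) (mul_le_mul_of_nonneg_left hn1 hC)
    _ = C ^ 2 * (n : ℝ) ^ (-(1 / 2) : ℝ) := by ring

lemma crossCov_map {α : Type*} [MeasurableSpace α] {P : Measure α} {Z : α → S}
    (hZ : AEMeasurable Z P) {a : S → E} {b : S → F} (ha : AEStronglyMeasurable a (P.map Z))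
    (hb : AEStronglyMeasurable b (P.map Z)) :
    crossCov (P.map Z) a b = crossCov P (fun ω ↦ a (Z ω)) (fun ω ↦ b (Z ω)) := by
  rw [crossCov, crossCov, integral_map hZ ha, integral_map hZ hb, integral_map hZ]
  exact aestronglyMeasurable_tensorOp (ha.sub aestronglyMeasurable_const)
    (hb.sub aestronglyMeasurable_const)

lemma inner_empCov_self_nonneg (n : ℕ) (A : ℕ → E) (x : E) : 0 ≤ ⟪empCov n A A x, x⟫_ℝ := by
  rw [empCov, smul_apply, sum_apply, inner_smul_left, sum_inner]
  refine mul_nonneg (by simp) (Finset.sum_nonneg fun i _ ↦ ?_)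
  rw [tensorOp_apply, inner_smul_left]
  exact mul_self_nonneg _

end Sample

/-! ### Feature maps of reproducing kernel Hilbert spaces. -/

section KernelSpace

variable {S 𝒦 : Type*} [NormedAddCommGroup 𝒦] [InnerProductSpace ℝ 𝒦] [CompleteSpace 𝒦]
  [RKHS ℝ 𝒦 S ℝ]

open scoped InnerProductSpace

lemma inner_featureMap (f : 𝒦) (x : S) : ⟪f, featureMap 𝒦 x⟫_ℝ = f x := by
  rw [featureMap, RKHS.inner_kerFun]
  simp

lemma inner_featureMap_featureMap (x y : S) :
    ⟪featureMap 𝒦 x, featureMap 𝒦 y⟫_ℝ = realKernel 𝒦 y x := by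
  rw [inner_featureMap, featureMap, realKernel, RKHS.kerFun_apply]

lemma norm_featureMap_sq (x : S) : ‖featureMap 𝒦 x‖ ^ 2 = realKernel 𝒦 x x := by
  rw [← real_inner_self_eq_norm_sq, inner_featureMap_featureMap]

lemma norm_featureMap (x : S) : ‖featureMap 𝒦 x‖ = √(realKernel 𝒦 x x) := by
  rw [← norm_featureMap_sq, Real.sqrt_sq (norm_nonneg _)]

/-- The squared distance of two features is `κ(y, y) - 2 κ(x, y) + κ(x, x)`, which vanishes as `y`
tends to `x`. -/
lemma continuous_featureMap [TopologicalSpace S]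
    (h : Continuous fun p : S × S ↦ realKernel 𝒦 p.1 p.2) :
    Continuous fun x : S ↦ featureMap 𝒦 x := by
  rw [continuous_iff_continuousAt]
  intro x
  rw [ContinuousAt, tendsto_iff_norm_sub_tendsto_zero]
  have h1 : ∀ y, ‖featureMap 𝒦 y - featureMap 𝒦 x‖ =
      √(realKernel 𝒦 y y - 2 * realKernel 𝒦 x y + realKernel 𝒦 x x) := fun y ↦ by
    rw [← norm_featureMap_sq, ← norm_featureMap_sq, ← inner_featureMap_featureMap,
      ← norm_sub_sq_real, Real.sqrt_sq (norm_nonneg _)]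
  simp_rw [h1]
  have key : ∀ K : S → S → ℝ, (Continuous fun p : S × S ↦ K p.1 p.2) →
      Continuous fun y ↦ √(K y y - 2 * K x y + K x x) := by
    intro K hK
    have h2 : Continuous fun y ↦ K y y := hK.comp (continuous_id.prodMk continuous_id)
    have h3 : Continuous fun y ↦ K x y := hK.comp (continuous_const.prodMk continuous_id)
    fun_prop
  have hc := key _ h
  have h0 := hc.tendsto x
  have hz : realKernel 𝒦 x x - 2 * realKernel 𝒦 x x + realKernel 𝒦 x x = 0 := by ring
  rwa [hz, Real.sqrt_zero] at h0

lemma continuous_apply_of_kernel [TopologicalSpace S]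
    (h : Continuous fun p : S × S ↦ realKernel 𝒦 p.1 p.2) (f : 𝒦) : Continuous fun x : S ↦ f x := by
  simp_rw [← inner_featureMap]
  exact continuous_const.inner (continuous_featureMap h)

end KernelSpace

/-! ### Quadratic forms and kernels of covariance operators. -/

section CrossCovariance

variable {Ω : Type*} [MeasurableSpace Ω] {P : Measure Ω} [IsProbabilityMeasure P]
  {E F : Type*} [NormedAddCommGroup E] [InnerProductSpace ℝ E] [CompleteSpace E]
  [NormedAddCommGroup F] [InnerProductSpace ℝ F] [CompleteSpace F]

open scoped InnerProductSpace

lemma memLp_four_of_integrable {f : Ω → E} (hf : AEStronglyMeasurable f P)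
    (h : Integrable (fun ω ↦ ‖f ω‖ ^ 4) P) : MemLp f 4 P := by
  rw [← integrable_norm_rpow_iff hf (by norm_num) (by norm_num)]
  convert h using 2 with ω
  rw [← Real.rpow_natCast]
  norm_num

lemma integrable_tensorOp_centered {A : Ω → E} {B : Ω → F} (hA : MemLp A 4 P) (hB : MemLp B 4 P) :
    Integrable (fun ω ↦ tensorOp (A ω - ∫ ω', A ω' ∂P) (B ω - ∫ ω', B ω' ∂P)) P :=
  (memLp_tensorOp (hA.sub (memLp_const _)) (hB.sub (memLp_const _))).integrable (by norm_num)

lemma inner_crossCov {A : Ω → E} {B : Ω → F} (hA : MemLp A 4 P) (hB : MemLp B 4 P) (x : E)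
    (v : F) : ⟪x, crossCov P A B v⟫_ℝ =
      ∫ ω, ⟪x, A ω - ∫ ω', A ω' ∂P⟫_ℝ * ⟪B ω - ∫ ω', B ω' ∂P, v⟫_ℝ ∂P := by
  have h := integrable_tensorOp_centered hA hB
  rw [crossCov, ContinuousLinearMap.integral_apply h, ← integral_inner]
  · simp_rw [tensorOp_apply, inner_smul_right, mul_comm]
  · exact h.apply_continuousLinearMap v

lemma inner_crossCov_comm {A : Ω → E} {B : Ω → F} (hA : MemLp A 4 P) (hB : MemLp B 4 P) (x : E)
    (v : F) : ⟪crossCov P B A x, v⟫_ℝ = ⟪x, crossCov P A B v⟫_ℝ := by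
  rw [real_inner_comm, inner_crossCov hA hB, inner_crossCov hB hA]
  refine integral_congr_ae (ae_of_all _ fun ω ↦ ?_)
  simp only
  rw [mul_comm, real_inner_comm, real_inner_comm v]

lemma inner_crossCov_self {A : Ω → E} (hA : MemLp A 4 P) (x : E) :
    ⟪crossCov P A A x, x⟫_ℝ = ∫ ω, ⟪x, A ω - ∫ ω', A ω' ∂P⟫_ℝ ^ 2 ∂P := by
  rw [real_inner_comm, inner_crossCov hA hA]
  refine integral_congr_ae (ae_of_all _ fun ω ↦ ?_)
  simp only
  rw [real_inner_comm x, sq]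

lemma inner_crossCov_self_nonneg {A : Ω → E} (hA : MemLp A 4 P) (x : E) :
    0 ≤ ⟪crossCov P A A x, x⟫_ℝ := by
  rw [inner_crossCov_self hA]
  exact integral_nonneg fun _ ↦ sq_nonneg _

/-- The form `⟪Σ x, x⟫` is the variance of `⟪x, A⟫`. Together with its converse below, this
describes the kernel of a covariance operator as the directions in which `A` is almost surely
constant. -/
lemma exists_const_of_crossCov_self_eq_zero {A : Ω → E} (hA : MemLp A 4 P) {x : E}
    (hx : crossCov P A A x = 0) : ∃ c : ℝ, ∀ᵐ ω ∂P, ⟪x, A ω⟫_ℝ = c := by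
  have h := inner_crossCov_self hA x
  rw [hx, inner_zero_left, eq_comm, integral_eq_zero_iff_of_nonneg (fun _ ↦ sq_nonneg _)] at h
  · refine ⟨⟪x, ∫ ω', A ω' ∂P⟫_ℝ, ?_⟩
    filter_upwards [h] with ω hω
    have := pow_eq_zero_iff two_ne_zero |>.1 hω
    rwa [inner_sub_right, sub_eq_zero] at this
  · have h2 : MemLp (fun ω ↦ ⟪x, A ω - ∫ ω', A ω' ∂P⟫_ℝ) 2 P :=
      (((hA.sub (memLp_const _)).mono_exponent (by norm_num)).const_inner x)
    exact h2.integrable_sq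

lemma crossCov_self_eq_zero_of_const {A : Ω → E} (hA : MemLp A 4 P) {x : E} {c : ℝ}
    (h : ∀ᵐ ω ∂P, ⟪x, A ω⟫_ℝ = c) : crossCov P A A x = 0 := by
  have hi : Integrable A P := hA.integrable (by norm_num)
  have hc : ⟪x, ∫ ω', A ω' ∂P⟫_ℝ = c := by
    rw [← integral_inner hi, integral_congr_ae h]
    simp
  refine ext_inner_left ℝ fun y ↦ ?_
  rw [inner_crossCov hA hA, inner_zero_right]
  refine integral_eq_zero_of_ae ?_
  filter_upwards [h] with ω hω
  rw [real_inner_comm x, inner_sub_right x, hω, hc, sub_self, mul_zero]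
  rfl

end CrossCovariance

/-! ### Uncorrelatedness of regression residuals. -/

section ConditionalExpectation

variable {Ω : Type*} {m mΩ : MeasurableSpace Ω} {P : Measure Ω} [IsProbabilityMeasure P]
  {H : Type*} [NormedAddCommGroup H] [InnerProductSpace ℝ H] [CompleteSpace H]

open scoped InnerProductSpace

/-- The residual of a conditional expectation is uncorrelated with conditioning variables. -/
lemma integral_mul_inner_sub_condExp (hm : m ≤ mΩ) {U C : Ω → H} (hU : Integrable U P)
    (hC : P[U | m] =ᵐ[P] C) {φ : Ω → ℝ} (hφ : StronglyMeasurable[m] φ)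
    (h1 : Integrable (φ • U) P) (h2 : Integrable (φ • C) P) (v : H) :
    ∫ ω, φ ω * ⟪U ω - C ω, v⟫_ℝ ∂P = 0 := by
  have h3 : ∫ ω, (φ • U) ω ∂P = ∫ ω, (φ • C) ω ∂P := by
    rw [← integral_condExp hm]
    refine integral_congr_ae ?_
    filter_upwards [condExp_smul_of_aestronglyMeasurable_left hφ.aestronglyMeasurable h1 hU, hC]
      with ω hω hω'
    rw [hω, Pi.smul_apply', Pi.smul_apply', hω']
  have h4 : ∀ ω, φ ω * ⟪U ω - C ω, v⟫_ℝ = ⟪v, (φ • U) ω - (φ • C) ω⟫_ℝ := fun ω ↦ by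
    rw [Pi.smul_apply', Pi.smul_apply', ← smul_sub, inner_smul_right, real_inner_comm]
  have h5 : Integrable (fun ω ↦ (φ • U) ω - (φ • C) ω) P := h1.sub h2
  simp_rw [h4]
  rw [integral_inner h5, integral_sub h1 h2, h3, sub_self, inner_zero_right]

/-- The residual is uncorrelated with the features that generate the conditional expectation. -/
lemma integral_inner_mul_residual_of_condExp {E : Type*} [NormedAddCommGroup E]
    [InnerProductSpace ℝ E] (hm : m ≤ mΩ) {A : Ω → E} (hAm : StronglyMeasurable[m] A)
    (hA : MemLp A 4 P) {U C : Ω → H} (hU : Integrable U P)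
    (hAU : Integrable (fun ω ↦ ‖A ω‖ * ‖U ω‖) P) {L : E →L[ℝ] H} {c : H}
    (hCL : ∀ ω, C ω = c + L (A ω)) (hC : P[U | m] =ᵐ[P] C) (f : E) (v : H) :
    Integrable (fun ω ↦ ⟪f, A ω⟫_ℝ * ⟪U ω - C ω, v⟫_ℝ) P ∧
      ∫ ω, ⟪f, A ω⟫_ℝ * ⟪U ω - C ω, v⟫_ℝ ∂P = 0 := by
  have hAs := hAm.mono hm
  have hφ : StronglyMeasurable[m] fun ω ↦ ⟪f, A ω⟫_ℝ :=
    StronglyMeasurable.inner stronglyMeasurable_const hAm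
  have hφ' : AEStronglyMeasurable (fun ω ↦ ⟪f, A ω⟫_ℝ) P := (hφ.mono hm).aestronglyMeasurable
  have hA1 : Integrable (fun ω ↦ ‖A ω‖) P := (hA.integrable (by norm_num)).norm
  have hA2 : Integrable (fun ω ↦ ‖A ω‖ ^ 2) P :=
    (memLp_two_iff_integrable_sq_norm hA.1).1 (hA.mono_exponent (by norm_num))
  have hCm : AEStronglyMeasurable C P := by
    have : C = fun ω ↦ c + L (A ω) := funext hCL
    rw [this]
    exact (aestronglyMeasurable_const.add (L.continuous.comp_aestronglyMeasurable hA.1))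
  have h1 : Integrable ((fun ω ↦ ⟪f, A ω⟫_ℝ) • U) P := by
    refine (hAU.const_mul ‖f‖).mono' (hφ'.smul hU.1) (ae_of_all _ fun ω ↦ ?_)
    rw [Pi.smul_apply', norm_smul, ← mul_assoc]
    exact mul_le_mul_of_nonneg_right (norm_inner_le_norm _ _) (norm_nonneg _)
  have h2 : Integrable ((fun ω ↦ ⟪f, A ω⟫_ℝ) • C) P := by
    refine (((hA1.mul_const ‖c‖).add (hA2.const_mul ‖L‖)).const_mul ‖f‖).mono' (hφ'.smul hCm)
      (ae_of_all _ fun ω ↦ ?_)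
    rw [Pi.smul_apply', norm_smul, Pi.add_apply]
    calc ‖⟪f, A ω⟫_ℝ‖ * ‖C ω‖ ≤ (‖f‖ * ‖A ω‖) * (‖c‖ + ‖L‖ * ‖A ω‖) := by
          refine mul_le_mul (norm_inner_le_norm _ _) ?_ (norm_nonneg _) (by positivity)
          rw [hCL]
          exact (norm_add_le _ _).trans (add_le_add_right (L.le_opNorm _) _)
      _ = ‖f‖ * (‖A ω‖ * ‖c‖ + ‖L‖ * ‖A ω‖ ^ 2) := by ring
  refine ⟨?_, integral_mul_inner_sub_condExp hm hU hC hφ h1 h2 v⟩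
  refine ((h1.sub h2).inner_const v).congr (ae_of_all _ fun ω ↦ ?_)
  simp only [Pi.sub_apply, Pi.smul_apply', ← smul_sub, inner_smul_left, conj_trivial]

/-- A centred residual is uncorrelated with variables of which it is independent. -/
lemma integral_mul_inner_residual_of_indepFun {S : Type*} [MeasurableSpace S]
    [MeasurableSpace H] [BorelSpace H] {R : Ω → H}
    {T : Ω → S} (hR : Integrable R P) (hR0 : ∫ ω, R ω ∂P = 0) (hRT : IndepFun R T P) {φ : S → ℝ}
    (hφ : Measurable φ) (hφi : Integrable (fun ω ↦ φ (T ω)) P) (v : H) :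
    Integrable (fun ω ↦ φ (T ω) * ⟪R ω, v⟫_ℝ) P ∧ ∫ ω, φ (T ω) * ⟪R ω, v⟫_ℝ ∂P = 0 := by
  have hRv : Integrable (fun ω ↦ ⟪R ω, v⟫_ℝ) P := hR.inner_const v
  have hind : IndepFun (fun ω ↦ φ (T ω)) (fun ω ↦ ⟪R ω, v⟫_ℝ) P :=
    hRT.symm.comp (φ := φ) (ψ := fun h ↦ ⟪h, v⟫_ℝ) hφ
      ((continuous_id.inner continuous_const).measurable)
  refine ⟨hind.integrable_mul hφi hRv, ?_⟩
  rw [hind.integral_fun_mul_eq_mul_integral hφi.1 hRv.1]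
  have : ∫ ω, ⟪R ω, v⟫_ℝ ∂P = 0 := by
    simp_rw [real_inner_comm v]
    rw [integral_inner hR, hR0, inner_zero_right]
  rw [this, mul_zero]

end ConditionalExpectation

/-! ### The joint regression as the pair of separate regressions. -/

namespace MediationModel

variable {Ω ΩX ΩM ΩY H 𝒳 ℳ : Type*} [MeasurableSpace Ω]
  [MetricSpace ΩX] [SecondCountableTopology ΩX] [MeasurableSpace ΩX] [BorelSpace ΩX]
  [MetricSpace ΩM] [SecondCountableTopology ΩM] [MeasurableSpace ΩM] [BorelSpace ΩM]
  [MetricSpace ΩY] [SecondCountableTopology ΩY] [MeasurableSpace ΩY] [BorelSpace ΩY]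
  [NormedAddCommGroup H] [InnerProductSpace ℝ H] [CompleteSpace H]
  [SecondCountableTopology H] [MeasurableSpace H] [BorelSpace H]
  [NormedAddCommGroup 𝒳] [InnerProductSpace ℝ 𝒳] [CompleteSpace 𝒳] [RKHS ℝ 𝒳 ΩX ℝ]
  [NormedAddCommGroup ℳ] [InnerProductSpace ℝ ℳ] [CompleteSpace ℳ] [RKHS ℝ ℳ ΩM ℝ]
  {𝔐 : MediationModel Ω ΩX ΩM ΩY H}

open scoped InnerProductSpace

lemma norm_jointFeature_sq (x : ΩX) (m : ΩM) :
    ‖jointFeature 𝒳 ℳ x m‖ ^ 2 = ‖featureMap 𝒳 x‖ ^ 2 + ‖featureMap ℳ m‖ ^ 2 := by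
  rw [WithLp.prod_norm_sq_eq_of_L2]
  rfl

lemma stronglyMeasurable_featX (hκX : Continuous fun p : ΩX × ΩX ↦ realKernel 𝒳 p.1 p.2) :
    StronglyMeasurable[sigmaOf 𝔐.X] (𝔐.featX 𝒳) :=
  (continuous_featureMap hκX).comp_stronglyMeasurable
    (comap_measurable 𝔐.X).stronglyMeasurable

lemma stronglyMeasurable_featM (hκM : Continuous fun p : ΩM × ΩM ↦ realKernel ℳ p.1 p.2) :
    StronglyMeasurable[sigmaOf 𝔐.M] (𝔐.featM ℳ) :=
  (continuous_featureMap hκM).comp_stronglyMeasurable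
    (comap_measurable 𝔐.M).stronglyMeasurable

lemma memLp_featX (hb : 𝔐.Basic) (h4 : 𝔐.FourthMoments 𝒳 ℳ)
    (hκX : Continuous fun p : ΩX × ΩX ↦ realKernel 𝒳 p.1 p.2) : MemLp (𝔐.featX 𝒳) 4 𝔐.P := by
  have := hb.isProb
  refine memLp_four_of_integrable
    ((stronglyMeasurable_featX hκX).mono hb.measX.comap_le).aestronglyMeasurable ?_
  refine h4.kX.congr (ae_of_all _ fun ω ↦ ?_)
  simp only [featX, ← norm_featureMap_sq]
  ring

lemma memLp_featM (hb : 𝔐.Basic) (h4 : 𝔐.FourthMoments 𝒳 ℳ)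
    (hκM : Continuous fun p : ΩM × ΩM ↦ realKernel ℳ p.1 p.2) : MemLp (𝔐.featM ℳ) 4 𝔐.P := by
  have := hb.isProb
  refine memLp_four_of_integrable
    ((stronglyMeasurable_featM hκM).mono hb.measM.comap_le).aestronglyMeasurable ?_
  refine h4.kM.congr (ae_of_all _ fun ω ↦ ?_)
  simp only [featM, ← norm_featureMap_sq]
  ring

lemma memLp_featZ (hb : 𝔐.Basic) (h4 : 𝔐.FourthMoments 𝒳 ℳ)
    (hκX : Continuous fun p : ΩX × ΩX ↦ realKernel 𝒳 p.1 p.2)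
    (hκM : Continuous fun p : ΩM × ΩM ↦ realKernel ℳ p.1 p.2) :
    MemLp (𝔐.featZ 𝒳 ℳ) 4 𝔐.P := by
  have := hb.isProb
  have hm : AEStronglyMeasurable (𝔐.featZ 𝒳 ℳ) 𝔐.P :=
    (WithLp.prod_continuous_toLp 2 𝒳 ℳ).comp_aestronglyMeasurable
      ((memLp_featX hb h4 hκX).1.prodMk (memLp_featM hb h4 hκM).1)
  refine memLp_four_of_integrable hm ?_
  refine ((h4.kX.add h4.kM).const_mul 2).mono' (hm.norm.pow 4) (ae_of_all _ fun ω ↦ ?_)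
  rw [Real.norm_of_nonneg (by positivity), Pi.add_apply, ← norm_featureMap_sq,
    ← norm_featureMap_sq]
  have h : ‖𝔐.featZ 𝒳 ℳ ω‖ ^ 4 =
      (‖featureMap 𝒳 (𝔐.X ω)‖ ^ 2 + ‖featureMap ℳ (𝔐.M ω)‖ ^ 2) ^ 2 := by
    rw [← norm_jointFeature_sq]
    simp only [featZ]
    ring
  rw [h]
  nlinarith [sq_nonneg (‖featureMap 𝒳 (𝔐.X ω)‖ ^ 2 - ‖featureMap ℳ (𝔐.M ω)‖ ^ 2)]

lemma memLp_V (hb : 𝔐.Basic) (h4 : 𝔐.FourthMoments 𝒳 ℳ) (hρ : Isometry 𝔐.ρ) :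
    MemLp 𝔐.V 4 𝔐.P := by
  have := hb.isProb
  exact memLp_four_of_integrable
    (hρ.continuous.measurable.comp hb.measY).stronglyMeasurable.aestronglyMeasurable h4.V

lemma inner_jointFeature (z : JointSpace 𝒳 ℳ) (x : ΩX) (m : ΩM) :
    ⟪z, jointFeature 𝒳 ℳ x m⟫_ℝ = z.fst x + z.snd m := by
  rw [WithLp.prod_inner_apply, ← inner_featureMap, ← inner_featureMap]
  rfl

lemma inner_featZ (z : JointSpace 𝒳 ℳ) (ω : Ω) :
    ⟪z, 𝔐.featZ 𝒳 ℳ ω⟫_ℝ = ⟪z.fst, 𝔐.featX 𝒳 ω⟫_ℝ + ⟪z.snd, 𝔐.featM ℳ ω⟫_ℝ := by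
  rw [WithLp.prod_inner_apply]
  rfl

lemma inner_integral_featZ (hX : Integrable (𝔐.featX 𝒳) 𝔐.P) (hM : Integrable (𝔐.featM ℳ) 𝔐.P)
    (hZ : Integrable (𝔐.featZ 𝒳 ℳ) 𝔐.P) (z : JointSpace 𝒳 ℳ) :
    ⟪z, ∫ ω, 𝔐.featZ 𝒳 ℳ ω ∂𝔐.P⟫_ℝ = ⟪z.fst, 𝔐.muX 𝒳⟫_ℝ + ⟪z.snd, 𝔐.muM ℳ⟫_ℝ := by
  rw [← integral_inner hZ, muX, muM, ← integral_inner hX, ← integral_inner hM,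
    ← integral_add (hX.const_inner _) (hM.const_inner _)]
  simp_rw [inner_featZ]

/-- The features are centred, so the residual has mean zero for any operator `L`; no conditional
expectation is involved. -/
lemma integral_sub_weak_eq_zero {E : Type*} [NormedAddCommGroup E] [InnerProductSpace ℝ E]
    [CompleteSpace E] {P : Measure Ω} [IsProbabilityMeasure P] {U : Ω → H} {A : Ω → E}
    (hU : Integrable U P) (hA : Integrable A P) (L : E →L[ℝ] H) :
    Integrable (fun ω ↦ U ω - (∫ ω', U ω' ∂P + L (A ω - ∫ ω', A ω' ∂P))) P ∧
      ∫ ω, (U ω - (∫ ω', U ω' ∂P + L (A ω - ∫ ω', A ω' ∂P))) ∂P = 0 := by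
  have h1 : Integrable (fun ω ↦ A ω - ∫ ω', A ω' ∂P) P := hA.sub (integrable_const _)
  have h2 : Integrable (fun ω ↦ L (A ω - ∫ ω', A ω' ∂P)) P := L.integrable_comp h1
  have h3 : Integrable (fun ω ↦ ∫ ω', U ω' ∂P + L (A ω - ∫ ω', A ω' ∂P)) P :=
    (integrable_const _).add h2
  refine ⟨hU.sub h3, ?_⟩
  rw [integral_sub hU h3, integral_add (integrable_const _) h2, L.integral_comp_comm h1,
    integral_sub hA (integrable_const _)]
  simp

lemma integral_add_eq_zero {P : Measure Ω} {f g : Ω → ℝ} (hf : Integrable f P ∧ ∫ ω, f ω ∂P = 0)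
    (hg : Integrable g P ∧ ∫ ω, g ω ∂P = 0) :
    Integrable (fun ω ↦ f ω + g ω) P ∧ ∫ ω, f ω + g ω ∂P = 0 :=
  ⟨hf.1.add hg.1, by rw [integral_add hf.1 hg.1, hf.2, hg.2, add_zero]⟩

lemma integral_sub_eq_zero {P : Measure Ω} {f g : Ω → ℝ} (hf : Integrable f P ∧ ∫ ω, f ω ∂P = 0)
    (hg : Integrable g P ∧ ∫ ω, g ω ∂P = 0) :
    Integrable (fun ω ↦ f ω - g ω) P ∧ ∫ ω, f ω - g ω ∂P = 0 :=
  ⟨hf.1.sub hg.1, by rw [integral_sub hf.1 hg.1, hf.2, hg.2, sub_zero]⟩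

lemma integral_const_mul_eq_zero {P : Measure Ω} {f : Ω → ℝ} (c : ℝ)
    (hf : Integrable f P ∧ ∫ ω, f ω ∂P = 0) :
    Integrable (fun ω ↦ c * f ω) P ∧ ∫ ω, c * f ω ∂P = 0 :=
  ⟨hf.1.const_mul c, by rw [integral_const_mul, hf.2, mul_zero]⟩

/-- The normal equation: the population regression of the outcome on the joint features is solved
by the pair of regressions of the two parts of the outcome. -/
theorem covZZ_apply_regressionPair (hκX : Continuous fun p : ΩX × ΩX ↦ realKernel 𝒳 p.1 p.2)
    (hκM : Continuous fun p : ΩM × ΩM ↦ realKernel ℳ p.1 p.2) (hb : 𝔐.Basic)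
    (hρ : Isometry 𝔐.ρ) (hdec : 𝔐.Decomposition) (hmom : 𝔐.Moments 𝒳 ℳ)
    (h4 : 𝔐.FourthMoments 𝒳 ℳ) (hweak : 𝔐.CondExpEqWeak 𝒳 ℳ) (hres : 𝔐.ResidualIndep 𝒳 ℳ)
    (v : H) :
    𝔐.covZZ 𝒳 ℳ (WithLp.toLp 2 (𝔐.RXV 𝒳 v, 𝔐.RMV ℳ v)) = 𝔐.covZV 𝒳 ℳ v := by
  have := hb.isProb
  have hX := memLp_featX hb h4 hκX
  have hM := memLp_featM hb h4 hκM
  have hZ := memLp_featZ hb h4 hκX hκM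
  have hV := memLp_V hb h4 hρ
  have hXi : Integrable (𝔐.featX 𝒳) 𝔐.P := hX.integrable (by norm_num)
  have hMi : Integrable (𝔐.featM ℳ) 𝔐.P := hM.integrable (by norm_num)
  have hZi : Integrable (𝔐.featZ 𝒳 ℳ) 𝔐.P := hZ.integrable (by norm_num)
  have hEV : ∫ ω, 𝔐.V ω ∂𝔐.P = ∫ ω, 𝔐.VI ω ∂𝔐.P + ∫ ω, 𝔐.VD ω ∂𝔐.P := by
    rw [← integral_add hmom.VI hmom.VD]
    exact integral_congr_ae hdec.add
  set r : JointSpace 𝒳 ℳ := WithLp.toLp 2 (𝔐.RXV 𝒳 v, 𝔐.RMV ℳ v) with hr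
  set RI : Ω → H := fun ω ↦ 𝔐.VI ω - 𝔐.Psi ℳ (𝔐.M ω) with hRI
  set RD : Ω → H := fun ω ↦ 𝔐.VD ω - 𝔐.gam 𝒳 (𝔐.X ω) with hRD
  obtain ⟨hRIi, hRI0⟩ : Integrable RI 𝔐.P ∧ ∫ ω, RI ω ∂𝔐.P = 0 :=
    integral_sub_weak_eq_zero hmom.VI hMi (𝔐.RMV ℳ).adjoint
  obtain ⟨hRDi, hRD0⟩ : Integrable RD 𝔐.P ∧ ∫ ω, RD ω ∂𝔐.P = 0 :=
    integral_sub_weak_eq_zero hmom.VD hXi (𝔐.RXV 𝒳).adjoint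
  -- Four correlations of residuals with features have to vanish. The residual of `V_I` against `M`
  -- and that of `V_D` against `X` are treated by conditioning; the crossed ones, `hIX` and `hDM`,
  -- by independence of the residuals.
  have hIM : ∀ g : ℳ, _ := fun g ↦ integral_inner_mul_residual_of_condExp hb.measM.comap_le
    (stronglyMeasurable_featM hκM) hM hmom.VI (C := fun ω ↦ 𝔐.Psi ℳ (𝔐.M ω))
    (hmom.kM_VI.congr (ae_of_all _ fun ω ↦ by
      simp only [featM, norm_featureMap]))
    (L := (𝔐.RMV ℳ).adjoint) (c := ∫ ω, 𝔐.VI ω ∂𝔐.P - (𝔐.RMV ℳ).adjoint (𝔐.muM ℳ))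
    (fun ω ↦ by simp only [Psi, map_sub, featM]; abel) hweak.VI_M g v
  have hDX : ∀ f : 𝒳, _ := fun f ↦ integral_inner_mul_residual_of_condExp hb.measX.comap_le
    (stronglyMeasurable_featX hκX) hX hmom.VD (C := fun ω ↦ 𝔐.gam 𝒳 (𝔐.X ω))
    (hmom.kX_VD.congr (ae_of_all _ fun ω ↦ by
      simp only [featX, norm_featureMap]))
    (L := (𝔐.RXV 𝒳).adjoint) (c := ∫ ω, 𝔐.VD ω ∂𝔐.P - (𝔐.RXV 𝒳).adjoint (𝔐.muX 𝒳))
    (fun ω ↦ by simp only [gam, map_sub, featX]; abel) hweak.VD_X f v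
  have hIX : ∀ f : 𝒳, Integrable (fun ω ↦ ⟪f, 𝔐.featX 𝒳 ω⟫_ℝ * ⟪RI ω, v⟫_ℝ) 𝔐.P ∧
      ∫ ω, ⟪f, 𝔐.featX 𝒳 ω⟫_ℝ * ⟪RI ω, v⟫_ℝ ∂𝔐.P = 0 := fun f ↦
    integral_mul_inner_residual_of_indepFun hRIi hRI0 hres.VI
      (φ := fun x ↦ ⟪f, featureMap 𝒳 x⟫_ℝ)
      ((continuous_const.inner (continuous_featureMap hκX)).measurable) (hXi.const_inner f) v
  have hDM : ∀ g : ℳ, Integrable (fun ω ↦ ⟪g, 𝔐.featM ℳ ω⟫_ℝ * ⟪RD ω, v⟫_ℝ) 𝔐.P ∧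
      ∫ ω, ⟪g, 𝔐.featM ℳ ω⟫_ℝ * ⟪RD ω, v⟫_ℝ ∂𝔐.P = 0 := fun g ↦
    integral_mul_inner_residual_of_indepFun hRDi hRD0 hres.VD
      (φ := fun x ↦ ⟪g, featureMap ℳ x⟫_ℝ)
      ((continuous_const.inner (continuous_featureMap hκM)).measurable) (hMi.const_inner g) v
  have hI1 : Integrable (fun ω ↦ ⟪RI ω, v⟫_ℝ) 𝔐.P ∧ ∫ ω, ⟪RI ω, v⟫_ℝ ∂𝔐.P = 0 := by
    simpa using integral_mul_inner_residual_of_indepFun hRIi hRI0 hres.VI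
      (φ := fun _ ↦ 1) measurable_const (integrable_const _) v
  have hD1 : Integrable (fun ω ↦ ⟪RD ω, v⟫_ℝ) 𝔐.P ∧ ∫ ω, ⟪RD ω, v⟫_ℝ ∂𝔐.P = 0 := by
    simpa using integral_mul_inner_residual_of_indepFun hRDi hRD0 hres.VD
      (φ := fun _ ↦ 1) measurable_const (integrable_const _) v
  refine ext_inner_left ℝ fun z ↦ ?_
  rw [covZZ, covZV, inner_crossCov hZ hZ, inner_crossCov hZ hV, eq_comm, ← sub_eq_zero]
  have hZ2 : MemLp (fun ω ↦ ⟪z, 𝔐.featZ 𝒳 ℳ ω - ∫ ω', 𝔐.featZ 𝒳 ℳ ω' ∂𝔐.P⟫_ℝ) 2 𝔐.P :=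
    (((hZ.sub (memLp_const _)).mono_exponent (by norm_num)).const_inner z)
  have hZr2 : MemLp (fun ω ↦ ⟪𝔐.featZ 𝒳 ℳ ω - ∫ ω', 𝔐.featZ 𝒳 ℳ ω' ∂𝔐.P, r⟫_ℝ) 2 𝔐.P :=
    (((hZ.sub (memLp_const _)).mono_exponent (by norm_num)).inner_const r)
  have hV2 : MemLp (fun ω ↦ ⟪𝔐.V ω - ∫ ω', 𝔐.V ω' ∂𝔐.P, v⟫_ℝ) 2 𝔐.P :=
    (((hV.sub (memLp_const _)).mono_exponent (by norm_num)).inner_const v)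
  have hp1 : Integrable (fun ω ↦ ⟪z, 𝔐.featZ 𝒳 ℳ ω - ∫ ω', 𝔐.featZ 𝒳 ℳ ω' ∂𝔐.P⟫_ℝ *
      ⟪𝔐.V ω - ∫ ω', 𝔐.V ω' ∂𝔐.P, v⟫_ℝ) 𝔐.P := MemLp.integrable_mul hZ2 hV2
  have hp2 : Integrable (fun ω ↦ ⟪z, 𝔐.featZ 𝒳 ℳ ω - ∫ ω', 𝔐.featZ 𝒳 ℳ ω' ∂𝔐.P⟫_ℝ *
      ⟪𝔐.featZ 𝒳 ℳ ω - ∫ ω', 𝔐.featZ 𝒳 ℳ ω' ∂𝔐.P, r⟫_ℝ) 𝔐.P := MemLp.integrable_mul hZ2 hZr2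
  rw [← integral_sub hp1 hp2]
  set k : ℝ := ⟪z.fst, 𝔐.muX 𝒳⟫_ℝ + ⟪z.snd, 𝔐.muM ℳ⟫_ℝ with hk
  -- The two sides of the normal equation, tested against `z`, differ by the correlation of the
  -- centred feature with the joint residual `V - Ψ(M) - γ(X) = RI + RD`. The constant `k` is the
  -- mean of `⟪z, featZ⟫`.
  have hae : (fun ω ↦ ⟪z, 𝔐.featZ 𝒳 ℳ ω - ∫ ω', 𝔐.featZ 𝒳 ℳ ω' ∂𝔐.P⟫_ℝ *
        ⟪𝔐.V ω - ∫ ω', 𝔐.V ω' ∂𝔐.P, v⟫_ℝ - ⟪z, 𝔐.featZ 𝒳 ℳ ω - ∫ ω', 𝔐.featZ 𝒳 ℳ ω' ∂𝔐.P⟫_ℝ *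
        ⟪𝔐.featZ 𝒳 ℳ ω - ∫ ω', 𝔐.featZ 𝒳 ℳ ω' ∂𝔐.P, r⟫_ℝ) =ᵐ[𝔐.P]
      fun ω ↦ ((⟪z.fst, 𝔐.featX 𝒳 ω⟫_ℝ * ⟪RI ω, v⟫_ℝ + ⟪z.fst, 𝔐.featX 𝒳 ω⟫_ℝ * ⟪RD ω, v⟫_ℝ) +
        (⟪z.snd, 𝔐.featM ℳ ω⟫_ℝ * ⟪RI ω, v⟫_ℝ + ⟪z.snd, 𝔐.featM ℳ ω⟫_ℝ * ⟪RD ω, v⟫_ℝ)) -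
        k * (⟪RI ω, v⟫_ℝ + ⟪RD ω, v⟫_ℝ) := by
    filter_upwards [hdec.add] with ω hω
    have e1 : ⟪𝔐.featZ 𝒳 ℳ ω - ∫ ω', 𝔐.featZ 𝒳 ℳ ω' ∂𝔐.P, r⟫_ℝ =
        ⟪𝔐.Psi ℳ (𝔐.M ω) + 𝔐.gam 𝒳 (𝔐.X ω) - ∫ ω', 𝔐.V ω' ∂𝔐.P, v⟫_ℝ := by
      rw [real_inner_comm, inner_sub_right, inner_featZ, inner_integral_featZ hXi hMi hZi, hEV]
      have e2 : 𝔐.Psi ℳ (𝔐.M ω) + 𝔐.gam 𝒳 (𝔐.X ω) -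
          (∫ ω, 𝔐.VI ω ∂𝔐.P + ∫ ω, 𝔐.VD ω ∂𝔐.P) =
          (𝔐.RMV ℳ).adjoint (𝔐.featM ℳ ω - 𝔐.muM ℳ) +
            (𝔐.RXV 𝒳).adjoint (𝔐.featX 𝒳 ω - 𝔐.muX 𝒳) := by
        simp only [Psi, gam, featM, featX]
        abel
      rw [e2, inner_add_left, ContinuousLinearMap.adjoint_inner_left,
        ContinuousLinearMap.adjoint_inner_left, inner_sub_left, inner_sub_left,
        real_inner_comm (𝔐.featX 𝒳 ω), real_inner_comm (𝔐.featM ℳ ω),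
        real_inner_comm (𝔐.muX 𝒳), real_inner_comm (𝔐.muM ℳ)]
      have hr1 : r.fst = 𝔐.RXV 𝒳 v := rfl
      have hr2 : r.snd = 𝔐.RMV ℳ v := rfl
      rw [hr1, hr2]
      ring
    have e3 : ⟪𝔐.V ω - ∫ ω', 𝔐.V ω' ∂𝔐.P, v⟫_ℝ -
        ⟪𝔐.featZ 𝒳 ℳ ω - ∫ ω', 𝔐.featZ 𝒳 ℳ ω' ∂𝔐.P, r⟫_ℝ = ⟪RI ω, v⟫_ℝ + ⟪RD ω, v⟫_ℝ := by
      rw [e1, ← inner_sub_left, ← inner_add_left, hω]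
      congr 1
      simp only [hRI, hRD]
      abel
    rw [← mul_sub, e3, inner_sub_right, inner_featZ, inner_integral_featZ hXi hMi hZi]
    ring
  rw [integral_congr_ae hae]
  exact (integral_sub_eq_zero (integral_add_eq_zero (integral_add_eq_zero (hIX _) (hDX _))
    (integral_add_eq_zero (hIM _) (hDM _))) (integral_const_mul_eq_zero k
      (integral_add_eq_zero hI1 hD1))).2

lemma inner_covZZ_comm (hκX : Continuous fun p : ΩX × ΩX ↦ realKernel 𝒳 p.1 p.2)
    (hκM : Continuous fun p : ΩM × ΩM ↦ realKernel ℳ p.1 p.2) (hb : 𝔐.Basic)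
    (h4 : 𝔐.FourthMoments 𝒳 ℳ) (x y : JointSpace 𝒳 ℳ) :
    ⟪𝔐.covZZ 𝒳 ℳ x, y⟫_ℝ = ⟪x, 𝔐.covZZ 𝒳 ℳ y⟫_ℝ :=
  have := hb.isProb
  inner_crossCov_comm (memLp_featZ hb h4 hκX hκM) (memLp_featZ hb h4 hκX hκM) x y

/-- Under identifiability, the joint regression operator is the pair of the separate ones. -/
theorem regressionOp_covZV_eq (hκX : Continuous fun p : ΩX × ΩX ↦ realKernel 𝒳 p.1 p.2)
    (hκM : Continuous fun p : ΩM × ΩM ↦ realKernel ℳ p.1 p.2) (hb : 𝔐.Basic)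
    (hρ : Isometry 𝔐.ρ) (hdec : 𝔐.Decomposition) (hmom : 𝔐.Moments 𝒳 ℳ)
    (h4 : 𝔐.FourthMoments 𝒳 ℳ) (hran : 𝔐.Ranges 𝒳 ℳ) (hweak : 𝔐.CondExpEqWeak 𝒳 ℳ)
    (hres : 𝔐.ResidualIndep 𝒳 ℳ) (hid : 𝔐.AdditivelyIdentifiable 𝒳 ℳ) (v : H) :
    regressionOp (𝔐.covZZ 𝒳 ℳ) (𝔐.covZV 𝒳 ℳ) v =
      WithLp.toLp 2 (𝔐.RXV 𝒳 v, 𝔐.RMV ℳ v) := by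
  have := hb.isProb
  have hX := memLp_featX hb h4 hκX
  have hM := memLp_featM hb h4 hκM
  have hsymm := inner_covZZ_comm hκX hκM hb h4
  refine eq_of_apply_eq_of_orthogonal_ker (T := 𝔐.covZZ 𝒳 ℳ) ?_
    (fun z hz ↦ hran.ZV.inner_ker hsymm v hz) fun z hz ↦ ?_
  · rw [hran.ZV.apply_regressionOp hsymm,
      covZZ_apply_regressionPair hκX hκM hb hρ hdec hmom h4 hweak hres]
  -- The pair is orthogonal to the kernel: if `Σ_ZZ z = 0`, then `z` is almost surely constant at
  -- `(X, M)`, so by identifiability its components lie in the kernels of `Σ_XX` and `Σ_MM`, to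
  -- which the Moore-Penrose values are orthogonal.
  · obtain ⟨c, hc⟩ := exists_const_of_crossCov_self_eq_zero (memLp_featZ hb h4 hκX hκM) hz
    obtain ⟨d, hd⟩ := hid z.fst z.snd ⟨c, by
      filter_upwards [hc] with ω hω
      rwa [← inner_jointFeature]⟩
    have hd' : ∀ᵐ ω ∂𝔐.P, ⟪z.fst, 𝔐.featX 𝒳 ω⟫_ℝ = d := by
      filter_upwards [hd] with ω hω
      rwa [featX, inner_featureMap]
    have he' : ∀ᵐ ω ∂𝔐.P, ⟪z.snd, 𝔐.featM ℳ ω⟫_ℝ = c - d := by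
      filter_upwards [hd', hc] with ω hω hω'
      rw [inner_featZ] at hω'
      linarith
    rw [WithLp.prod_inner_apply]
    have h1 := hran.XV.inner_ker (inner_crossCov_comm hX hX) v
      (crossCov_self_eq_zero_of_const hX hd')
    have h2 := hran.MV.inner_ker (inner_crossCov_comm hM hM) v
      (crossCov_self_eq_zero_of_const hM he')
    exact (congrArg₂ (· + ·) h1 h2).trans (add_zero 0)

/-- Positivity implies identifiability of the additive decomposition. -/
theorem Positivity.additivelyIdentifiable (hp : 𝔐.Positivity ℳ)
    (hκX : Continuous fun p : ΩX × ΩX ↦ realKernel 𝒳 p.1 p.2)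
    (hκM : Continuous fun p : ΩM × ΩM ↦ realKernel ℳ p.1 p.2) (hb : 𝔐.Basic) (m : ΩM) :
    𝔐.AdditivelyIdentifiable 𝒳 ℳ := by
  rintro f g ⟨c, hc⟩
  have := hp.support
  have hcont : Continuous fun p : ΩX × ΩM ↦ f p.1 + g p.2 :=
    ((continuous_apply_of_kernel hκX f).comp continuous_fst).add
      ((continuous_apply_of_kernel hκM g).comp continuous_snd)
  have hae : (fun p : ΩX × ΩM ↦ f p.1 + g p.2) =ᵐ[𝔐.P.map fun ω ↦ (𝔐.X ω, 𝔐.M ω)]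
      fun _ ↦ c := by
    rw [Filter.EventuallyEq, ae_map_iff (hb.measX.prodMk hb.measM).aemeasurable
      (measurableSet_eq_fun hcont.measurable measurable_const)]
    exact hc
  -- Equality now holds at every point, also off the observed pairs, so the mediator can be frozen
  -- at the given `m`.
  have h := (Continuous.ae_eq_iff_eq _ hcont continuous_const).1 hae
  refine ⟨c - g m, ae_of_all _ fun ω ↦ ?_⟩
  have h' : f (𝔐.X ω) + g m = c := congrFun h (𝔐.X ω, m)
  linarith

end MediationModel

/-! ### Random functions evaluated at independent random indices. -/

section Freezing

variable {Ω S T : Type*} {𝒢 mΩ : MeasurableSpace Ω} [mS : MeasurableSpace S] [mT : MeasurableSpace T]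
  {P : Measure Ω} [IsProbabilityMeasure P] {E : Type*} [NormedAddCommGroup E] [NormedSpace ℝ E]
  [CompleteSpace E]

/-- The joint law is a product, so Fubini's theorem applies. -/
lemma ProbabilityTheory.IndepFun.setIntegral_eq_integral_map {Z : Ω → S} {W : Ω → T}
    (hZ : Measurable Z) (hW : Measurable W) (h : IndepFun Z W P) {F : S × T → E}
    (hF : StronglyMeasurable F) (hint : Integrable (fun ω ↦ F (Z ω, W ω)) P) {B : Set S}
    (hB : MeasurableSet B) :
    ∫ ω in Z ⁻¹' B, F (Z ω, W ω) ∂P = ∫ s in B, ∫ ω, F (s, W ω) ∂P ∂(P.map Z) := by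
  have hmap := (indepFun_iff_map_prod_eq_prod_map_map hZ.aemeasurable hW.aemeasurable).1 h
  have hZW : Measurable fun ω ↦ (Z ω, W ω) := hZ.prodMk hW
  have := Measure.isProbabilityMeasure_map (μ := P) hZ.aemeasurable
  have := Measure.isProbabilityMeasure_map (μ := P) hW.aemeasurable
  have hint' : Integrable F ((P.map Z).prod (P.map W)) := by
    rw [← hmap]
    exact (integrable_map_measure hF.aestronglyMeasurable hZW.aemeasurable).2 hint
  have h1 : ∫ ω in Z ⁻¹' B, F (Z ω, W ω) ∂P =
      ∫ p in B ×ˢ Set.univ, F p ∂((P.map Z).prod (P.map W)) := by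
    rw [← hmap, setIntegral_map (hB.prod MeasurableSet.univ) hF.aestronglyMeasurable
      hZW.aemeasurable]
    congr 2
    ext ω
    simp
  rw [h1, setIntegral_prod _ hint'.integrableOn]
  refine integral_congr_ae (ae_of_all _ fun s ↦ ?_)
  simp only [Measure.restrict_univ]
  exact integral_map hW.aemeasurable
    (hF.comp_measurable measurable_prodMk_left).aestronglyMeasurable

lemma ProbabilityTheory.IndepFun.condExp_eq_integral {Z : Ω → S} {W : Ω → T}
    (hZ : Measurable Z) (hW : Measurable W) (h : IndepFun Z W P) {F : S × T → E}
    (hF : StronglyMeasurable F) (hint : Integrable (fun ω ↦ F (Z ω, W ω)) P) :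
    (fun ω ↦ ∫ ω', F (Z ω, W ω') ∂P) =ᵐ[P] P[fun ω ↦ F (Z ω, W ω) | sigmaOf Z] := by
  have hmap := (indepFun_iff_map_prod_eq_prod_map_map hZ.aemeasurable hW.aemeasurable).1 h
  have hZW : Measurable fun ω ↦ (Z ω, W ω) := hZ.prodMk hW
  have := Measure.isProbabilityMeasure_map (μ := P) hZ.aemeasurable
  have := Measure.isProbabilityMeasure_map (μ := P) hW.aemeasurable
  have hint' : Integrable F ((P.map Z).prod (P.map W)) := by
    rw [← hmap]
    exact (integrable_map_measure hF.aestronglyMeasurable hZW.aemeasurable).2 hint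
  have hG : (fun s ↦ ∫ ω, F (s, W ω) ∂P) = fun s ↦ ∫ t, F (s, t) ∂(P.map W) := by
    ext s
    exact (integral_map hW.aemeasurable
      (hF.comp_measurable measurable_prodMk_left).aestronglyMeasurable).symm
  have hGm : StronglyMeasurable fun s ↦ ∫ ω, F (s, W ω) ∂P := by
    rw [hG]
    exact hF.integral_prod_right'
  have hGi : Integrable (fun s ↦ ∫ ω, F (s, W ω) ∂P) (P.map Z) := by
    rw [hG]
    exact hint'.integral_prod_left
  have hGZ : Integrable (fun ω ↦ ∫ ω', F (Z ω, W ω') ∂P) P := hGi.comp_measurable hZ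
  refine ae_eq_condExp_of_forall_setIntegral_eq hZ.comap_le hint (fun s _ _ ↦ hGZ.integrableOn)
    ?_ (hGm.comp_measurable (comap_measurable Z)).aestronglyMeasurable
  rintro _ ⟨B, hB, rfl⟩ _
  rw [h.setIntegral_eq_integral_map hZ hW hF hint hB,
    setIntegral_map hB hGm.aestronglyMeasurable hZ.aemeasurable]

/-- Integration of a random function at an independent random index. -/
lemma ProbabilityTheory.Indep.integral_randomFunction (h𝒢 : 𝒢 ≤ mΩ)
    {Z : Ω → S} (hZ : Measurable Z) (h : Indep 𝒢 (sigmaOf Z) P) {F : S → Ω → E}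
    (hF : StronglyMeasurable[mS.prod 𝒢] fun p : S × Ω ↦ F p.1 p.2)
    (hint : Integrable (fun ω ↦ F (Z ω) ω) P) :
    ∫ ω, F (Z ω) ω ∂P = ∫ s, ∫ ω, F s ω ∂P ∂(P.map Z) := by
  -- The second variable is the identity of `Ω` with the σ-algebra `𝒢`, which turns the random
  -- function into a deterministic function of two independent variables.
  have hind : @IndepFun Ω S Ω mΩ mS 𝒢 Z id P := by
    refine (@IndepFun_iff_Indep Ω S Ω mΩ mS 𝒢 Z id P).2 ?_
    have hid : MeasurableSpace.comap id 𝒢 = 𝒢 := MeasurableSpace.comap_id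
    rw [hid]
    exact h.symm
  have := @IndepFun.setIntegral_eq_integral_map Ω S Ω mΩ mS 𝒢 P _ E _ _ _ Z id hZ
    (measurable_id'' h𝒢) hind _ hF hint Set.univ MeasurableSet.univ
  simpa using this

/-- Conditional expectation of a random function at an independent random index. -/
lemma ProbabilityTheory.Indep.condExp_randomFunction (h𝒢 : 𝒢 ≤ mΩ)
    {Z : Ω → S} (hZ : Measurable Z) (h : Indep 𝒢 (sigmaOf Z) P) {F : S → Ω → E}
    (hF : StronglyMeasurable[mS.prod 𝒢] fun p : S × Ω ↦ F p.1 p.2)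
    (hint : Integrable (fun ω ↦ F (Z ω) ω) P) :
    (fun ω ↦ ∫ ω', F (Z ω) ω' ∂P) =ᵐ[P] P[fun ω ↦ F (Z ω) ω | sigmaOf Z] := by
  have hind : @IndepFun Ω S Ω mΩ mS 𝒢 Z id P := by
    refine (@IndepFun_iff_Indep Ω S Ω mΩ mS 𝒢 Z id P).2 ?_
    have hid : MeasurableSpace.comap id 𝒢 = 𝒢 := MeasurableSpace.comap_id
    rw [hid]
    exact h.symm
  exact @IndepFun.condExp_eq_integral Ω S Ω mΩ mS 𝒢 P _ E _ _ _ Z id hZ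
    (measurable_id'' h𝒢) hind _ hF hint

end Freezing

/-! ### Consequences of conditional independence. -/

section CondIndep

variable {Ω : Type*} {m₁ m₂ m mΩ : MeasurableSpace Ω} {P : Measure Ω} [IsProbabilityMeasure P]

lemma integrable_indicator_one {A : Set Ω} (hA : MeasurableSet A) :
    Integrable (A.indicator fun _ ↦ (1 : ℝ)) P := (integrable_const _).indicator hA

lemma setIntegral_indicator_one {A B : Set Ω} (hA : MeasurableSet A) :
    ∫ ω in B, A.indicator (fun _ ↦ (1 : ℝ)) ω ∂P = P.real (A ∩ B) := by
  exact (integral_indicator_one hA).trans (measureReal_restrict_apply hA)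

lemma CondIndepGiven.measureReal_inter (h₁ : m₁ ≤ mΩ) (h₂ : m₂ ≤ mΩ) (hm : m ≤ mΩ)
    (h : CondIndepGiven P m₁ m₂ m) {A B C : Set Ω} (hA : MeasurableSet[m₁] A)
    (hB : MeasurableSet[m₂] B) (hC : MeasurableSet[m] C) :
    P.real (A ∩ B ∩ C) = ∫ ω in C, (P[A.indicator (fun _ ↦ (1 : ℝ)) | m]) ω *
      (P[B.indicator (fun _ ↦ (1 : ℝ)) | m]) ω ∂P := by
  have hAB : MeasurableSet (A ∩ B) := (h₁ _ hA).inter (h₂ _ hB)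
  rw [← setIntegral_indicator_one hAB, ← setIntegral_condExp hm (integrable_indicator_one hAB) hC]
  exact integral_congr_ae (ae_restrict_of_ae (h A B hA hB))

/-- If `m₁` is independent of `m`, and of `m₂` given `m`, then it is independent of both jointly. -/
lemma CondIndepGiven.measureReal_inter_of_indep (h₁ : m₁ ≤ mΩ) (h₂ : m₂ ≤ mΩ) (hm : m ≤ mΩ)
    (h : CondIndepGiven P m₁ m₂ m) (hind : Indep m₁ m P) {A B C : Set Ω}
    (hA : MeasurableSet[m₁] A) (hB : MeasurableSet[m₂] B) (hC : MeasurableSet[m] C) :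
    P.real (A ∩ B ∩ C) = P.real A * P.real (B ∩ C) := by
  have hA1 : P[A.indicator (fun _ ↦ (1 : ℝ)) | m] =ᵐ[P] fun _ ↦ P.real A := by
    refine (condExp_indep_eq h₁ hm (stronglyMeasurable_const.indicator hA) hind).trans ?_
    exact ae_of_all _ fun _ ↦ integral_indicator_one (h₁ _ hA)
  rw [h.measureReal_inter h₁ h₂ hm hA hB hC, ← setIntegral_indicator_one (h₂ _ hB),
    ← setIntegral_condExp hm (integrable_indicator_one (h₂ _ hB)) hC, ← integral_const_mul]
  refine integral_congr_ae (ae_restrict_of_ae ?_)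
  filter_upwards [hA1] with ω hω
  rw [hω]

lemma condExp_indicator_mem_Icc (hm : m ≤ mΩ) {B : Set Ω} (hB : MeasurableSet B) :
    ∀ᵐ ω ∂P, (P[B.indicator (fun _ ↦ (1 : ℝ)) | m]) ω ∈ Set.Icc (0 : ℝ) 1 := by
  have h0 : 0 ≤ᵐ[P] P[B.indicator (fun _ ↦ (1 : ℝ)) | m] :=
    condExp_nonneg (ae_of_all _ fun ω ↦ Set.indicator_nonneg (fun _ _ ↦ zero_le_one) ω)
  have h1 : P[B.indicator (fun _ ↦ (1 : ℝ)) | m] ≤ᵐ[P] P[fun _ ↦ (1 : ℝ) | m] :=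
    condExp_mono (integrable_indicator_one hB) (integrable_const _)
      (ae_of_all _ fun ω ↦ Set.indicator_le_self' (fun _ _ ↦ zero_le_one) ω)
  rw [condExp_const hm] at h1
  filter_upwards [h0, h1] with ω h h'
  exact ⟨h, h'⟩

/-- Given `m`, a conditionally independent σ-algebra does not change the mean of `U`. -/
lemma CondIndepGiven.setIntegral_inter {H : Type*} [NormedAddCommGroup H] [NormedSpace ℝ H]
    [CompleteSpace H] [SecondCountableTopology H] [MeasurableSpace H] [BorelSpace H]
    (h₂ : m₂ ≤ mΩ) (hm : m ≤ mΩ) {U : Ω → H} (hUm : Measurable U) (hU : Integrable U P)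
    (h : CondIndepGiven P (sigmaOf U) m₂ m) {B C : Set Ω} (hB : MeasurableSet[m₂] B)
    (hC : MeasurableSet[m] C) :
    ∫ ω in B ∩ C, U ω ∂P = ∫ ω in B ∩ C, (P[U | m]) ω ∂P := by
  set q := P[B.indicator (fun _ ↦ (1 : ℝ)) | m] with hq
  have hqm : StronglyMeasurable[m] q := stronglyMeasurable_condExp
  have hqI : Integrable q P := integrable_condExp
  have hq01 := condExp_indicator_mem_Icc (P := P) hm (h₂ _ hB)
  have hqb : ∀ᵐ ω ∂P, ‖q ω‖ ≤ 1 := by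
    filter_upwards [hq01] with ω hω
    rw [Real.norm_of_nonneg hω.1]
    exact hω.2
  have hqU : Integrable (q • U) P := by
    refine hU.norm.mono' (hqI.1.smul hU.1) ?_
    filter_upwards [hqb] with ω hω
    rw [Pi.smul_apply', norm_smul]
    exact mul_le_of_le_one_left (norm_nonneg _) hω
  -- `U` has the same law under `P` restricted to `B ∩ C` and under `P` restricted to `C` with
  -- density `q = P(B | m)`: on events `U ∈ D` this is conditional independence. Integrating the
  -- identity against both laws extends it from events to the vector-valued `U`.
  have hmeas : (P.restrict (B ∩ C)).map U =
      ((P.restrict C).withDensity fun ω ↦ ENNReal.ofReal (q ω)).map U := by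
    ext D hD
    have hD' : MeasurableSet[sigmaOf U] (U ⁻¹' D) := ⟨D, hD, rfl⟩
    have hDm : MeasurableSet (U ⁻¹' D) := hUm hD
    have hDi := integrable_indicator_one (P := P) hDm
    rw [Measure.map_apply hUm hD, Measure.map_apply hUm hD, Measure.restrict_apply hDm,
      withDensity_apply _ hDm, Measure.restrict_restrict hDm,
      ← ofReal_integral_eq_lintegral_ofReal hqI.integrableOn
        (ae_restrict_of_ae (hq01.mono fun _ h ↦ h.1)), ← ofReal_measureReal, ← Set.inter_assoc,
      h.measureReal_inter hUm.comap_le h₂ hm hD' hB hC]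
    congr 1
    have h1 : Integrable ((U ⁻¹' D).indicator (fun _ ↦ (1 : ℝ)) * q) P := by
      refine hqI.norm.mono' (hDi.1.mul hqI.1) (ae_of_all _ fun ω ↦ ?_)
      rw [Pi.mul_apply, norm_mul]
      refine mul_le_of_le_one_left (norm_nonneg _) ?_
      by_cases hω : ω ∈ U ⁻¹' D <;> simp [hω]
    have h2 := condExp_mul_of_aestronglyMeasurable_right (m := m) hqm.aestronglyMeasurable h1 hDi
    have h3 : ∫ ω in C, ((U ⁻¹' D).indicator (fun _ ↦ (1 : ℝ)) * q) ω ∂P =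
        ∫ ω in U ⁻¹' D ∩ C, q ω ∂P := by
      rw [← Measure.restrict_restrict hDm, ← integral_indicator hDm]
      refine integral_congr_ae (ae_of_all _ fun ω ↦ ?_)
      by_cases hω : ω ∈ U ⁻¹' D <;> simp [hω]
    rw [← h3, ← setIntegral_condExp hm h1 hC]
    exact integral_congr_ae (ae_restrict_of_ae h2.symm)
  have h1 : ∫ ω in B ∩ C, U ω ∂P = ∫ ω in C, (q • U) ω ∂P := by
    have e1 := integral_map (μ := P.restrict (B ∩ C)) hUm.aemeasurable
      (f := fun h ↦ h) aestronglyMeasurable_id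
    have e2 := integral_map (μ := (P.restrict C).withDensity fun ω ↦ ENNReal.ofReal (q ω))
      hUm.aemeasurable (f := fun h ↦ h) aestronglyMeasurable_id
    rw [← e1, hmeas, e2, integral_withDensity_eq_integral_toReal_smul₀
      (hqI.1.aemeasurable.ennreal_ofReal.restrict) (ae_of_all _ fun _ ↦ ENNReal.ofReal_lt_top)]
    refine integral_congr_ae (ae_restrict_of_ae ?_)
    filter_upwards [hq01] with ω hω
    rw [ENNReal.toReal_ofReal hω.1, Pi.smul_apply']
  have h2 : ∫ ω in C, (q • U) ω ∂P = ∫ ω in C, (q • P[U | m]) ω ∂P := by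
    rw [← setIntegral_condExp hm hqU hC]
    exact integral_congr_ae (ae_restrict_of_ae
      (condExp_smul_of_aestronglyMeasurable_left hqm.aestronglyMeasurable hqU hU))
  have hBU : Integrable (B.indicator (fun _ ↦ (1 : ℝ)) • P[U | m]) P := by
    refine (integrable_condExp (f := U) (m := m) (μ := P)).norm.mono'
      ((integrable_indicator_one (h₂ _ hB)).1.smul integrable_condExp.1) (ae_of_all _ fun ω ↦ ?_)
    rw [Pi.smul_apply', norm_smul]
    refine mul_le_of_le_one_left (norm_nonneg _) ?_
    by_cases hω : ω ∈ B <;> simp [hω]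
  have h3 : ∫ ω in B ∩ C, (P[U | m]) ω ∂P =
      ∫ ω in C, (B.indicator (fun _ ↦ (1 : ℝ)) • P[U | m]) ω ∂P := by
    rw [← Measure.restrict_restrict (h₂ _ hB), ← integral_indicator (h₂ _ hB)]
    refine integral_congr_ae (ae_of_all _ fun ω ↦ ?_)
    by_cases hω : ω ∈ B <;> simp [hω]
  rw [h1, h2, h3, ← setIntegral_condExp hm hBU hC]
  refine integral_congr_ae (ae_restrict_of_ae ?_)
  exact (condExp_smul_of_aestronglyMeasurable_right (integrable_indicator_one (h₂ _ hB)) hBU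
    (stronglyMeasurable_condExp (f := U) (m := m) (μ := P)).aestronglyMeasurable).symm

/-- Dynkin's π-λ argument. The hypothesis `huniv` serves the complements, since the whole space need
not belong to `p`. -/
lemma setIntegral_eq_of_piSystem {E : Type*} [NormedAddCommGroup E] [NormedSpace ℝ E]
    (hm : m ≤ mΩ) {f g : Ω → E} (hf : Integrable f P) (hg : Integrable g P) {p : Set (Set Ω)}
    (hgen : m = MeasurableSpace.generateFrom p) (hp : IsPiSystem p)
    (huniv : ∫ ω, f ω ∂P = ∫ ω, g ω ∂P) (h : ∀ s ∈ p, ∫ ω in s, f ω ∂P = ∫ ω in s, g ω ∂P)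
    {s : Set Ω} (hs : MeasurableSet[m] s) : ∫ ω in s, f ω ∂P = ∫ ω in s, g ω ∂P := by
  induction s, hs using MeasurableSpace.induction_on_inter hgen hp with
  | empty => simp
  | basic t ht => exact h t ht
  | compl t ht ih =>
    have e1 := integral_add_compl (hm _ ht) hf
    have e2 := integral_add_compl (hm _ ht) hg
    rw [ih] at e1
    exact add_left_cancel (e1.trans (huniv.trans e2.symm))
  | iUnion t hd ht ih =>
    rw [integral_iUnion (fun i ↦ hm _ (ht i)) hd hf.integrableOn,
      integral_iUnion (fun i ↦ hm _ (ht i)) hd hg.integrableOn]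
    exact tsum_congr ih

end CondIndep

/-! ### Passing from rectangles to the σ-algebra of the pair `(X, M)`. -/

section Rectangles

variable {Ω S T : Type*} {𝒢 mΩ : MeasurableSpace Ω} [MeasurableSpace S] [MeasurableSpace T]
  {P : Measure Ω} [IsProbabilityMeasure P]

/-- The inverse images of measurable rectangles. -/
def rectanglePreimages (X : Ω → S) (M : Ω → T) : Set (Set Ω) :=
  {s | ∃ t ∈ Set.image2 (· ×ˢ ·) {s : Set S | MeasurableSet s} {t : Set T | MeasurableSet t},
    (fun ω ↦ (X ω, M ω)) ⁻¹' t = s}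

lemma isPiSystem_rectanglePreimages (X : Ω → S) (M : Ω → T) :
    IsPiSystem (rectanglePreimages X M) := isPiSystem_prod.comap _

lemma generateFrom_rectanglePreimages (X : Ω → S) (M : Ω → T) :
    sigmaOf (fun ω ↦ (X ω, M ω)) = MeasurableSpace.generateFrom (rectanglePreimages X M) := by
  rw [sigmaOf, ← generateFrom_prod, MeasurableSpace.comap_generateFrom]
  rfl

lemma exists_of_mem_rectanglePreimages {X : Ω → S} {M : Ω → T} {s : Set Ω}
    (hs : s ∈ rectanglePreimages X M) :
    ∃ C B, MeasurableSet C ∧ MeasurableSet B ∧ s = X ⁻¹' C ∩ M ⁻¹' B := by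
  obtain ⟨_, ⟨C, hC, B, hB, rfl⟩, rfl⟩ := hs
  exact ⟨C, B, hC, hB, rfl⟩

/-- The contraction property of conditional independence: rectangles form a generating π-system, and
on them the probability factors by `CondIndepGiven.measureReal_inter_of_indep`. -/
lemma CondIndepGiven.indep_prodMk (h𝒢 : 𝒢 ≤ mΩ) {X : Ω → S} {M : Ω → T}
    (hX : Measurable X) (hM : Measurable M) (hind : Indep 𝒢 (sigmaOf X) P)
    (h : CondIndepGiven P 𝒢 (sigmaOf M) (sigmaOf X)) :
    Indep 𝒢 (sigmaOf fun ω ↦ (X ω, M ω)) P := by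
  refine IndepSets.indep h𝒢 (hX.prodMk hM).comap_le
    (@MeasurableSpace.isPiSystem_measurableSet Ω 𝒢) (isPiSystem_rectanglePreimages X M)
    (@MeasurableSpace.generateFrom_measurableSet Ω 𝒢).symm
    (generateFrom_rectanglePreimages X M) ?_
  rw [IndepSets_iff]
  intro A s hA hs
  obtain ⟨C, B, hC, hB, rfl⟩ := exists_of_mem_rectanglePreimages hs
  have h1 := h.measureReal_inter_of_indep h𝒢 hM.comap_le hX.comap_le hind hA ⟨B, hB, rfl⟩
    ⟨C, hC, rfl⟩
  rw [Set.inter_comm (X ⁻¹' C), ← Set.inter_assoc, ← ofReal_measureReal, h1,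
    ENNReal.ofReal_mul measureReal_nonneg, ofReal_measureReal, ofReal_measureReal]

/-- Conditioning on a conditionally independent variable in addition does not change the
conditional expectation. -/
lemma condExp_prodMk_eq {H : Type*} [NormedAddCommGroup H] [NormedSpace ℝ H]
    [CompleteSpace H] [SecondCountableTopology H] [MeasurableSpace H] [BorelSpace H]
    {X : Ω → S} {M : Ω → T} (hX : Measurable X) (hM : Measurable M) {R : Type*}
    [MeasurableSpace R] {N : Ω → R} {U : Ω → H}
    (hN : sigmaOf N ≤ sigmaOf fun ω ↦ (X ω, M ω)) (hU : Integrable U P)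
    (h : ∀ C B, MeasurableSet C → MeasurableSet B → ∫ ω in X ⁻¹' C ∩ M ⁻¹' B, U ω ∂P =
      ∫ ω in X ⁻¹' C ∩ M ⁻¹' B, (P[U | sigmaOf N]) ω ∂P) :
    P[U | sigmaOf N] =ᵐ[P] P[U | sigmaOf fun ω ↦ (X ω, M ω)] := by
  have hle := (hX.prodMk hM).comap_le
  refine ae_eq_condExp_of_forall_setIntegral_eq hle hU
    (fun s _ _ ↦ integrable_condExp.integrableOn) (fun s hs _ ↦ ?_)
    (stronglyMeasurable_condExp.mono hN).aestronglyMeasurable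
  refine (setIntegral_eq_of_piSystem hle hU integrable_condExp
    (generateFrom_rectanglePreimages X M) (isPiSystem_rectanglePreimages X M)
    (integral_condExp (hN.trans hle)).symm (fun t ht ↦ ?_) hs).symm
  obtain ⟨C, B, hC, hB, rfl⟩ := exists_of_mem_rectanglePreimages ht
  exact h C B hC hB

end Rectangles

/-! ### Potential outcomes under ignorability. -/

section PotentialOutcomes

variable {Ω ΩX ΩM ΩY H E : Type*} {𝒢 mΩ : MeasurableSpace Ω} [mX : MeasurableSpace ΩX]
  [mM : MeasurableSpace ΩM] [mY : MeasurableSpace ΩY] {P : Measure Ω} [IsProbabilityMeasure P]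
  {X : Ω → ΩX} {M : Ω → ΩM} {Mpot : ΩX → Ω → ΩM} {Ypot : ΩX → ΩM → Ω → ΩY}
  [NormedAddCommGroup E] [NormedSpace ℝ E] [CompleteSpace E]

lemma measurable_randomFunction (h𝒢 : 𝒢 ≤ mΩ)
    (hM : Measurable[mX.prod 𝒢] fun p : ΩX × Ω ↦ Mpot p.1 p.2) (x : ΩX) : Measurable (Mpot x) :=
  (hM.comp (@measurable_prodMk_left _ _ mX 𝒢 x)).mono h𝒢 le_rfl

lemma measurable_randomFunction_section
    (hY : Measurable[(mX.prod mM).prod 𝒢] fun p : (ΩX × ΩM) × Ω ↦ Ypot p.1.1 p.1.2 p.2) (x : ΩX) :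
    Measurable[mM.prod 𝒢] fun p : ΩM × Ω ↦ Ypot x p.1 p.2 := by
  have h0 : Measurable[mM.prod 𝒢, (mX.prod mM).prod 𝒢] fun p : ΩM × Ω ↦ ((x, p.1), p.2) :=
    @Measurable.prodMk _ (mM.prod 𝒢) _ _ (mX.prod mM) 𝒢 _ _
      (measurable_prodMk_left.comp (@measurable_fst _ _ mM 𝒢)) (@measurable_snd _ _ mM 𝒢)
  exact hY.comp h0

lemma IsIgnorable.measurable_Mpot (h : IsIgnorable P X M Mpot Ypot) (x : ΩX) :
    Measurable (Mpot x) := by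
  obtain ⟨𝒢Y, 𝒢M, h𝒢Y, h𝒢M, hYm, hMm, hYX, hYM, hMX, hYMpot⟩ := h
  exact measurable_randomFunction h𝒢M hMm x

/-- The random function `Y(·, ·)` is independent of the pair `(X, M)`, so conditioning on the pair
freezes the indices. -/
lemma IsIgnorable.condExp_Ypot (h : IsIgnorable P X M Mpot Ypot) (hX : Measurable X)
    (hM : Measurable M) {g : ΩY → E} (hg : StronglyMeasurable g)
    (hint : Integrable (fun ω ↦ g (Ypot (X ω) (M ω) ω)) P) :
    (fun ω ↦ ∫ ω', g (Ypot (X ω) (M ω) ω') ∂P) =ᵐ[P]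
      P[fun ω ↦ g (Ypot (X ω) (M ω) ω) | sigmaOf fun ω ↦ (X ω, M ω)] := by
  obtain ⟨𝒢Y, 𝒢M, h𝒢Y, h𝒢M, hYm, hMm, hYX, hYM, hMX, hYMpot⟩ := h
  exact (hYM.indep_prodMk h𝒢Y hX hM hYX).condExp_randomFunction h𝒢Y (hX.prodMk hM)
    (F := fun p ω ↦ g (Ypot p.1 p.2 ω)) (hg.comp_measurable hYm) hint

lemma IsIgnorable.condExp_Mpot (h : IsIgnorable P X M Mpot Ypot) (hX : Measurable X)
    {g : ΩM → E} (hg : StronglyMeasurable g)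
    (hint : Integrable (fun ω ↦ g (Mpot (X ω) ω)) P) :
    (fun ω ↦ ∫ ω', g (Mpot (X ω) ω') ∂P) =ᵐ[P] P[fun ω ↦ g (Mpot (X ω) ω) | sigmaOf X] := by
  obtain ⟨𝒢Y, 𝒢M, h𝒢Y, h𝒢M, hYm, hMm, hYX, hYM, hMX, hYMpot⟩ := h
  exact hMX.condExp_randomFunction h𝒢M hX (F := fun x ω ↦ g (Mpot x ω)) (hg.comp_measurable hMm)
    hint

/-- This is where the cross-world independence of `Y(·, ·)` and `M(x')` enters. -/
lemma IsIgnorable.integral_nested (h : IsIgnorable P X M Mpot Ypot) {g : ΩY → E}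
    (hg : StronglyMeasurable g) (x x' : ΩX)
    (hint : Integrable (fun ω ↦ g (Ypot x (Mpot x' ω) ω)) P) :
    ∫ ω, g (Ypot x (Mpot x' ω) ω) ∂P =
      ∫ m, ∫ ω, g (Ypot x m ω) ∂P ∂(P.map (Mpot x')) := by
  obtain ⟨𝒢Y, 𝒢M, h𝒢Y, h𝒢M, hYm, hMm, hYX, hYM, hMX, hYMpot⟩ := h
  exact (hYMpot x').integral_randomFunction h𝒢Y (measurable_randomFunction h𝒢M hMm x')
    (F := fun m ω ↦ g (Ypot x m ω)) (hg.comp_measurable (measurable_randomFunction_section hYm x))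
    hint

end PotentialOutcomes

/-! ### Identification of the causal means. -/

namespace MediationModel

variable {Ω ΩX ΩM ΩY H 𝒳 ℳ : Type*} [MeasurableSpace Ω]
  [MetricSpace ΩX] [SecondCountableTopology ΩX] [mX : MeasurableSpace ΩX] [BorelSpace ΩX]
  [MetricSpace ΩM] [SecondCountableTopology ΩM] [mM : MeasurableSpace ΩM] [BorelSpace ΩM]
  [MetricSpace ΩY] [SecondCountableTopology ΩY] [MeasurableSpace ΩY] [BorelSpace ΩY]
  [NormedAddCommGroup H] [InnerProductSpace ℝ H] [CompleteSpace H]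
  [SecondCountableTopology H] [MeasurableSpace H] [BorelSpace H]
  [NormedAddCommGroup 𝒳] [InnerProductSpace ℝ 𝒳] [CompleteSpace 𝒳] [RKHS ℝ 𝒳 ΩX ℝ]
  [NormedAddCommGroup ℳ] [InnerProductSpace ℝ ℳ] [CompleteSpace ℳ] [RKHS ℝ ℳ ΩM ℝ]
  {𝔐 : MediationModel Ω ΩX ΩM ΩY H}

lemma continuous_Phi (hκX : Continuous fun p : ΩX × ΩX ↦ realKernel 𝒳 p.1 p.2) :
    Continuous (𝔐.Phi 𝒳 ℳ) :=
  continuous_const.add ((ContinuousLinearMap.continuous _).comp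
    ((continuous_featureMap hκX).sub continuous_const))

lemma continuous_gam (hκX : Continuous fun p : ΩX × ΩX ↦ realKernel 𝒳 p.1 p.2) :
    Continuous (𝔐.gam 𝒳) :=
  continuous_const.add ((ContinuousLinearMap.continuous _).comp
    ((continuous_featureMap hκX).sub continuous_const))

lemma continuous_Psi (hκM : Continuous fun p : ΩM × ΩM ↦ realKernel ℳ p.1 p.2) :
    Continuous (𝔐.Psi ℳ) :=
  continuous_const.add ((ContinuousLinearMap.continuous _).comp
    ((continuous_featureMap hκM).sub continuous_const))

/-- Under positivity, continuous functions of `(X, M)` that agree almost surely are equal. -/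
lemma Positivity.eq_of_ae_eq (hp : 𝔐.Positivity ℳ) (hb : 𝔐.Basic) {E : Type*}
    [NormedAddCommGroup E] {f g : ΩX × ΩM → E} (hf : Continuous f) (hg : Continuous g)
    (h : ∀ᵐ ω ∂𝔐.P, f (𝔐.X ω, 𝔐.M ω) = g (𝔐.X ω, 𝔐.M ω)) : f = g := by
  have := hp.support
  refine (Continuous.ae_eq_iff_eq (𝔐.P.map fun ω ↦ (𝔐.X ω, 𝔐.M ω)) hf hg).1 ?_
  rw [Filter.EventuallyEq, ae_map_iff (hb.measX.prodMk hb.measM).aemeasurable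
    (isClosed_eq hf hg).measurableSet]
  exact h

/-- Conditional independence allows `X` to be added to the conditioning of `V_I` on `M`, and `M` to
that of `V_D` on `X`, without changing the conditional expectations. -/
lemma condExp_V_eq (hb : 𝔐.Basic) (hdec : 𝔐.Decomposition) (hmom : 𝔐.Moments 𝒳 ℳ)
    (hweak : 𝔐.CondExpEqWeak 𝒳 ℳ) :
    𝔐.P[𝔐.V | sigmaOf fun ω ↦ (𝔐.X ω, 𝔐.M ω)] =ᵐ[𝔐.P]
      fun ω ↦ 𝔐.gam 𝒳 (𝔐.X ω) + 𝔐.Psi ℳ (𝔐.M ω) := by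
  have := hb.isProb
  have hI : 𝔐.P[𝔐.VI | sigmaOf 𝔐.M] =ᵐ[𝔐.P]
      𝔐.P[𝔐.VI | sigmaOf fun ω ↦ (𝔐.X ω, 𝔐.M ω)] := by
    refine condExp_prodMk_eq hb.measX hb.measM ?_ hmom.VI fun C B hC hB ↦
      hdec.condVI.setIntegral_inter hb.measX.comap_le hb.measM.comap_le hb.measVI hmom.VI
        ⟨C, hC, rfl⟩ ⟨B, hB, rfl⟩
    exact (measurable_snd.comp (comap_measurable fun ω ↦ (𝔐.X ω, 𝔐.M ω))).comap_le
  have hD : 𝔐.P[𝔐.VD | sigmaOf 𝔐.X] =ᵐ[𝔐.P]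
      𝔐.P[𝔐.VD | sigmaOf fun ω ↦ (𝔐.X ω, 𝔐.M ω)] := by
    refine condExp_prodMk_eq hb.measX hb.measM ?_ hmom.VD fun C B hC hB ↦ ?_
    · exact (measurable_fst.comp (comap_measurable fun ω ↦ (𝔐.X ω, 𝔐.M ω))).comap_le
    · rw [Set.inter_comm]
      exact hdec.condVD.setIntegral_inter hb.measM.comap_le hb.measX.comap_le hb.measVD hmom.VD
        ⟨B, hB, rfl⟩ ⟨C, hC, rfl⟩
  have hadd : 𝔐.V =ᵐ[𝔐.P] 𝔐.VI + 𝔐.VD := hdec.add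
  filter_upwards [condExp_congr_ae (m := sigmaOf fun ω ↦ (𝔐.X ω, 𝔐.M ω)) hadd,
    condExp_add hmom.VI hmom.VD (sigmaOf fun ω ↦ (𝔐.X ω, 𝔐.M ω)), hI, hD, hweak.VI_M,
    hweak.VD_X] with ω h1 h2 h3 h4 h5 h6
  rw [h1, h2, Pi.add_apply, ← h3, ← h4, h5, h6, add_comm]

/-- The mean of a potential outcome. -/
theorem integral_Vpot_eq (hκX : Continuous fun p : ΩX × ΩX ↦ realKernel 𝒳 p.1 p.2)
    (hκM : Continuous fun p : ΩM × ΩM ↦ realKernel ℳ p.1 p.2) (hb : 𝔐.Basic)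
    (hign : 𝔐.Ignorability) (hρ : Isometry 𝔐.ρ) (hdec : 𝔐.Decomposition)
    (hmom : 𝔐.Moments 𝒳 ℳ) (hweak : 𝔐.CondExpEqWeak 𝒳 ℳ) (hp : 𝔐.Positivity ℳ)
    (x : ΩX) (m : ΩM) :
    ∫ ω, 𝔐.Vpot x m ω ∂𝔐.P = 𝔐.gam 𝒳 x + 𝔐.Psi ℳ m := by
  have := hb.isProb
  have hV : 𝔐.V =ᵐ[𝔐.P] fun ω ↦ 𝔐.Vpot (𝔐.X ω) (𝔐.M ω) ω := by
    filter_upwards [hb.sutvaY] with ω hω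
    rw [MediationModel.V, hω, Vpot]
  have hVi : Integrable 𝔐.V 𝔐.P := (hmom.VI.add hmom.VD).congr (EventuallyEq.symm hdec.add)
  have h := IsIgnorable.condExp_Ypot hign hb.measX hb.measM
    hρ.continuous.measurable.stronglyMeasurable (hVi.congr hV)
  -- At `(X, M)` both functions are versions of `𝔼[V | X, M]`, one by ignorability and one by the
  -- decomposition. Both are continuous, so positivity makes them equal everywhere.
  have heq := hp.eq_of_ae_eq hb (f := fun p ↦ ∫ ω, 𝔐.Vpot p.1 p.2 ω ∂𝔐.P)
    (g := fun p ↦ 𝔐.gam 𝒳 p.1 + 𝔐.Psi ℳ p.2) hp.continuousV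
    (((continuous_gam hκX).comp continuous_fst).add ((continuous_Psi hκM).comp continuous_snd)) (by
      filter_upwards [h, condExp_congr_ae (m := sigmaOf fun ω ↦ (𝔐.X ω, 𝔐.M ω)) hV,
        condExp_V_eq hb hdec hmom hweak] with ω h1 h2 h3
      exact h1.trans (h2.symm.trans h3))
  exact congrFun heq (x, m)

/-- The mean feature of a potential mediator. -/
theorem integral_featureMap_Mpot_eq (hκX : Continuous fun p : ΩX × ΩX ↦ realKernel 𝒳 p.1 p.2)
    (hκM : Continuous fun p : ΩM × ΩM ↦ realKernel ℳ p.1 p.2) (hb : 𝔐.Basic)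
    (hign : 𝔐.Ignorability) (hM : Integrable (𝔐.featM ℳ) 𝔐.P) (hweak : 𝔐.CondExpEqWeak 𝒳 ℳ)
    (hp : 𝔐.Positivity ℳ) (x : ΩX) (m : ΩM) :
    ∫ ω, featureMap ℳ (𝔐.Mpot x ω) ∂𝔐.P = 𝔐.Phi 𝒳 ℳ x := by
  have := hb.isProb
  have hfe : 𝔐.featM ℳ =ᵐ[𝔐.P] fun ω ↦ featureMap ℳ (𝔐.Mpot (𝔐.X ω) ω) := by
    filter_upwards [hb.sutvaM] with ω hω
    rw [featM, hω]
  have h := IsIgnorable.condExp_Mpot hign hb.measX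
    (continuous_featureMap hκM).stronglyMeasurable (hM.congr hfe)
  -- Positivity concerns the joint law, so functions of the exposure alone are viewed on the
  -- product; `m` serves only as a second coordinate.
  have heq := hp.eq_of_ae_eq hb (f := fun p ↦ ∫ ω, featureMap ℳ (𝔐.Mpot p.1 ω) ∂𝔐.P)
    (g := fun p ↦ 𝔐.Phi 𝒳 ℳ p.1) (hp.continuousM.comp continuous_fst)
    ((continuous_Phi hκX).comp continuous_fst) (by
      filter_upwards [h, condExp_congr_ae (m := sigmaOf 𝔐.X) hfe, hweak.M_X] with ω h1 h2 h3
      rw [h1, ← h2, h3])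
  exact congrFun heq (x, m)

/-- Identification of the nested potential outcome means. -/
theorem nestedMean_eq (hκX : Continuous fun p : ΩX × ΩX ↦ realKernel 𝒳 p.1 p.2)
    (hκM : Continuous fun p : ΩM × ΩM ↦ realKernel ℳ p.1 p.2) (hb : 𝔐.Basic)
    (hign : 𝔐.Ignorability) (hρ : Isometry 𝔐.ρ) (hfr : 𝔐.FrechetEmbedding)
    (hdec : 𝔐.Decomposition) (hmom : 𝔐.Moments 𝒳 ℳ) (hM : Integrable (𝔐.featM ℳ) 𝔐.P)
    (hweak : 𝔐.CondExpEqWeak 𝒳 ℳ) (hp : 𝔐.Positivity ℳ) (m : ΩM) (x x' : ΩX) :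
    𝔐.nestedMean x x' = 𝔐.gam 𝒳 x + (∫ ω, 𝔐.VI ω ∂𝔐.P +
      (𝔐.RMV ℳ).adjoint (𝔐.Phi 𝒳 ℳ x' - 𝔐.muM ℳ)) := by
  have := hb.isProb
  have hVpot := integral_Vpot_eq hκX hκM hb hign hρ hdec hmom hweak hp
  have hMpot := integral_featureMap_Mpot_eq hκX hκM hb hign hM hweak hp x' m
  have hZ : Measurable (𝔐.Mpot x') := IsIgnorable.measurable_Mpot hign x'
  have h : 𝔐.nestedMean x x' = ∫ m, ∫ ω, 𝔐.Vpot x m ω ∂𝔐.P ∂(𝔐.P.map (𝔐.Mpot x')) :=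
    IsIgnorable.integral_nested hign hρ.continuous.measurable.stronglyMeasurable x x'
      (hfr.integrable_nested x x')
  have hi := hp.integrableM x'
  have hi2 : Integrable (fun ω ↦ featureMap ℳ (𝔐.Mpot x' ω) - 𝔐.muM ℳ) 𝔐.P :=
    hi.sub (integrable_const _)
  have hi3 : Integrable (fun ω ↦ (𝔐.RMV ℳ).adjoint
    (featureMap ℳ (𝔐.Mpot x' ω) - 𝔐.muM ℳ)) 𝔐.P := ContinuousLinearMap.integrable_comp _ hi2
  have hi4 : Integrable (fun ω ↦ 𝔐.Psi ℳ (𝔐.Mpot x' ω)) 𝔐.P := (integrable_const _).add hi3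
  rw [h]
  simp_rw [hVpot]
  -- `Ψ` is affine in the feature of its argument, so the law of `M(x')` enters only through its
  -- mean feature `Φ(x')`.
  have e : ∫ m, 𝔐.gam 𝒳 x + 𝔐.Psi ℳ m ∂(𝔐.P.map (𝔐.Mpot x')) =
      ∫ ω, 𝔐.gam 𝒳 x + 𝔐.Psi ℳ (𝔐.Mpot x' ω) ∂𝔐.P := integral_map hZ.aemeasurable
    (continuous_const.add (continuous_Psi hκM)).aestronglyMeasurable
  rw [e, integral_add (integrable_const _) hi4]
  simp_rw [Psi]
  rw [integral_add (integrable_const _) hi3, ContinuousLinearMap.integral_comp_comm _ hi2,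
    integral_sub hi (integrable_const _), hMpot]
  simp

end MediationModel

/-! ### Stochastic rates of regularized regressions and their composition. -/

section RegressionRates

variable {Ω S : Type*} [MeasurableSpace Ω] [MeasurableSpace S] {Q : Measure Ω}
  [IsProbabilityMeasure Q] {W : ℕ → Ω → S} {ν : Measure S} [IsProbabilityMeasure ν]
  {E F : Type*} [NormedAddCommGroup E] [InnerProductSpace ℝ E] [CompleteSpace E]
  [TopologicalSpace.SeparableSpace E]
  [NormedAddCommGroup F] [InnerProductSpace ℝ F] [CompleteSpace F]

open scoped InnerProductSpace

/-- The rate of regularized regression. -/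
abbrev regRate (ε : ℕ → ℝ) (η : ℝ) (n : ℕ) : ℝ :=
  (ε n)⁻¹ * (n : ℝ) ^ (-(1 / 2) : ℝ) + ε n ^ η

/-- A population regression operator `R`, with `C = R T` for the cross-covariance `C` and the
covariance `T`, and with bias of order `ε ^ η`. -/
structure HasRegressionBias (T : E →L[ℝ] E) (C R : E →L[ℝ] F) (η : ℝ) (K : ℝ) : Prop where
  nonneg : ∀ x, 0 ≤ ⟪T x, x⟫_ℝ
  eq_comp : C = R ∘L T
  bias_le : ∀ ε, 0 < ε → regBias T R ε ≤ ε ^ η * K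

lemma HasRegressionBias.bound_nonneg {T : E →L[ℝ] E} {C R : E →L[ℝ] F} {η K : ℝ}
    (h : HasRegressionBias T C R η K) : 0 ≤ K := by
  have := h.bias_le 1 one_pos
  rw [Real.one_rpow, one_mul, regBias, one_mul] at this
  exact (norm_nonneg _).trans this

lemma HasRegressionOp.hasRegressionBias {T : E →L[ℝ] E} {C : F →L[ℝ] E} {C' : E →L[ℝ] F}
    (h : HasRegressionOp T C) (hT : ∀ x, 0 ≤ ⟪T x, x⟫_ℝ)
    (hsymm : ∀ x y, ⟪T x, y⟫_ℝ = ⟪x, T y⟫_ℝ) (hC : ∀ x v, ⟪C' x, v⟫_ℝ = ⟪x, C v⟫_ℝ) {η : ℝ}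
    (hη : η ∈ Set.Ioc (0 : ℝ) 1) {S : F →L[ℝ] E} (hS : ∀ v, C v = opPow T (1 + η) (S v)) :
    HasRegressionBias T C' (regressionOp T C).adjoint η ‖S‖ :=
  ⟨hT, h.adjoint_eq hsymm hC, fun _ hε ↦ h.regBias_le hT hsymm hη hS hε⟩

lemma HasRegressionBias.norm_empRegression_sub_le {T : E →L[ℝ] E} {C R : E →L[ℝ] F} {η K : ℝ}
    (h : HasRegressionBias T C R η K) {ε : ℕ → ℝ} (hε : ∀ n, 0 < ε n) {c : ℝ} {n : ℕ}
    {A : ℕ → E} {B : ℕ → F} (h1 : ‖empCov n A A - T‖ ≤ c * (n : ℝ) ^ (-(1 / 2) : ℝ))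
    (h2 : ‖empCov n B A - C‖ ≤ c * (n : ℝ) ^ (-(1 / 2) : ℝ)) (hc : 0 ≤ c) :
    ‖empRegression n (ε n) A B - R‖ ≤ (K + (c + 2 * ‖R‖ * c)) * regRate ε η n := by
  have hK := h.bound_nonneg
  have hεn := hε n
  have hi : 0 ≤ (ε n)⁻¹ * (n : ℝ) ^ (-(1 / 2) : ℝ) := by positivity
  have hp : 0 ≤ ε n ^ η := by positivity
  have h3 := norm_regularized_regression_sub_le (C' := empCov n B A) h.eq_comp h.nonneg
    (inner_empCov_self_nonneg n A) hεn
  have h4 := h.bias_le _ hεn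
  calc ‖empRegression n (ε n) A B - R‖
      ≤ regBias T R (ε n) + (‖empCov n B A - C‖ + 2 * ‖R‖ * ‖empCov n A A - T‖) * (ε n)⁻¹ := h3
    _ ≤ ε n ^ η * K + (c * (n : ℝ) ^ (-(1 / 2) : ℝ) +
          2 * ‖R‖ * (c * (n : ℝ) ^ (-(1 / 2) : ℝ))) * (ε n)⁻¹ := by gcongr
    _ = K * ε n ^ η + (c + 2 * ‖R‖ * c) * ((ε n)⁻¹ * (n : ℝ) ^ (-(1 / 2) : ℝ)) := by ring
    _ ≤ K * regRate ε η n + (c + 2 * ‖R‖ * c) * regRate ε η n := by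
        gcongr <;> unfold regRate <;> linarith
    _ = _ := by ring

/-- The regularized regression operator, applied to a fixed vector. -/
lemma IsIIDSample.isBigO_empRegression_apply (hW : IsIIDSample Q W ν) {a : S → E} {b : S → F}
    (ha : MemLp a 4 ν) (hb : MemLp b 4 ν) {R : E →L[ℝ] F} {η K : ℝ}
    (h : HasRegressionBias (crossCov ν a a) (crossCov ν b a) R η K) {ε : ℕ → ℝ}
    (hε : ∀ n, 0 < ε n) (t : E) :
    IsBigOInProbability Q (fun n ω ↦ ‖empRegression n (ε n) (fun i ↦ a (W i ω))
      (fun i ↦ b (W i ω)) t - R t‖) (regRate ε η) := by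
  refine ((hW.isBigO_empCov ha ha).add (hW.isBigO_empCov hb ha)).of_imp (fun n ↦ by positivity)
    fun c hc ↦ ⟨(K + (c + 2 * ‖R‖ * c)) * ‖t‖, Eventually.of_forall fun n ω hω ↦ ?_⟩
  rw [abs_of_nonneg (by positivity)] at hω
  have h1 := norm_nonneg (empCov n (fun i ↦ a (W i ω)) (fun i ↦ a (W i ω)) - crossCov ν a a)
  have h2 := norm_nonneg (empCov n (fun i ↦ b (W i ω)) (fun i ↦ a (W i ω)) - crossCov ν b a)
  have h3 := h.norm_empRegression_sub_le hε (c := c) (n := n) (A := fun i ↦ a (W i ω))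
    (B := fun i ↦ b (W i ω)) (by linarith) (by linarith) hc
  rw [abs_of_nonneg (norm_nonneg _), ← sub_apply, mul_right_comm]
  exact (ContinuousLinearMap.le_opNorm _ _).trans (mul_le_mul_of_nonneg_right h3 (norm_nonneg _))

/-- Once `ε ≤ 1`, the root-`n` errors of the sample means are absorbed into the regression rate. The
convergence of `ε` to zero is needed for nothing else, hence not for the effect estimators, in which
no sample mean is added or subtracted outside the covariances. -/
lemma eventually_rate_le {ε : ℕ → ℝ} (hε : ∀ n, 0 < ε n) (hε0 : Tendsto ε atTop (𝓝 0)) (η : ℝ) :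
    ∀ᶠ n : ℕ in atTop, (n : ℝ) ^ (-(1 / 2) : ℝ) ≤ 1 ∧
      (n : ℝ) ^ (-(1 / 2) : ℝ) ≤ regRate ε η n := by
  filter_upwards [eventually_ne_atTop 0, hε0.eventually_le_const one_pos] with n hn h1
  have hn0 : 0 ≤ (n : ℝ) ^ (-(1 / 2) : ℝ) := by positivity
  refine ⟨Real.rpow_le_one_of_one_le_of_nonpos
    (by exact_mod_cast Nat.one_le_iff_ne_zero.2 hn) (by norm_num), ?_⟩
  have h2 : 0 ≤ ε n ^ η := Real.rpow_nonneg (hε n).le _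
  have h3 : 1 * (n : ℝ) ^ (-(1 / 2) : ℝ) ≤ (ε n)⁻¹ * (n : ℝ) ^ (-(1 / 2) : ℝ) :=
    mul_le_mul_of_nonneg_right ((one_le_inv₀ (hε n)).2 h1) hn0
  unfold regRate
  linarith

/-- The regularized regression estimate of a conditional mean, at a fixed point. -/
lemma IsIIDSample.isBigO_empRegression_affine (hW : IsIIDSample Q W ν) {a : S → E} {b : S → F}
    (ha : MemLp a 4 ν) (hb : MemLp b 4 ν) {R : E →L[ℝ] F} {η K : ℝ}
    (h : HasRegressionBias (crossCov ν a a) (crossCov ν b a) R η K) {ε : ℕ → ℝ}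
    (hε : ∀ n, 0 < ε n) (hε0 : Tendsto ε atTop (𝓝 0)) (t : E) :
    IsBigOInProbability Q (fun n ω ↦ ‖empMean n (fun i ↦ b (W i ω)) +
      empRegression n (ε n) (fun i ↦ a (W i ω)) (fun i ↦ b (W i ω))
        (t - empMean n (fun i ↦ a (W i ω))) - (∫ s, b s ∂ν + R (t - ∫ s, a s ∂ν))‖)
      (regRate ε η) := by
  have ha2 : MemLp a 2 ν := ha.mono_exponent (by norm_num)
  have hb2 : MemLp b 2 ν := hb.mono_exponent (by norm_num)
  refine ((((hW.isBigO_empCov ha ha).add (hW.isBigO_empCov hb ha)).add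
    (hW.isBigO_empMean ha2)).add (hW.isBigO_empMean hb2)).of_imp (fun n ↦ by positivity)
    fun c hc ↦ ⟨c + (K + (c + 2 * ‖R‖ * c)) * (‖t - ∫ s, a s ∂ν‖ + c) + ‖R‖ * c, ?_⟩
  filter_upwards [eventually_rate_le hε hε0 η] with n ⟨hn1, hn2⟩ ω hω
  have hK := h.bound_nonneg
  have hr : 0 ≤ regRate ε η n := le_trans (by positivity) hn2
  rw [abs_of_nonneg (by positivity)] at hω
  have h1 := norm_nonneg (empCov n (fun i ↦ a (W i ω)) (fun i ↦ a (W i ω)) - crossCov ν a a)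
  have h2 := norm_nonneg (empCov n (fun i ↦ b (W i ω)) (fun i ↦ a (W i ω)) - crossCov ν b a)
  have h3 := norm_nonneg (empMean n (fun i ↦ a (W i ω)) - ∫ s, a s ∂ν)
  have h4 := norm_nonneg (empMean n (fun i ↦ b (W i ω)) - ∫ s, b s ∂ν)
  have h5 := h.norm_empRegression_sub_le hε (c := c) (n := n) (A := fun i ↦ a (W i ω))
    (B := fun i ↦ b (W i ω)) (by linarith) (by linarith) hc
  set R' := empRegression n (ε n) (fun i ↦ a (W i ω)) (fun i ↦ b (W i ω))
  set α := empMean n (fun i ↦ a (W i ω))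
  set β := empMean n (fun i ↦ b (W i ω))
  have hα : ‖α - ∫ s, a s ∂ν‖ ≤ c * (n : ℝ) ^ (-(1 / 2) : ℝ) := by linarith
  have hβ : ‖β - ∫ s, b s ∂ν‖ ≤ c * (n : ℝ) ^ (-(1 / 2) : ℝ) := by linarith
  have hα1 : ‖α - ∫ s, a s ∂ν‖ ≤ c := hα.trans (mul_le_of_le_one_right hc hn1)
  -- The three terms are the error of the outcome mean, the operator error at the empirically
  -- centred point, and the shift of the centring seen through `R`.
  have e : β + R' (t - α) - (∫ s, b s ∂ν + R (t - ∫ s, a s ∂ν)) = (β - ∫ s, b s ∂ν) +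
      (R' - R) ((t - ∫ s, a s ∂ν) - (α - ∫ s, a s ∂ν)) - R (α - ∫ s, a s ∂ν) := by
    simp only [sub_apply, map_sub]
    abel
  rw [abs_of_nonneg (norm_nonneg _), e]
  calc ‖(β - ∫ s, b s ∂ν) + (R' - R) ((t - ∫ s, a s ∂ν) - (α - ∫ s, a s ∂ν)) -
        R (α - ∫ s, a s ∂ν)‖
      ≤ ‖β - ∫ s, b s ∂ν‖ + ‖R' - R‖ * (‖t - ∫ s, a s ∂ν‖ + ‖α - ∫ s, a s ∂ν‖) +
          ‖R‖ * ‖α - ∫ s, a s ∂ν‖ := by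
        refine (norm_sub_le _ _).trans (add_le_add ((norm_add_le _ _).trans
          (add_le_add_right ?_ _)) (R.le_opNorm _))
        exact ((R' - R).le_opNorm _).trans
          (mul_le_mul_of_nonneg_left (norm_sub_le _ _) (norm_nonneg _))
    _ ≤ c * regRate ε η n + (K + (c + 2 * ‖R‖ * c)) * regRate ε η n *
          (‖t - ∫ s, a s ∂ν‖ + c) + ‖R‖ * (c * regRate ε η n) := by
        have h6 : c * (n : ℝ) ^ (-(1 / 2) : ℝ) ≤ c * regRate ε η n :=
          mul_le_mul_of_nonneg_left hn2 hc
        gcongr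
        · exact hβ.trans h6
        · exact hα.trans h6
    _ = _ := by ring

lemma empMean_toLp (n : ℕ) (A : ℕ → E) (B : ℕ → F) :
    empMean n (fun i ↦ WithLp.toLp 2 (A i, B i)) =
      WithLp.toLp 2 (empMean n A, empMean n B) := by
  have h : ∑ i ∈ Finset.range n, WithLp.toLp 2 (A i, B i) =
      WithLp.toLp 2 (∑ i ∈ Finset.range n, A i, ∑ i ∈ Finset.range n, B i) := by
    induction n with
    | zero => rfl
    | succ n ih => rw [Finset.sum_range_succ, ih, Finset.sum_range_succ, Finset.sum_range_succ]; rfl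
  rw [empMean, h]
  rfl

/-- The first block column of the joint empirical covariance contains both operators of the first
regression. This links the two regressions in the composition. -/
lemma empCov_toLp_apply_fst (n : ℕ) (A : ℕ → E) (B : ℕ → F) (h : E) :
    empCov n (fun i ↦ WithLp.toLp 2 (A i, B i)) (fun i ↦ WithLp.toLp 2 (A i, B i))
      (WithLp.toLp 2 (h, 0)) = WithLp.toLp 2 (empCov n A A h, empCov n B A h) := by
  have h1 : ∀ i, tensorOp (WithLp.toLp 2 (A i, B i) - WithLp.toLp 2 (empMean n A, empMean n B))
      (WithLp.toLp 2 (A i, B i) - WithLp.toLp 2 (empMean n A, empMean n B))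
      (WithLp.toLp 2 (h, (0 : F))) = WithLp.toLp 2 (tensorOp (A i - empMean n A)
        (A i - empMean n A) h, tensorOp (B i - empMean n B) (A i - empMean n A) h) := fun i ↦ by
    rw [tensorOp_apply, WithLp.prod_inner_apply]
    simp [tensorOp_apply, ← WithLp.toLp_sub, ← WithLp.toLp_smul]
  have h2 := empMean_toLp n (fun i ↦ tensorOp (A i - empMean n A) (A i - empMean n A) h)
    (fun i ↦ tensorOp (B i - empMean n B) (A i - empMean n A) h)
  simp only [empCov, smul_apply, sum_apply, empMean_toLp, h1]
  exact h2

lemma norm_toLp_fst (h : E) : ‖WithLp.toLp 2 (h, (0 : F))‖ = ‖h‖ := by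
  rw [WithLp.prod_norm_eq_of_L2]
  simp

lemma norm_toLp_snd (h : F) : ‖WithLp.toLp 2 ((0 : E), h)‖ = ‖h‖ := by
  rw [WithLp.prod_norm_eq_of_L2]
  simp

/-- Composition of two regularized regressions. -/
lemma IsIIDSample.isBigO_empRegression_comp {G : Type*} [NormedAddCommGroup G]
    [InnerProductSpace ℝ G] [CompleteSpace G] [TopologicalSpace.SeparableSpace F]
    (hW : IsIIDSample Q W ν) {a : S → E} {b : S → F} {v : S → G}
    (ha : MemLp a 4 ν) (hb : MemLp b 4 ν) (hz : MemLp (fun s ↦ WithLp.toLp 2 (a s, b s)) 4 ν)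
    (hv : MemLp v 4 ν) {R₁ : E →L[ℝ] F} {R₂ : WithLp 2 (E × F) →L[ℝ] G} {η₁ η₂ K₁ K₂ : ℝ}
    (h₁ : HasRegressionBias (crossCov ν a a) (crossCov ν b a) R₁ η₁ K₁)
    (h₂ : HasRegressionBias (crossCov ν (fun s ↦ WithLp.toLp 2 (a s, b s))
      (fun s ↦ WithLp.toLp 2 (a s, b s))) (crossCov ν v (fun s ↦ WithLp.toLp 2 (a s, b s)))
        R₂ η₂ K₂) {ε₁ ε₂ : ℕ → ℝ} (hε₁ : ∀ n, 0 < ε₁ n) (hε₂ : ∀ n, 0 < ε₂ n) (t : E) :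
    IsBigOInProbability Q (fun n ω ↦ ‖empRegression n (ε₂ n)
      (fun i ↦ WithLp.toLp 2 (a (W i ω), b (W i ω))) (fun i ↦ v (W i ω))
        (WithLp.toLp 2 (0, empRegression n (ε₁ n) (fun i ↦ a (W i ω)) (fun i ↦ b (W i ω)) t)) -
          R₂ (WithLp.toLp 2 (0, R₁ t))‖)
      (fun n ↦ regRate ε₂ η₂ n + regRate ε₁ η₁ n) := by
  have : TopologicalSpace.SeparableSpace (WithLp 2 (E × F)) :=
    (WithLp.toLp_surjective 2).denseRange.separableSpace (WithLp.prod_continuous_toLp 2 E F)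
  refine ((((hW.isBigO_empCov ha ha).add (hW.isBigO_empCov hb ha)).add
    (hW.isBigO_empCov hz hz)).add (hW.isBigO_empCov hv hz)).of_imp (fun n ↦ by positivity)
    fun c hc ↦ ⟨‖R₂‖ * ((K₁ + (c + 2 * ‖R₁‖ * c)) * ‖t‖) + (K₂ + ‖R₂‖ * c) * ‖R₁ t‖ +
      (c + ‖R₂‖ * c) * (3 * ‖t‖), Eventually.of_forall fun n ω hω ↦ ?_⟩
  rw [abs_of_nonneg (by positivity)] at hω
  set A := fun i ↦ a (W i ω)
  set B := fun i ↦ b (W i ω)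
  set Z := fun i ↦ WithLp.toLp 2 (a (W i ω), b (W i ω)) with hZ
  set V := fun i ↦ v (W i ω)
  set T := crossCov ν (fun s ↦ WithLp.toLp 2 (a s, b s)) (fun s ↦ WithLp.toLp 2 (a s, b s))
  set C := crossCov ν v (fun s ↦ WithLp.toLp 2 (a s, b s))
  have n1 := norm_nonneg (empCov n A A - crossCov ν a a)
  have n2 := norm_nonneg (empCov n B A - crossCov ν b a)
  have n3 := norm_nonneg (empCov n Z Z - T)
  have n4 := norm_nonneg (empCov n V Z - C)
  have hK₁ := h₁.bound_nonneg
  have hK₂ := h₂.bound_nonneg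
  have e1 := hε₁ n
  have e2 := hε₂ n
  have hAA := inner_empCov_self_nonneg n A
  have hreg := h₁.norm_empRegression_sub_le hε₁ (c := c) (n := n) (A := A) (B := B)
    (by linarith) (by linarith) hc
  set k := empRegression n (ε₁ n) A B t with hk
  set h := tikhonov (empCov n A A) (ε₁ n) t with hh
  -- The joint covariance sends `(h, 0)` to `(t - ε₁ h, k)`, so the input `(0, k)` of the second
  -- regression lies in its range up to controlled terms.
  have hpq : empCov n Z Z (WithLp.toLp 2 (h, 0)) =
      WithLp.toLp 2 (t, 0) - ε₁ n • WithLp.toLp 2 (h, 0) + WithLp.toLp 2 (0, k) := by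
    rw [hZ, empCov_toLp_apply_fst n A B h, hh, apply_tikhonov hAA e1]
    simp only [← WithLp.toLp_sub, ← WithLp.toLp_smul, ← WithLp.toLp_add]
    congr 1
    ext
    · simp
    · simp [hk, empRegression]
  have hp : ‖WithLp.toLp 2 (h, (0 : F))‖ ≤ (ε₁ n)⁻¹ * ‖WithLp.toLp 2 (t, (0 : F))‖ := by
    rw [norm_toLp_fst, norm_toLp_fst]
    exact norm_tikhonov_le hAA e1 t
  have main := norm_regularized_regression_comp_sub_le (C' := empCov n V Z) h₂.eq_comp h₂.nonneg
    (inner_empCov_self_nonneg n Z) e2 e1 (WithLp.toLp 2 (0, R₁ t)) hpq hp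
  have hkk : ‖WithLp.toLp 2 ((0 : E), k) - WithLp.toLp 2 (0, R₁ t)‖ ≤
      (K₁ + (c + 2 * ‖R₁‖ * c)) * regRate ε₁ η₁ n * ‖t‖ := by
    rw [← WithLp.toLp_sub, Prod.mk_sub_mk, sub_zero, norm_toLp_snd, hk, ← sub_apply]
    exact (ContinuousLinearMap.le_opNorm _ _).trans (mul_le_mul_of_nonneg_right hreg (norm_nonneg _))
  rw [norm_toLp_fst, norm_toLp_snd] at main
  set r := (n : ℝ) ^ (-(1 / 2) : ℝ) with hr
  have hr0 : 0 ≤ r := by positivity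
  have hZZ : ‖empCov n Z Z - T‖ ≤ c * r := by linarith
  have hVZ : ‖empCov n V Z - C‖ ≤ c * r := by linarith
  have hb2 := h₂.bias_le _ e2
  rw [abs_of_nonneg (norm_nonneg _)]
  refine le_trans main ?_
  have p1 : 0 ≤ (ε₁ n)⁻¹ * r := by positivity
  have p2 : 0 ≤ (ε₂ n)⁻¹ * r := by positivity
  have p3 : 0 ≤ ε₁ n ^ η₁ := by positivity
  have p4 : 0 ≤ ε₂ n ^ η₂ := by positivity
  have q1 : regRate ε₁ η₁ n ≤ regRate ε₂ η₂ n + regRate ε₁ η₁ n := by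
    unfold regRate
    linarith
  calc ‖R₂‖ * ‖WithLp.toLp 2 ((0 : E), k) - WithLp.toLp 2 (0, R₁ t)‖ +
        (regBias T R₂ (ε₂ n) + ‖R₂‖ * ‖empCov n Z Z - T‖ * (ε₂ n)⁻¹) * ‖R₁ t‖ +
        (‖empCov n V Z - C‖ + ‖R₂‖ * ‖empCov n Z Z - T‖) *
          (((ε₁ n)⁻¹ + 2 * (ε₂ n)⁻¹) * ‖t‖)
      ≤ ‖R₂‖ * ((K₁ + (c + 2 * ‖R₁‖ * c)) * regRate ε₁ η₁ n * ‖t‖) +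
        (ε₂ n ^ η₂ * K₂ + ‖R₂‖ * (c * r) * (ε₂ n)⁻¹) * ‖R₁ t‖ +
        (c * r + ‖R₂‖ * (c * r)) * (((ε₁ n)⁻¹ + 2 * (ε₂ n)⁻¹) * ‖t‖) := by gcongr
    _ = ‖R₂‖ * ((K₁ + (c + 2 * ‖R₁‖ * c)) * ‖t‖) * regRate ε₁ η₁ n +
        (K₂ * ε₂ n ^ η₂ + ‖R₂‖ * c * ((ε₂ n)⁻¹ * r)) * ‖R₁ t‖ +
        (c + ‖R₂‖ * c) * ((ε₁ n)⁻¹ * r + 2 * ((ε₂ n)⁻¹ * r)) * ‖t‖ := by ring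
    _ ≤ ‖R₂‖ * ((K₁ + (c + 2 * ‖R₁‖ * c)) * ‖t‖) * (regRate ε₂ η₂ n + regRate ε₁ η₁ n) +
        (K₂ * (regRate ε₂ η₂ n + regRate ε₁ η₁ n) +
          ‖R₂‖ * c * (regRate ε₂ η₂ n + regRate ε₁ η₁ n)) * ‖R₁ t‖ +
        (c + ‖R₂‖ * c) * (3 * (regRate ε₂ η₂ n + regRate ε₁ η₁ n)) * ‖t‖ := by
        have q2 : ε₂ n ^ η₂ ≤ regRate ε₂ η₂ n + regRate ε₁ η₁ n := by
          unfold regRate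
          linarith
        have q3 : (ε₂ n)⁻¹ * r ≤ regRate ε₂ η₂ n + regRate ε₁ η₁ n := by
          unfold regRate
          linarith
        have q4 : (ε₁ n)⁻¹ * r + 2 * ((ε₂ n)⁻¹ * r) ≤
            3 * (regRate ε₂ η₂ n + regRate ε₁ η₁ n) := by
          unfold regRate
          linarith
        gcongr
    _ = _ := by ring

end RegressionRates

/-! ### Adjoint of the joint regression operator and mean of the joint feature. -/

namespace MediationModel

variable {Ω ΩX ΩM ΩY H 𝒳 ℳ : Type*} [MeasurableSpace Ω]
  [MetricSpace ΩX] [SecondCountableTopology ΩX] [mX : MeasurableSpace ΩX] [BorelSpace ΩX]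
  [MetricSpace ΩM] [SecondCountableTopology ΩM] [mM : MeasurableSpace ΩM] [BorelSpace ΩM]
  [MetricSpace ΩY] [SecondCountableTopology ΩY] [MeasurableSpace ΩY] [BorelSpace ΩY]
  [NormedAddCommGroup H] [InnerProductSpace ℝ H] [CompleteSpace H]
  [SecondCountableTopology H] [MeasurableSpace H] [BorelSpace H]
  [NormedAddCommGroup 𝒳] [InnerProductSpace ℝ 𝒳] [CompleteSpace 𝒳] [RKHS ℝ 𝒳 ΩX ℝ]
  [NormedAddCommGroup ℳ] [InnerProductSpace ℝ ℳ] [CompleteSpace ℳ] [RKHS ℝ ℳ ΩM ℝ]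
  {𝔐 : MediationModel Ω ΩX ΩM ΩY H}

open scoped InnerProductSpace

lemma adjoint_regressionOp_covZV_apply
    (h : ∀ v, regressionOp (𝔐.covZZ 𝒳 ℳ) (𝔐.covZV 𝒳 ℳ) v =
      WithLp.toLp 2 (𝔐.RXV 𝒳 v, 𝔐.RMV ℳ v)) (f : 𝒳) (g : ℳ) :
    (regressionOp (𝔐.covZZ 𝒳 ℳ) (𝔐.covZV 𝒳 ℳ)).adjoint (WithLp.toLp 2 (f, g)) =
      (𝔐.RXV 𝒳).adjoint f + (𝔐.RMV ℳ).adjoint g := by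
  refine ext_inner_right ℝ fun v ↦ ?_
  rw [ContinuousLinearMap.adjoint_inner_left, h, inner_add_left,
    ContinuousLinearMap.adjoint_inner_left, ContinuousLinearMap.adjoint_inner_left,
    WithLp.prod_inner_apply]

lemma integral_featZ_eq (hX : Integrable (𝔐.featX 𝒳) 𝔐.P) (hM : Integrable (𝔐.featM ℳ) 𝔐.P)
    (hZ : Integrable (𝔐.featZ 𝒳 ℳ) 𝔐.P) :
    ∫ ω, 𝔐.featZ 𝒳 ℳ ω ∂𝔐.P = WithLp.toLp 2 (𝔐.muX 𝒳, 𝔐.muM ℳ) := by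
  refine ext_inner_left ℝ fun z ↦ ?_
  rw [inner_integral_featZ hX hM hZ, WithLp.prod_inner_apply]
  rfl

end MediationModel

end

/-! ### The four rates. -/

theorem theorem1
    {Ω ΩX ΩM ΩY H 𝒳 ℳ Ω' : Type*} [MeasurableSpace Ω]
    -- separable metric spaces for the exposure, the mediator and the outcome
    [MetricSpace ΩX] [TopologicalSpace.SeparableSpace ΩX] [MeasurableSpace ΩX] [BorelSpace ΩX]
    [MetricSpace ΩM] [TopologicalSpace.SeparableSpace ΩM] [MeasurableSpace ΩM] [BorelSpace ΩM]
    [MetricSpace ΩY] [TopologicalSpace.SeparableSpace ΩY] [MeasurableSpace ΩY] [BorelSpace ΩY]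
    -- the separable Hilbert space in which the outcomes are embedded
    [NormedAddCommGroup H] [InnerProductSpace ℝ H] [CompleteSpace H]
    [TopologicalSpace.SeparableSpace H] [MeasurableSpace H] [BorelSpace H]
    -- separable reproducing kernel Hilbert spaces with continuous kernels
    [NormedAddCommGroup 𝒳] [InnerProductSpace ℝ 𝒳] [CompleteSpace 𝒳] [RKHS ℝ 𝒳 ΩX ℝ]
    [TopologicalSpace.SeparableSpace 𝒳]
    [NormedAddCommGroup ℳ] [InnerProductSpace ℝ ℳ] [CompleteSpace ℳ] [RKHS ℝ ℳ ΩM ℝ]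
    [TopologicalSpace.SeparableSpace ℳ]
    (hκX : Continuous fun p : ΩX × ΩX => realKernel 𝒳 p.1 p.2)
    (hκM : Continuous fun p : ΩM × ΩM => realKernel ℳ p.1 p.2)
    -- the mediation model
    (𝔐 : MediationModel Ω ΩX ΩM ΩY H)
    (hbasic : 𝔐.Basic) (hign : 𝔐.Ignorability)
    (hρ : Isometry 𝔐.ρ) (hfr : 𝔐.FrechetEmbedding)
    (hdec : 𝔐.Decomposition) (hmom : 𝔐.Moments 𝒳 ℳ) (hmom4 : 𝔐.FourthMoments 𝒳 ℳ)
    (hran : 𝔐.Ranges 𝒳 ℳ) (hweak : 𝔐.CondExpEqWeak 𝒳 ℳ)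
    (hres : 𝔐.ResidualIndep 𝒳 ℳ)
    (η η' : ℝ) (hη : η ∈ Set.Ioc (0 : ℝ) 1) (hη' : η' ∈ Set.Ioc (0 : ℝ) 1)
    (hsmooth : 𝔐.Smoothness 𝒳 ℳ η η')
    -- an i.i.d. sample of copies of `(X, M, Y)`
    [MeasurableSpace Ω'] (Q : Measure Ω') [IsProbabilityMeasure Q]
    (X : ℕ → Ω' → ΩX) (M : ℕ → Ω' → ΩM) (Y : ℕ → Ω' → ΩY)
    (hindep : iIndepFun (fun i ω => (X i ω, M i ω, Y i ω)) Q)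
    (hident : ∀ i, IdentDistrib (fun ω => (X i ω, M i ω, Y i ω))
      (fun ω => (𝔐.X ω, 𝔐.M ω, 𝔐.Y ω)) Q 𝔐.P)
    -- the regularization parameters
    (ε ε' : ℕ → ℝ) (hε : ∀ n, 0 < ε n) (hε' : ∀ n, 0 < ε' n)
    (hε0 : Tendsto ε atTop (𝓝 0)) (hε0' : Tendsto ε' atTop (𝓝 0))
    (x xs : ΩX) (m : ΩM) :
    IsBigOInProbability Q
      (fun n ω => ‖hatPhi 𝒳 ℳ n (ε n) (fun i => X i ω) (fun i => M i ω) x - 𝔐.Phi 𝒳 ℳ x‖)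
      (fun n => (ε n)⁻¹ * (n : ℝ) ^ (-(1 / 2) : ℝ) + ε n ^ η) ∧
    (𝔐.AdditivelyIdentifiable 𝒳 ℳ → IsBigOInProbability Q
      (fun n ω => ‖hatPsiGam 𝒳 ℳ n (ε' n) (fun i => X i ω) (fun i => M i ω)
        (fun i => 𝔐.ρ (Y i ω)) x m - 𝔐.Psi ℳ m - 𝔐.gam 𝒳 x‖)
      (fun n => (ε' n)⁻¹ * (n : ℝ) ^ (-(1 / 2) : ℝ) + ε' n ^ η')) ∧
    (𝔐.Positivity ℳ → IsBigOInProbability Q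
      (fun n ω => ‖hatNDE 𝒳 ℳ n (ε' n) (fun i => X i ω) (fun i => M i ω)
        (fun i => 𝔐.ρ (Y i ω)) x xs - 𝔐.NDE x xs‖)
      (fun n => (ε' n)⁻¹ * (n : ℝ) ^ (-(1 / 2) : ℝ) + ε' n ^ η') ∧
    IsBigOInProbability Q
      (fun n ω => ‖hatNIE 𝒳 ℳ n (ε n) (ε' n) (fun i => X i ω) (fun i => M i ω)
        (fun i => 𝔐.ρ (Y i ω)) x xs - 𝔐.NIE x xs‖)
      (fun n => ((ε' n)⁻¹ * (n : ℝ) ^ (-(1 / 2) : ℝ) + ε' n ^ η') +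
        ((ε n)⁻¹ * (n : ℝ) ^ (-(1 / 2) : ℝ) + ε n ^ η))) := by
  have := UniformSpace.secondCountable_of_separable ΩX
  have := UniformSpace.secondCountable_of_separable ΩM
  have := UniformSpace.secondCountable_of_separable ΩY
  have := UniformSpace.secondCountable_of_separable H
  have := hbasic.isProb
  have hsep : TopologicalSpace.SeparableSpace (MediationModel.JointSpace 𝒳 ℳ) :=
    (WithLp.toLp_surjective 2).denseRange.separableSpace (WithLp.prod_continuous_toLp 2 𝒳 ℳ)
  have hX := MediationModel.memLp_featX hbasic hmom4 hκX
  have hM := MediationModel.memLp_featM hbasic hmom4 hκM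
  have hZ := MediationModel.memLp_featZ hbasic hmom4 hκX hκM
  have hV := MediationModel.memLp_V hbasic hmom4 hρ
  have hXi : Integrable (𝔐.featX 𝒳) 𝔐.P := hX.integrable (by norm_num)
  have hMi : Integrable (𝔐.featM ℳ) 𝔐.P := hM.integrable (by norm_num)
  have hZi : Integrable (𝔐.featZ 𝒳 ℳ) 𝔐.P := hZ.integrable (by norm_num)
  -- Moments and covariances are transported to the law of one observation, where the features of
  -- the model and of the sample become the same functions.
  set ν := 𝔐.P.map (fun ω => (𝔐.X ω, 𝔐.M ω, 𝔐.Y ω)) with hν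
  have hWm : AEMeasurable (fun ω => (𝔐.X ω, 𝔐.M ω, 𝔐.Y ω)) 𝔐.P :=
    (hbasic.measX.prodMk (hbasic.measM.prodMk hbasic.measY)).aemeasurable
  have : IsProbabilityMeasure ν := Measure.isProbabilityMeasure_map hWm
  have hW : IsIIDSample Q (fun i ω => (X i ω, M i ω, Y i ω)) ν :=
    ⟨fun i => (hident i).aemeasurable_fst, fun i => (hident i).map_eq, hindep⟩
  set aX : ΩX × ΩM × ΩY → 𝒳 := fun s => featureMap 𝒳 s.1 with haX
  set aM : ΩX × ΩM × ΩY → ℳ := fun s => featureMap ℳ s.2.1 with haM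
  set aZ : ΩX × ΩM × ΩY → MediationModel.JointSpace 𝒳 ℳ :=
    fun s => WithLp.toLp 2 (aX s, aM s) with haZ
  set aV : ΩX × ΩM × ΩY → H := fun s => 𝔐.ρ s.2.2 with haV
  have mX : AEStronglyMeasurable aX ν :=
    ((continuous_featureMap hκX).comp continuous_fst).aestronglyMeasurable
  have mM : AEStronglyMeasurable aM ν := ((continuous_featureMap hκM).comp
    (continuous_fst.comp continuous_snd)).aestronglyMeasurable
  have mZ : AEStronglyMeasurable aZ ν :=
    (WithLp.prod_continuous_toLp 2 𝒳 ℳ).comp_aestronglyMeasurable (mX.prodMk mM)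
  have mV : AEStronglyMeasurable aV ν :=
    (hρ.continuous.comp (continuous_snd.comp continuous_snd)).aestronglyMeasurable
  have lX : MemLp aX 4 ν := (memLp_map_measure_iff mX hWm).2 hX
  have lM : MemLp aM 4 ν := (memLp_map_measure_iff mM hWm).2 hM
  have lZ : MemLp aZ 4 ν := (memLp_map_measure_iff mZ hWm).2 hZ
  have lV : MemLp aV 4 ν := (memLp_map_measure_iff mV hWm).2 hV
  have cXX : crossCov ν aX aX = 𝔐.covXX 𝒳 := crossCov_map hWm mX mX
  have cMX : crossCov ν aM aX = 𝔐.covMX 𝒳 ℳ := crossCov_map hWm mM mX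
  have cZZ : crossCov ν aZ aZ = 𝔐.covZZ 𝒳 ℳ := crossCov_map hWm mZ mZ
  have cVZ : crossCov ν aV aZ = crossCov 𝔐.P 𝔐.V (𝔐.featZ 𝒳 ℳ) := crossCov_map hWm mV mZ
  have iX : ∫ s, aX s ∂ν = 𝔐.muX 𝒳 := integral_map hWm mX
  have iM : ∫ s, aM s ∂ν = 𝔐.muM ℳ := integral_map hWm mM
  have iZ : ∫ s, aZ s ∂ν = WithLp.toLp 2 (𝔐.muX 𝒳, 𝔐.muM ℳ) :=
    (integral_map hWm mZ).trans (MediationModel.integral_featZ_eq hXi hMi hZi)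
  have iV : ∫ s, aV s ∂ν = ∫ ω, 𝔐.VI ω ∂𝔐.P + ∫ ω, 𝔐.VD ω ∂𝔐.P := by
    rw [← integral_add hmom.VI hmom.VD, ← integral_congr_ae hdec.add]
    exact integral_map hWm mV
  obtain ⟨SZ, hSZ⟩ := hsmooth.ZV
  obtain ⟨SX, hSX⟩ := hsmooth.XM
  have b1 : HasRegressionBias (crossCov ν aX aX) (crossCov ν aM aX) (𝔐.RXM 𝒳 ℳ).adjoint η ‖SX‖ := by
    rw [cXX, cMX]
    exact hran.XM.hasRegressionBias (inner_crossCov_self_nonneg hX) (inner_crossCov_comm hX hX)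
      (inner_crossCov_comm hX hM) hη hSX
  have b2 : HasRegressionBias (crossCov ν aZ aZ) (crossCov ν aV aZ)
      (regressionOp (𝔐.covZZ 𝒳 ℳ) (𝔐.covZV 𝒳 ℳ)).adjoint η' ‖SZ‖ := by
    rw [cZZ, cVZ]
    exact hran.ZV.hasRegressionBias (inner_crossCov_self_nonneg hZ) (inner_crossCov_comm hZ hZ)
      (inner_crossCov_comm hZ hV) hη' hSZ
  -- `b2` gives rates towards the joint operator `R_ZV` without identifiability, which is needed
  -- only to split this limit into its exposure and mediator parts.
  have hR : 𝔐.AdditivelyIdentifiable 𝒳 ℳ → ∀ f g,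
      (regressionOp (𝔐.covZZ 𝒳 ℳ) (𝔐.covZV 𝒳 ℳ)).adjoint (WithLp.toLp 2 (f, g)) =
        (𝔐.RXV 𝒳).adjoint f + (𝔐.RMV ℳ).adjoint g := fun hid =>
    MediationModel.adjoint_regressionOp_covZV_apply (MediationModel.regressionOp_covZV_eq hκX hκM
      hbasic hρ hdec hmom hmom4 hran hweak hres hid)
  refine ⟨?_, fun hid => ?_, fun hp => ⟨?_, ?_⟩⟩
  · have h := hW.isBigO_empRegression_affine lX lM b1 hε hε0 (featureMap 𝒳 x)
    rw [iX, iM] at h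
    exact h
  · have h := hW.isBigO_empRegression_affine lZ lV b2 hε' hε0'
      (WithLp.toLp 2 (featureMap 𝒳 x, featureMap ℳ m))
    rw [iZ, iV, ← WithLp.toLp_sub, Prod.mk_sub_mk, hR hid] at h
    have e : ∫ ω, 𝔐.VI ω ∂𝔐.P + ∫ ω, 𝔐.VD ω ∂𝔐.P +
        ((𝔐.RXV 𝒳).adjoint (featureMap 𝒳 x - 𝔐.muX 𝒳) +
          (𝔐.RMV ℳ).adjoint (featureMap ℳ m - 𝔐.muM ℳ)) = 𝔐.Psi ℳ m + 𝔐.gam 𝒳 x := by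
      rw [MediationModel.Psi, MediationModel.gam]
      abel
    rw [e] at h
    simp_rw [sub_sub]
    exact h
  · have hid := hp.additivelyIdentifiable (𝒳 := 𝒳) hκX hκM hbasic m
    have h := hW.isBigO_empRegression_apply lZ lV b2 hε'
      (WithLp.toLp 2 (featureMap 𝒳 x - featureMap 𝒳 xs, 0))
    -- Both nested means use `M(x)`, so the mediator terms cancel.
    have e : (𝔐.RXV 𝒳).adjoint (featureMap 𝒳 x - featureMap 𝒳 xs) + (𝔐.RMV ℳ).adjoint 0 =
        𝔐.NDE x xs := by
      rw [MediationModel.NDE, MediationModel.nestedMean_eq hκX hκM hbasic hign hρ hfr hdec hmom hMi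
        hweak hp m, MediationModel.nestedMean_eq hκX hκM hbasic hign hρ hfr hdec hmom hMi
        hweak hp m, MediationModel.gam, MediationModel.gam]
      simp only [map_sub, map_zero]
      abel
    rw [hR hid, e] at h
    exact h
  · have hid := hp.additivelyIdentifiable (𝒳 := 𝒳) hκX hκM hbasic m
    have h := hW.isBigO_empRegression_comp lX lM lZ lV b1 b2 hε hε'
      (featureMap 𝒳 x - featureMap 𝒳 xs)
    -- Both nested means use the outcome at `xs`, so the `γ` terms cancel and the difference of `Φ`
    -- at the two exposures remains.
    have e : (𝔐.RXV 𝒳).adjoint 0 + (𝔐.RMV ℳ).adjoint ((𝔐.RXM 𝒳 ℳ).adjoint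
        (featureMap 𝒳 x - featureMap 𝒳 xs)) = 𝔐.NIE x xs := by
      rw [MediationModel.NIE, MediationModel.nestedMean_eq hκX hκM hbasic hign hρ hfr hdec hmom hMi
        hweak hp m, MediationModel.nestedMean_eq hκX hκM hbasic hign hρ hfr hdec hmom hMi
        hweak hp m, MediationModel.Phi, MediationModel.Phi]
      simp only [map_sub, map_zero, map_add]
      abel
    rw [hR hid, e] at h
    exact h
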